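/- **Theorem 1.1.** Let $(M^4,J,g)$ be a connected, complete Kähler manifold of real dimension $4$ (complex dimension $2$) with Kähler form $\omega(\cdot,\cdot)=g(J\cdot,\cdot)$, and let $V$ be a smooth vector field on $M^4$ which is Killing and symplectomorphic, i.e. $\mathcal{L}_Vg=0$ and $\mathcal{L}_V\omega=0$. Let $\mathcal{D}=\{v\in TM^4 : \omega(v,V)=0\}$. For $p\in M^4$, the integral leaf of $\mathcal{D}$ through $p$ is the set of all points of $M^4$ that can be joined to $p$ by a piecewise $C^1$ curve whose velocity lies in $\mathcal{D}$ at all times (at a zero of $V$ the condition is empty, so a leaf may contain zeros of $V$; where locally $dz=-i_V\omega$, the function $z$ is constant along such curves). Assume that there are a compact set $K\subset M^4$ and a number $\epsilon>0$ such that $|V|>\epsilon$ on $M^4\setminus K$. Then either every integral leaf of $\mathcal{D}$ is a compact subset of $M^4$, or every integral leaf is non-compact. -/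

import Mathlib

open Bundle Set
open scoped Manifold ContDiff

noncomputable section

namespace Kahler

variable {E : Type*} [NormedAddCommGroup E] [NormedSpace ℂ E]

/-- A complex manifold is in particular a smooth real manifold. -/
instance isManifold_real {M : Type*} [TopologicalSpace M] [ChartedSpace E M]
    [IsManifold 𝓘(ℂ, E) ω M] : IsManifold 𝓘(ℝ, E) ∞ M := by
  refine isManifold_of_contDiffOn 𝓘(ℝ, E) ∞ M fun e e' he he' => ?_
  have h1 := (mem_groupoid_of_pregroupoid.1
    (HasGroupoid.compatible (G := contDiffGroupoid ω 𝓘(ℂ, E)) he he')).1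
  have h2 : ContDiffOn ℂ ω (e.symm ≫ₕ e') (e.symm ≫ₕ e').source := by
    simpa [contDiffPregroupoid] using h1
  simpa using (h2.restrict_scalars ℝ).of_le le_top

variable {M : Type*} [TopologicalSpace M] [ChartedSpace E M] [IsManifold 𝓘(ℂ, E) ω M]

/-- A (real) tangent vector field on the complex manifold `M`. -/
abbrev VField (E M : Type*) [NormedAddCommGroup E] [NormedSpace ℂ E]
    [TopologicalSpace M] [ChartedSpace E M] : Type _ :=
  (x : M) → TangentSpace 𝓘(ℝ, E) x

/-- The vector field `X` is smooth at (that is, near) the point `x`. -/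
def SmoothAt (X : VField E M) (x : M) : Prop :=
  ContMDiffAt 𝓘(ℝ, E) 𝓘(ℝ, E).tangent ∞
    (fun y => (⟨y, X y⟩ : TangentBundle 𝓘(ℝ, E) M)) x

/-- The derivative of the function `f` at `x` along the tangent vector `v`. -/
def dirDeriv (f : M → ℝ) (x : M) (v : TangentSpace 𝓘(ℝ, E) x) : ℝ :=
  mfderiv 𝓘(ℝ, E) 𝓘(ℝ, ℝ) f x v

/-- The complex structure `J` on the tangent space at `x`: multiplication by `i` in a holomorphic
chart (on a complex manifold it does not matter which one). -/
def J (x : M) : TangentSpace 𝓘(ℝ, E) x →L[ℝ] TangentSpace 𝓘(ℝ, E) x :=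
  ((Complex.I • ContinuousLinearMap.id ℂ E).restrictScalars ℝ : E →L[ℝ] E)

/-- The field `B` of bilinear forms has vanishing Lie derivative along `V`: for all
vector fields `X`, `Y`, `V(B(X, Y)) = B([V, X], Y) + B(X, [V, Y])`. -/
def LieDerivEqZero (V : VField E M)
    (B : (x : M) → TangentSpace 𝓘(ℝ, E) x → TangentSpace 𝓘(ℝ, E) x → ℝ) : Prop :=
  ∀ (X Y : VField E M) (x : M), SmoothAt X x → SmoothAt Y x →
    dirDeriv (fun y => B y (X y) (Y y)) x (V x) =
      B x (VectorField.mlieBracket 𝓘(ℝ, E) V X x) (Y x) +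
      B x (X x) (VectorField.mlieBracket 𝓘(ℝ, E) V Y x)

/-- The field `B` of alternating bilinear forms is a closed 2-form: for all vector fields
`X`, `Y`, `Z`,
`X(B(Y, Z)) + Y(B(Z, X)) + Z(B(X, Y)) - B([X, Y], Z) - B([Y, Z], X) - B([Z, X], Y) = 0`. -/
def IsClosedTwoForm
    (B : (x : M) → TangentSpace 𝓘(ℝ, E) x → TangentSpace 𝓘(ℝ, E) x → ℝ) : Prop :=
  ∀ (X Y Z : VField E M) (x : M),
    SmoothAt X x → SmoothAt Y x → SmoothAt Z x →
    dirDeriv (fun y => B y (Y y) (Z y)) x (X x) +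
      dirDeriv (fun y => B y (Z y) (X y)) x (Y x) +
      dirDeriv (fun y => B y (X y) (Y y)) x (Z x) -
      B x (VectorField.mlieBracket 𝓘(ℝ, E) X Y x) (Z x) -
      B x (VectorField.mlieBracket 𝓘(ℝ, E) Y Z x) (X x) -
      B x (VectorField.mlieBracket 𝓘(ℝ, E) Z X x) (Y x) = 0

variable [RiemannianBundle (fun x : M => TangentSpace 𝓘(ℝ, E) x)]

/-- The Riemannian metric `g` as a field of bilinear forms. -/
def metric (x : M) (v w : TangentSpace 𝓘(ℝ, E) x) : ℝ := inner ℝ v w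

/-- The Kähler form `ω(v, w) = g(Jv, w)`. -/
def kahlerForm (x : M) (v w : TangentSpace 𝓘(ℝ, E) x) : ℝ := inner ℝ (J x v) w

variable (E M) in
/-- The metric is Kähler: it is Hermitian, and its Kähler form is closed. -/
structure IsKahler : Prop where
  hermitian : ∀ (x : M) (v w : TangentSpace 𝓘(ℝ, E) x),
    metric x (J x v) (J x w) = metric x v w
  closed : IsClosedTwoForm (kahlerForm (E := E) (M := M))

/-- `V` is a smooth vector field whose flow preserves both the metric (`V` is Killing) and the
Kähler form (`V` is symplectomorphic). -/
structure IsSymplecticKilling (V : VField E M) : Prop where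
  smooth : ∀ x, SmoothAt V x
  killing : LieDerivEqZero V (metric (E := E) (M := M))
  symplectic : LieDerivEqZero V (kahlerForm (E := E) (M := M))

/-- The distribution `𝒟 = {v : ω(v, V) = 0}`. At a zero of `V` it is the whole tangent space. -/
def distribution (V : VField E M) (x : M) : Set (TangentSpace 𝓘(ℝ, E) x) :=
  {v | kahlerForm x v (V x) = 0}

/-- The integral leaf of `𝒟` through `p`: all points that can be joined to `p` by a `C¹` curve
everywhere tangent to `𝒟`. (As curves may be reparametrized so that they stop at their
ends, piecewise `C¹` curves reach the same points.) Leaves contain the zeros of `V` that they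
reach; where `dz = -i_V ω`, the function `z` is constant along these curves. -/
def leaf (V : VField E M) (p : M) : Set M :=
  {q | ∃ γ : ℝ → M, ContMDiff 𝓘(ℝ, ℝ) 𝓘(ℝ, E) 1 γ ∧ γ 0 = p ∧ γ 1 = q ∧
    ∀ t : ℝ, mfderiv 𝓘(ℝ, ℝ) 𝓘(ℝ, E) γ t (1 : ℝ) ∈ distribution V (γ t)}

end Kahler

end

/-! Since the form `ω(·, V)` is closed, it has local primitives `z`, unique up to additive
constants, and a leaf stays locally on a level of `z`. The converse, that nearby points of one level
lie on one leaf, is delicate only at zeros of `V`. There the Hessian of `z` is invariant under `J`.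
If it is nonzero, the Morse lemma, or its Morse-Bott version when it has a kernel, brings `z` into
the form `a|u|² + b|w|²` plus a constant, with complex `u` and `w`. Every level of this form in a
polydisc, singular or not, is path connected, because each sign is carried by a whole complex line.
If the Hessian is zero, then so is the derivative of `V`, and a Killing field vanishing to first
order vanishes nearby, so that `z` is locally constant.

What remains concerns partitions that are locally given by levels of functions defined up to
constants. Following a class preserves differences of height, so holonomy acts by translations.

Points on compact leaves form an open set. By Baire's theorem a compact leaf has isolated levels, at
one point and hence everywhere. Finitely many boxes then follow all neighbouring leaves at once and
show that these form a compact family.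

This set is also closed. Consider compact leaves at the heights `[a, c)` of a box. Outside `K` the
gradient of `z` has length `|V| > ε`, so from height `t` one can descend inside the family to height
`b`, or else reach `K`, within distance `(t - b)/ε`. The family is therefore totally bounded, and
relatively compact by completeness. The leaf at height `c` lies in its closure. If this leaf were
not compact, it could not return to a box at levels differing by `c - a` or less, since the lower
return would lie on one of the compact leaves. It would then be closed in a compact set, hence
compact.

Connectedness of `M` concludes. The carrying results are `Foliation.isCompact_leafGraph_nhds`,
`Foliation.exists_dist_le`, `Foliation.isCompact_class_of_Ico` and
`IsKahlerKilling.exists_isLevelBox`. -/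

namespace LevelFoliation

/-! ### Partitions into local levels: holonomy and isolation of compact classes. -/

open Filter Topology

variable {M : Type*} [MetricSpace M]

/-- A box of the partition of `M` into the classes of `R`: the function `z` is constant on the
classes locally, its levels in `W` belong to a single class, and it is open onto its image. -/
structure IsBox (R : M → M → Prop) (W : Set M) (z : M → ℝ) : Prop where
  isOpen : IsOpen W
  preconnected : IsPreconnected W
  continuousOn : ContinuousOn z W
  level : ∀ y ∈ W, ∀ y' ∈ W, z y = z y' → R y y'
  relOpen : ∀ y ∈ W, ∀ O ∈ 𝓝 y, ∃ η > 0, ∀ y' ∈ W, |z y' - z y| < η →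
    ∃ p ∈ O, p ∈ W ∧ z p = z y'

/-- An equivalence relation whose classes are locally the level sets of functions that are
well defined up to constants. -/
structure Foliation (R : M → M → Prop) (Ch : Set M → (M → ℝ) → Prop) : Prop where
  equiv : Equivalence R
  isBox : ∀ {W z}, Ch W z → IsBox R W z
  exists_box : ∀ x, ∀ O ∈ 𝓝 x, ∃ W z, Ch W z ∧ x ∈ W ∧ W ⊆ O
  compat : ∀ {W z W' z'} {q : M}, Ch W z → Ch W' z' → q ∈ W → q ∈ W' →
    ∀ᶠ y in 𝓝 q, z y - z q = z' y - z' q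
  path : ∀ x y, R x y → ∃ γ : ℝ → M, Continuous γ ∧ γ 0 = x ∧ γ 1 = y ∧
    ∀ t W z, Ch W z → γ t ∈ W → ∀ᶠ s in 𝓝 t, z (γ s) = z (γ t)

variable {R : M → M → Prop} {Ch : Set M → (M → ℝ) → Prop}

namespace Foliation

/-- Reversing the sign of all local functions. -/
theorem neg (F : Foliation R Ch) : Foliation R (fun W z => Ch W (-z)) where
  equiv := F.equiv
  isBox := fun {W z} h => by
    obtain ⟨h1, h2, h3, h4, h5⟩ := F.isBox h
    refine ⟨h1, h2, by simpa using h3.neg, fun y hy y' hy' e => h4 y hy y' hy' (by simp [e]), ?_⟩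
    intro y hy O hO
    obtain ⟨η, hη, H⟩ := h5 y hy O hO
    refine ⟨η, hη, fun y' hy' e => ?_⟩
    obtain ⟨p, hp, hpW, e'⟩ := H y' hy' (by
      rw [abs_sub_comm] at e; simpa [neg_add_eq_sub] using e)
    exact ⟨p, hp, hpW, by simpa using e'⟩
  exists_box := fun x O hO => by
    obtain ⟨W, z, h, hx, hW⟩ := F.exists_box x O hO
    exact ⟨W, -z, by simpa using h, hx, hW⟩
  compat := fun {W z W' z' q} h h' hq hq' => by
    filter_upwards [F.compat h h' hq hq'] with y hy
    simp only [Pi.neg_apply] at hy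
    linarith
  path := fun x y hxy => by
    obtain ⟨γ, h1, h2, h3, h4⟩ := F.path x y hxy
    refine ⟨γ, h1, h2, h3, fun t W z h ht => ?_⟩
    filter_upwards [h4 t W _ h ht] with s hs
    simpa using hs

variable (F : Foliation R Ch)
include F

/-- Along a path in a class the local functions are locally constant, so `P` is locally constant
along it. The hypothesis `step` is symmetric in the two points, which gives both directions. -/
theorem path_induction {P : M → Prop}
    (step : ∀ W z, Ch W z → ∀ y ∈ W, ∀ y' ∈ W, z y = z y' → P y → P y')
    {x y : M} (hxy : R x y) (hx : P x) : P y := by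
  obtain ⟨γ, hγ, h0, h1, hz⟩ := F.path x y hxy
  have hloc : IsLocallyConstant (fun t => P (γ t)) := by
    rw [IsLocallyConstant.iff_eventually_eq]
    intro t
    obtain ⟨W, z, hC, htW, -⟩ := F.exists_box (γ t) univ univ_mem
    filter_upwards [hz t W z hC htW, hγ.continuousAt.preimage_mem_nhds
      ((F.isBox hC).isOpen.mem_nhds htW)] with s hs hsW
    exact propext ⟨step W z hC _ hsW _ htW hs, step W z hC _ htW _ hsW hs.symm⟩
  have := hloc.apply_eq_of_isPreconnected isPreconnected_univ (mem_univ (0 : ℝ)) (mem_univ 1)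
  simp only [h0, h1] at this
  exact this ▸ hx

/-- Holonomy: nearby levels of boxes at two points of a class correspond to each other. -/
theorem holonomy {q q' : M} (hqq : R q q') {W : Set M} {z : M → ℝ} (hW : Ch W z) (hq : q ∈ W)
    {W' : Set M} {z' : M → ℝ} (hW' : Ch W' z') (hq' : q' ∈ W') :
    ∃ η > 0, ∀ y' ∈ W', |z' y' - z' q'| < η → ∃ y ∈ W, z y - z q = z' y' - z' q' ∧ R y y' := by
  revert W' z'
  refine F.path_induction (P := fun q' => ∀ {W' : Set M} {z' : M → ℝ}, Ch W' z' → q' ∈ W' →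
    ∃ η > 0, ∀ y' ∈ W', |z' y' - z' q'| < η → ∃ y ∈ W, z y - z q = z' y' - z' q' ∧ R y y')
    ?_ hqq ?_
  · intro W₁ z₁ h₁ q₁ hq₁ q₂ hq₂ e ih W' z' h' hq₂'
    obtain ⟨η₁, hη₁, H₁⟩ := ih h₁ hq₁
    -- Compatibility is known only near `q₂`. Each nearby level of `W'` has a representative there,
    -- by `relOpen`, and its height can then be read in `z₁`.
    have hO := inter_mem (F.compat h₁ h' hq₂ hq₂') ((F.isBox h₁).isOpen.mem_nhds hq₂)
    obtain ⟨η₂, hη₂, H₂⟩ := (F.isBox h').relOpen q₂ hq₂' _ hO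
    refine ⟨min η₁ η₂, lt_min hη₁ hη₂, fun y' hy' hy => ?_⟩
    obtain ⟨p, ⟨hp1, hp2⟩, hpW, hpz⟩ := H₂ y' hy' (hy.trans_le (min_le_right _ _))
    simp only [mem_ofPred_eq] at hp1
    obtain ⟨y, hyW, hyz, hyR⟩ := H₁ p hp2 (by
      rw [e, hp1, hpz]; exact hy.trans_le (min_le_left _ _))
    exact ⟨y, hyW, by rw [hyz, e, hp1, hpz],
      F.equiv.trans hyR ((F.isBox h').level p hpW y' hy' hpz)⟩
  · intro W' z' h' hq'
    have hO := inter_mem (F.compat hW h' hq hq') ((F.isBox hW).isOpen.mem_nhds hq)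
    obtain ⟨η₂, hη₂, H₂⟩ := (F.isBox h').relOpen q hq' _ hO
    refine ⟨η₂, hη₂, fun y' hy' hy => ?_⟩
    obtain ⟨p, ⟨hp1, hp2⟩, hpW, hpz⟩ := H₂ y' hy' hy
    simp only [mem_ofPred_eq] at hp1
    exact ⟨p, hp2, by rw [hp1, hpz], (F.isBox h').level p hpW y' hy' hpz⟩

/-- On a compact class, the levels through the class are isolated at some point. -/
theorem exists_isolated {x : M} (hL : IsCompact {y | R x y}) :
    ∃ y, R x y ∧ ∃ W z, Ch W z ∧ y ∈ W ∧ ∃ O ∈ 𝓝 y, ∀ q ∈ O, R x q → z q = z y := by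
  classical
  set L : Set M := {y | R x y} with hLdef
  have hxL : x ∈ L := F.equiv.refl x
  choose W z hC hW _ using fun y : M => F.exists_box y univ univ_mem
  have hr : ∀ y : M, ∃ r > 0, Metric.closedBall y r ⊆ W y := fun y =>
    Metric.nhds_basis_closedBall.mem_iff.1 ((F.isBox (hC y)).isOpen.mem_nhds (hW y))
  choose r hr0 hr using hr
  obtain ⟨t, htL, htc⟩ := hL.elim_nhds_subcover (fun y => Metric.ball y (r y))
    (fun y _ => Metric.ball_mem_nhds y (hr0 y))
  have : CompactSpace L := isCompact_iff_compactSpace.1 hL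
  have : Nonempty L := ⟨⟨x, hxL⟩⟩
  -- plaques are pairs of an index and a level
  let mem : M → (M × ℝ) → Prop := fun y p => p.1 ∈ t ∧ y ∈ W p.1 ∧ z p.1 y = p.2
  let adj : (M × ℝ) → (M × ℝ) → Prop := fun p p' => ∃ y ∈ L, mem y p ∧ mem y p'
  -- On the part of the plaque `p` inside the box `j`, the function `z j` is locally constant by
  -- compatibility. As `L` is second countable, it takes only countably many values there.
  have hadj : ∀ p, {p' | adj p p'}.Countable := by
    intro p
    have hj : ∀ j ∈ t, ((fun y : L => (j, z j y)) '' {y : L | y.1 ∈ W j ∧ mem y p}).Countable := by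
      intro j hj
      set Y : Set L := {y : L | y.1 ∈ W j ∧ mem y p}
      have hloc : ∀ y ∈ Y, {y' : L | y' ∈ Y → z j y' = z j y} ∈ 𝓝[Y] y := by
        intro y hy
        apply mem_nhdsWithin_of_mem_nhds
        filter_upwards [continuous_subtype_val.continuousAt.eventually
          (F.compat (hC j) (hC p.1) hy.1 hy.2.2.1)] with y' hy' hyY
        have e1 := hy.2.2.2
        have e2 := hyY.2.2.2
        linarith
      obtain ⟨T, hTY, hTc, hT⟩ := TopologicalSpace.countable_cover_nhdsWithin hloc
      refine (hTc.image (fun y : L => (j, z j y))).mono ?_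
      rintro _ ⟨y, hy, rfl⟩
      obtain ⟨y₀, hy₀, hyy⟩ := mem_iUnion₂.1 (hT hy)
      exact ⟨y₀, hy₀, by simp [hyy hy]⟩
    refine (t.countable_toSet.biUnion (fun j hj' => hj j hj')).mono ?_
    rintro ⟨j, c⟩ ⟨y, hyL, hyp, hj, hyj, hc⟩
    exact mem_biUnion hj ⟨⟨y, hyL⟩, ⟨hyj, hyp⟩, by simpa using hc⟩
  have hcov : ∀ y ∈ L, ∃ j ∈ t, y ∈ Metric.ball j (r j) := fun y hy => by simpa using htc hy
  obtain ⟨j₀, hj₀, hxj₀⟩ := hcov x hxL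
  have hballW : ∀ {y j}, y ∈ Metric.ball j (r j) → y ∈ W j := fun h =>
    hr _ (Metric.ball_subset_closedBall h)
  let p₀ : M × ℝ := (j₀, z j₀ x)
  -- The plaques reached from `p₀` by a chain of `n` adjacencies.
  let Sn : ℕ → Set (M × ℝ) := fun n => Nat.rec {p₀} (fun _ A => ⋃ p ∈ A, {p' | adj p p'}) n
  have hSn : ∀ n, (Sn n).Countable := by
    intro n
    induction n with
    | zero => exact countable_singleton _
    | succ n ih => exact ih.biUnion fun p _ => hadj p
  let S : Set (M × ℝ) := ⋃ n, Sn n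
  have hS : S.Countable := countable_iUnion hSn
  have hSadj : ∀ p ∈ S, ∀ p', adj p p' → p' ∈ S := by
    intro p hp p' hpp
    obtain ⟨n, hn⟩ := mem_iUnion.1 hp
    exact mem_iUnion.2 ⟨n + 1, mem_biUnion hn hpp⟩
  -- Countably many plaques suffice for `L`: a path from `x` stays for a short time in one plaque of
  -- a covering box, so membership in `S` propagates along it.
  have hall : ∀ y ∈ L, ∀ p, mem y p → p ∈ S := by
    intro y hy
    obtain ⟨γ, hγ, h0, h1, hz⟩ := F.path x y hy
    have hγL : ∀ s, R x (γ s) := by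
      have hloc : IsLocallyConstant (fun t => R x (γ t)) := by
        rw [IsLocallyConstant.iff_eventually_eq]
        intro s
        filter_upwards [hz s _ _ (hC (γ s)) (hW _), hγ.continuousAt.preimage_mem_nhds
          ((F.isBox (hC (γ s))).isOpen.mem_nhds (hW _))] with s' hs' hsW
        have := (F.isBox (hC (γ s))).level _ hsW _ (hW _) hs'
        exact propext ⟨fun h => F.equiv.trans h this,
          fun h => F.equiv.trans h (F.equiv.symm this)⟩
      intro s
      have := hloc.apply_eq_of_isPreconnected isPreconnected_univ (mem_univ (0 : ℝ)) (mem_univ s)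
      simp only [h0] at this
      exact this ▸ F.equiv.refl x
    have hloc : IsLocallyConstant (fun s => ∀ p, mem (γ s) p → p ∈ S) := by
      rw [IsLocallyConstant.iff_eventually_eq]
      intro s
      obtain ⟨j, hj, hsj⟩ := hcov _ (hγL s)
      have hsW := hballW hsj
      filter_upwards [hz s _ _ (hC j) hsW, hγ.continuousAt.preimage_mem_nhds
        ((F.isBox (hC j)).isOpen.mem_nhds hsW)] with s' hs' hs'W
      have m1 : mem (γ s) (j, z j (γ s)) := ⟨hj, hsW, rfl⟩
      have m2 : mem (γ s') (j, z j (γ s)) := ⟨hj, hs'W, hs'⟩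
      refine propext ⟨fun h p hp => ?_, fun h p hp => ?_⟩
      · exact hSadj _ (h _ m2) _ ⟨γ s, hγL s, m1, hp⟩
      · exact hSadj _ (h _ m1) _ ⟨γ s', hγL s', m2, hp⟩
    have := hloc.apply_eq_of_isPreconnected isPreconnected_univ (mem_univ (0 : ℝ)) (mem_univ 1)
    simp only [h0, h1] at this
    rw [← this]
    intro p hp
    have m0 : mem x p₀ := ⟨hj₀, hballW hxj₀, rfl⟩
    exact hSadj p₀ (mem_iUnion.2 ⟨0, rfl⟩) p ⟨x, hxL, m0, hp⟩
  have : Countable S := hS.to_subtype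
  -- Restricting a plaque to the closed ball makes it closed in `L`, as Baire's theorem requires. A
  -- plaque with interior in `L` carries only one level of `L` near an interior point.
  let f : S → Set L := fun p => {y : L | p.1.1 ∈ t ∧ y.1 ∈ Metric.closedBall p.1.1 (r p.1.1) ∧
    z p.1.1 y = p.1.2}
  have hfc : ∀ p, IsClosed (f p) := by
    intro p
    by_cases hpt : p.1.1 ∈ t
    · have hc := ((F.isBox (hC p.1.1)).continuousOn.mono (hr p.1.1)).preimage_isClosed_of_isClosed
        Metric.isClosed_closedBall (isClosed_singleton (x := p.1.2))
      convert! hc.preimage (continuous_subtype_val (p := fun y => y ∈ L)) using 1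
      ext y
      simp [f, hpt]
    · simp [f, hpt]
  have hfu : ⋃ p, f p = univ := by
    ext y
    simp only [mem_iUnion, mem_univ, iff_true]
    obtain ⟨j, hj, hyj⟩ := hcov y y.2
    exact ⟨⟨(j, z j y), hall y y.2 _ ⟨hj, hballW hyj, rfl⟩⟩, hj,
      Metric.ball_subset_closedBall hyj, rfl⟩
  obtain ⟨p, y, hy⟩ := nonempty_interior_of_iUnion_of_closed hfc hfu
  have hyin := interior_subset hy
  obtain ⟨O, hO, hOs⟩ := mem_nhds_subtype _ _ _ |>.1 (isOpen_interior.mem_nhds hy)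
  refine ⟨y, y.2, W p.1.1, z p.1.1, hC _, hr _ hyin.2.1, O, hO, fun q hq hxq => ?_⟩
  have := interior_subset (hOs (show (⟨q, hxq⟩ : L) ∈ Subtype.val ⁻¹' O from hq))
  exact this.2.2.trans hyin.2.2.symm

/-- The levels through a compact class are isolated. -/
theorem isolated {x : M} (hL : IsCompact {y | R x y}) {y : M} (hxy : R x y)
    {W : Set M} {z : M → ℝ} (hW : Ch W z) (hy : y ∈ W) :
    ∀ᶠ q in 𝓝 y, R x q → z q = z y := by
  obtain ⟨y₀, h₀, W₀, z₀, hC₀, hy₀, O₀, hO₀, H₀⟩ := F.exists_isolated hL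
  revert W z
  refine F.path_induction (P := fun y => ∀ {W : Set M} {z : M → ℝ}, Ch W z → y ∈ W →
    ∀ᶠ q in 𝓝 y, R x q → z q = z y) ?_ (F.equiv.trans (F.equiv.symm h₀) hxy) ?_
  · intro W₁ z₁ h₁ q₁ hq₁ q₂ hq₂ e ih W z h hq
    -- A point near `q₂` slides along its own level to a point near `q₁`, where isolation is already
    -- known.
    obtain ⟨η, hη, H⟩ := (F.isBox h₁).relOpen q₁ hq₁ _ (ih h₁ hq₁)
    have hcont : ContinuousAt z₁ q₂ :=
      (F.isBox h₁).continuousOn.continuousAt ((F.isBox h₁).isOpen.mem_nhds hq₂)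
    filter_upwards [F.compat h h₁ hq hq₂, (F.isBox h₁).isOpen.mem_nhds hq₂,
      hcont.eventually (Metric.ball_mem_nhds _ hη)] with q hq' hqW hqη hxq
    obtain ⟨p, hp, hpW, hpz⟩ := H q hqW (by rw [e]; exact hqη)
    have := hp (F.equiv.trans hxq ((F.isBox h₁).level _ hqW _ hpW hpz.symm))
    linarith
  · intro W z h hq
    filter_upwards [hO₀, F.compat h hC₀ hq hy₀] with q hq' hqc hxq
    have := H₀ q hq' hxq
    linarith

end Foliation

end LevelFoliation

/-! ### Stability of compact classes. -/

namespace LevelFoliation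

open Filter Topology

variable {M : Type*} [MetricSpace M]

/-- The points of the classes meeting the levels `z = t`, `t ∈ S`, of the box `W`,
together with the level. -/
def leafGraph (R : M → M → Prop) (W : Set M) (z : M → ℝ) (S : Set ℝ) : Set (ℝ × M) :=
  {p | p.1 ∈ S ∧ ∃ y ∈ W, z y = p.1 ∧ R y p.2}

variable {R : M → M → Prop} {Ch : Set M → (M → ℝ) → Prop}

namespace Foliation

variable (F : Foliation R Ch)
include F

/-- Classes near a compact class form a compact family. -/
theorem isCompact_leafGraph_nhds [LocallyCompactSpace M] {x : M} (hL : IsCompact {y | R x y})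
    {W₀ : Set M} {z₀ : M → ℝ} (hW₀ : Ch W₀ z₀) (hx : x ∈ W₀) :
    ∃ η > 0, IsCompact (leafGraph R W₀ z₀ (Icc (z₀ x - η) (z₀ x + η))) := by
  classical
  have hxL : R x x := F.equiv.refl x
  choose W z hC hW _ using fun y : M => F.exists_box y univ univ_mem
  have hr : ∀ y : M, ∃ r > 0, Metric.closedBall y r ⊆ W y ∧ IsCompact (Metric.closedBall y r) ∧
      (R x y → ∀ q ∈ Metric.closedBall y r, R x q → z y q = z y y) := by
    intro y
    obtain ⟨K, hK, -, hKy⟩ := local_compact_nhds (univ_mem : univ ∈ 𝓝 y)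
    have hev : ∀ᶠ q in 𝓝 y, R x y → R x q → z y q = z y y := by
      by_cases h : R x y
      · filter_upwards [F.isolated hL h (hC y) (hW y)] with q hq _ using hq
      · exact Eventually.of_forall fun q h' => absurd h' h
    obtain ⟨r, hr, hs⟩ := Metric.nhds_basis_closedBall.mem_iff.1
      (inter_mem (inter_mem ((F.isBox (hC y)).isOpen.mem_nhds (hW y)) hK) hev)
    exact ⟨r, hr, fun q hq => (hs hq).1.1,
      hKy.of_isClosed_subset Metric.isClosed_closedBall (fun q hq => (hs hq).1.2),
      fun h q hq => (hs hq).2 h⟩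
  choose r hr0 hr hrc hriso using hr
  obtain ⟨t, htL, htc⟩ := hL.elim_nhds_subcover (fun y => Metric.ball y (r y))
    (fun y _ => Metric.ball_mem_nhds y (hr0 y))
  have hcov : ∀ y, R x y → ∃ j ∈ t, y ∈ Metric.ball j (r j) := fun y hy => by
    simpa using htc (show y ∈ {y | R x y} from hy)
  have hbW : ∀ {y j}, y ∈ Metric.ball j (r j) → y ∈ W j := fun h =>
    hr _ (Metric.ball_subset_closedBall h)
  -- Heights are normalized to vanish at the centre `j`. By the choice of the radii they vanish on
  -- the whole class inside each ball, so different balls agree about height zero.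
  have hzc : ∀ j, ContinuousOn (fun q => z j q - z j j) (Metric.closedBall j (r j)) := fun j =>
    ((F.isBox (hC j)).continuousOn.mono (hr j)).sub continuousOn_const
  -- every level near zero of one ball is covered by the open balls
  have hA : ∀ j ∈ t, ∃ η > 0, ∀ q ∈ Metric.closedBall j (r j), |z j q - z j j| ≤ η →
      ∃ k ∈ t, q ∈ Metric.ball k (r k) ∧ z k q - z k k = z j q - z j j := by
    intro j hj
    set A : Set M := {q | ∃ k ∈ t, q ∈ Metric.ball k (r k) ∧ z k q - z k k = z j q - z j j}
    have hBc : IsCompact (Metric.closedBall j (r j) \ interior A) := (hrc j).diff isOpen_interior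
    -- A point of height zero is on the class, hence in an open ball `k` with the same normalized
    -- heights nearby, and so is interior to `A`. On the compact remainder the height is therefore
    -- bounded away from zero.
    have hpos : ∀ q ∈ Metric.closedBall j (r j) \ interior A, 0 < |z j q - z j j| := by
      rintro q ⟨hq, hqA⟩
      by_contra hcon
      have h0 : z j q - z j j = 0 := abs_nonpos_iff.1 (not_lt.1 hcon)
      have hjq : R j q := (F.isBox (hC j)).level _ (hW j) _ (hr j hq) (by linarith)
      have hxq : R x q := F.equiv.trans (htL j hj) hjq
      obtain ⟨k, hk, hqk⟩ := hcov q hxq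
      have hk0 := hriso k (htL k hk) q (Metric.ball_subset_closedBall hqk) hxq
      apply hqA
      rw [mem_interior_iff_mem_nhds]
      filter_upwards [F.compat (hC k) (hC j) (hbW hqk) (hr j hq),
        Metric.isOpen_ball.mem_nhds hqk] with q' h1 h2
      exact ⟨k, hk, h2, by linarith⟩
    obtain hem | hne := (Metric.closedBall j (r j) \ interior A).eq_empty_or_nonempty
    · refine ⟨1, one_pos, fun q hq _ => ?_⟩
      by_contra hcon
      have : q ∈ Metric.closedBall j (r j) \ interior A :=
        ⟨hq, fun h => hcon (interior_subset h : q ∈ A)⟩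
      simp [hem] at this
    · obtain ⟨q₀, hq₀, hmin⟩ := hBc.exists_isMinOn hne ((hzc j).abs.mono sdiff_subset)
      refine ⟨|z j q₀ - z j j| / 2, half_pos (hpos q₀ hq₀), fun q hq hqη => ?_⟩
      by_contra hcon
      have h1 : |z j q₀ - z j j| ≤ |z j q - z j j| :=
        hmin (show q ∈ Metric.closedBall j (r j) \ interior A from
          ⟨hq, fun h => hcon (interior_subset h : q ∈ A)⟩)
      have := hpos q₀ hq₀
      linarith
  have hH : ∀ j ∈ t, ∃ η > 0, ∀ y' ∈ W j, |z j y' - z j j| < η →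
      ∃ y ∈ W₀, z₀ y - z₀ x = z j y' - z j j ∧ R y y' := fun j hj =>
    F.holonomy (htL j hj) hW₀ hx (hC j) (hW j)
  obtain ⟨j₀, hj₀, hxj₀⟩ := hcov x hxL
  have hj₀0 := hriso j₀ (htL j₀ hj₀) x (Metric.ball_subset_closedBall hxj₀) hxL
  obtain ⟨η₀, hη₀, H₀⟩ := (F.isBox hW₀).relOpen x hx _
    (inter_mem (F.compat hW₀ (hC j₀) hx (hbW hxj₀)) (Metric.isOpen_ball.mem_nhds hxj₀))
  choose! η₁ hη₁ H₁ using hA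
  choose! η₂ hη₂ H₂ using hH
  obtain ⟨η, hη, hη0, hηle⟩ : ∃ η > 0, η < η₀ ∧ ∀ j ∈ t, η < η₁ j ∧ η < η₂ j := by
    have : ∀ᶠ η in 𝓝[>] (0 : ℝ), 0 < η ∧ η < η₀ ∧ ∀ j ∈ t, η < η₁ j ∧ η < η₂ j := by
      have hlt : ∀ c > (0 : ℝ), ∀ᶠ η in 𝓝[>] (0 : ℝ), η < c := fun c hc =>
        mem_nhdsWithin_of_mem_nhds (Iio_mem_nhds hc)
      refine eventually_mem_nhdsWithin.and ((hlt _ hη₀).and ?_)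
      rw [Filter.eventually_all_finset]
      exact fun j hj => (hlt _ (hη₁ j hj)).and (hlt _ (hη₂ j hj))
    obtain ⟨η, h1, h2, h3⟩ := this.exists
    exact ⟨η, h1, h2, h3⟩
  refine ⟨η, hη, ?_⟩
  -- Near the compact class the whole family consists of slices of finitely many compact balls. One
  -- inclusion follows paths from ball to ball at a fixed height; the other brings each slice back
  -- to `W₀` by holonomy.
  have hkey : leafGraph R W₀ z₀ (Icc (z₀ x - η) (z₀ x + η)) =
      ⋃ j ∈ t, (fun q => (z j q - z j j + z₀ x, q)) ''
        (Metric.closedBall j (r j) ∩ (fun q => z j q - z j j) ⁻¹' Icc (-η) η) := by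
    ext ⟨s, q⟩
    simp only [mem_iUnion, mem_image, leafGraph, mem_ofPred_eq, Prod.mk.injEq, exists_prop,
      mem_inter_iff, mem_preimage]
    constructor
    · rintro ⟨hs, y, hyW, hys, hyq⟩
      have hs' : |s - z₀ x| ≤ η := by rw [abs_le]; constructor <;> linarith [hs.1, hs.2]
      set Pt : M → Prop := fun q => ∃ j ∈ t, q ∈ Metric.closedBall j (r j) ∧
        z j q - z j j = s - z₀ x with hPt
      suffices Pt q by
        obtain ⟨j, hj, hqj, hz⟩ := this
        refine ⟨j, hj, q, ⟨hqj, ?_⟩, by rw [hz]; ring, rfl⟩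
        rw [hz]; exact abs_le.1 hs'
      obtain ⟨p, ⟨hp1, hp2⟩, hpW, hpz⟩ := H₀ y hyW (by rw [hys]; exact hs'.trans_lt hη0)
      have hRpq : R p q := F.equiv.trans ((F.isBox hW₀).level p hpW y hyW hpz) hyq
      have hp : Pt p := by
        refine ⟨j₀, hj₀, Metric.ball_subset_closedBall hp2, ?_⟩
        have hp1 : z₀ p - z₀ x = z j₀ p - z j₀ x := hp1
        linarith
      obtain ⟨γ, hγ, h0, h1, hz⟩ := F.path p q hRpq
      have hcl : IsClosed {q | Pt q} := by
        have : {q | Pt q} = ⋃ j ∈ t, (Metric.closedBall j (r j) ∩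
            (fun q => z j q - z j j) ⁻¹' {s - z₀ x}) := by
          ext q
          simp only [hPt, mem_iUnion, exists_prop]
          rfl
        rw [this]
        exact isClosed_biUnion_finset fun j _ => (hzc j).preimage_isClosed_of_isClosed
          Metric.isClosed_closedBall isClosed_singleton
      -- The closed balls give closedness. For openness, `H₁` replaces the closed ball by an open
      -- one at the same normalized height.
      have hclopen : IsClopen (γ ⁻¹' {q | Pt q}) := by
        refine ⟨hcl.preimage hγ, isOpen_iff_mem_nhds.2 fun u hu => ?_⟩
        obtain ⟨j, hj, hqj, hzj⟩ := hu
        obtain ⟨k, hk, hqk, hzk⟩ := H₁ j hj _ hqj (by rw [hzj]; exact hs'.trans (hηle j hj).1.le)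
        filter_upwards [hz u _ _ (hC k) (hbW hqk),
          hγ.continuousAt.preimage_mem_nhds (Metric.isOpen_ball.mem_nhds hqk)] with v hv1 hv2
        exact ⟨k, hk, Metric.ball_subset_closedBall hv2, by rw [hv1, hzk, hzj]⟩
      obtain hem | hun := isClopen_iff.1 hclopen
      · have : (0 : ℝ) ∈ γ ⁻¹' {q | Pt q} := by simpa [h0] using hp
        simp [hem] at this
      · have : (1 : ℝ) ∈ γ ⁻¹' {q | Pt q} := by simp [hun]
        simpa [h1] using this
    · rintro ⟨j, hj, q', ⟨hq', hzq⟩, rfl, rfl⟩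
      refine ⟨⟨by linarith [hzq.1], by linarith [hzq.2]⟩, ?_⟩
      obtain ⟨y, hyW, hyz, hyR⟩ := H₂ j hj q' (hr j hq') ((abs_le.2 hzq).trans_lt (hηle j hj).2)
      exact ⟨y, hyW, by linarith, hyR⟩
  rw [hkey]
  refine t.isCompact_biUnion fun j _ => IsCompact.image_of_continuousOn ?_ ?_
  · exact (hrc j).of_isClosed_subset ((hzc j).preimage_isClosed_of_isClosed
      Metric.isClosed_closedBall isClosed_Icc) inter_subset_left
  · exact (((hzc j).mono inter_subset_left).add continuousOn_const).prodMk continuousOn_id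

theorem isCompact_class_of_leafGraph {W : Set M} {z : M → ℝ} (hW : Ch W z) {S : Set ℝ}
    (hS : IsCompact (leafGraph R W z S)) {y : M} (hy : y ∈ W) (hyS : z y ∈ S) :
    IsCompact {q | R y q} := by
  have : {q | R y q} = Prod.snd '' (leafGraph R W z S ∩ Prod.fst ⁻¹' {z y}) := by
    ext q
    constructor
    · intro h
      exact ⟨(z y, q), ⟨⟨hyS, y, hy, rfl, h⟩, rfl⟩, rfl⟩
    · rintro ⟨⟨_, _⟩, ⟨⟨_, y', hy', e, h⟩, e'⟩, rfl⟩
      exact F.equiv.trans ((F.isBox hW).level _ hy _ hy' (e.trans e').symm) h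
  rw [this]
  exact (hS.inter_right (isClosed_singleton.preimage continuous_fst)).image continuous_snd

/-- The union of the compact classes is open. -/
theorem isOpen_isCompact_class [LocallyCompactSpace M] :
    IsOpen {x | IsCompact {y | R x y}} := by
  rw [isOpen_iff_mem_nhds]
  intro x hx
  obtain ⟨W, z, hW, hxW, -⟩ := F.exists_box x univ univ_mem
  obtain ⟨η, hη, hc⟩ := F.isCompact_leafGraph_nhds hx hW hxW
  filter_upwards [(F.isBox hW).isOpen.mem_nhds hxW,
    ((F.isBox hW).continuousOn.continuousAt ((F.isBox hW).isOpen.mem_nhds hxW)).eventually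
      (Icc_mem_nhds (show z x - η < z x by linarith) (show z x < z x + η by linarith))] with y h1 h2
  exact F.isCompact_class_of_leafGraph hW hc h1 h2

/-- Each level of `[a, b]` has a neighbourhood over which the family is compact, and finitely many
of these cover the interval. -/
theorem isCompact_leafGraph_Icc [LocallyCompactSpace M] {W : Set M} {z : M → ℝ} (hW : Ch W z)
    {a b : ℝ} (hsub : Icc a b ⊆ z '' W)
    (h : ∀ y ∈ W, z y ∈ Icc a b → IsCompact {q | R y q}) :
    IsCompact (leafGraph R W z (Icc a b)) := by
  have hloc : ∀ t : ℝ, ∃ η > 0, t ∈ Icc a b →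
      IsCompact (leafGraph R W z (Icc (t - η) (t + η))) := by
    intro t
    by_cases ht : t ∈ Icc a b
    · obtain ⟨y, hy, rfl⟩ := hsub ht
      obtain ⟨η, hη, hc⟩ := F.isCompact_leafGraph_nhds (h y hy ht) hW hy
      exact ⟨η, hη, fun _ => hc⟩
    · exact ⟨1, one_pos, fun h => absurd h ht⟩
  choose η hη hc using hloc
  obtain ⟨T, hT, hcov⟩ := (isCompact_Icc (a := a) (b := b)).elim_nhds_subcover
    (fun t => Icc (t - η t) (t + η t))
    (fun t _ => Icc_mem_nhds (by linarith [hη t]) (by linarith [hη t]))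
  have : leafGraph R W z (Icc a b) =
      (⋃ t ∈ T, leafGraph R W z (Icc (t - η t) (t + η t))) ∩ Prod.fst ⁻¹' Icc a b := by
    ext ⟨s, q⟩
    simp only [leafGraph, mem_ofPred_eq, mem_inter_iff, mem_iUnion, exists_prop, mem_preimage]
    constructor
    · rintro ⟨hs, hy⟩
      obtain ⟨t, ht, hst⟩ := mem_iUnion₂.1 (hcov hs)
      exact ⟨⟨t, ht, hst, hy⟩, hs⟩
    · rintro ⟨⟨t, ht, hst, hy⟩, hs⟩
      exact ⟨hs, hy⟩
  rw [this]
  exact (T.isCompact_biUnion fun t ht => hc t (hT t ht)).inter_right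
    (isClosed_Icc.preimage continuous_fst)

end Foliation

end LevelFoliation

/-! ### Limits of compact classes under a lower bound on the slope. -/

namespace LevelFoliation

open Filter Topology

variable {M : Type*} [MetricSpace M]

variable {R : M → M → Prop} {Ch : Set M → (M → ℝ) → Prop}

/-- Outside `K`, the local functions can be decreased with slope more than `ε`. -/
def HasSlope (Ch : Set M → (M → ℝ) → Prop) (K : Set M) (ε : ℝ) : Prop :=
  ∀ q ∉ K, ∀ W z, Ch W z → q ∈ W → ∀ O ∈ 𝓝 q, ∃ q' ∈ O, q' ∈ W ∧ z q' < z q ∧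
    ε * dist q q' < z q - z q'

namespace Foliation

variable (F : Foliation R Ch)
include F

theorem class_eq {p q : M} (h : R p q) : {y | R p y} = {y | R q y} := by
  ext y
  exact ⟨fun h' => F.equiv.trans (F.equiv.symm h) h', fun h' => F.equiv.trans h h'⟩

/-- Descending along the local functions, one reaches `K` or a lower level in controlled
distance. -/
theorem exists_dist_le [LocallyCompactSpace M] {K : Set M} {ε : ℝ} (hε : 0 < ε)
    (hK : HasSlope Ch K ε) {W : Set M} {z : M → ℝ} (hW : Ch W z) {b t : ℝ}
    (hc : IsCompact (leafGraph R W z (Icc b t))) {q : M} (hq : (t, q) ∈ leafGraph R W z (Icc b t)) :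
    ∃ q', (q' ∈ K ∨ (b, q') ∈ leafGraph R W z (Icc b t)) ∧ dist q q' ≤ (t - b) / ε := by
  -- A minimum of height plus `ε` times the distance to `q`, in the manner of Ekeland: outside `K`
  -- and above height `b` the slope would allow a smaller value.
  obtain ⟨⟨s, y⟩, hsy, hmin⟩ := hc.exists_isMinOn ⟨_, hq⟩
    (f := fun p : ℝ × M => p.1 + ε * dist q p.2) (by fun_prop)
  have hle : s + ε * dist q y ≤ t := by simpa using hmin hq
  have hbs : b ≤ s := hsy.1.1
  refine ⟨y, ?_, by rw [le_div_iff₀ hε]; linarith⟩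
  by_contra! hcon
  obtain ⟨hyK, hyb⟩ := hcon
  have hsb : b < s := lt_of_le_of_ne hbs fun h => hyb (h ▸ hsy)
  obtain ⟨-, p, hpW, hps, hpy⟩ := hsy
  have hst : s ≤ t := by have := dist_nonneg (x := q) (y := y); nlinarith
  dsimp only at hps hpy
  obtain ⟨W₁, z₁, h₁, hyW₁, -⟩ := F.exists_box y univ univ_mem
  -- Holonomy turns a descent of `z₁` near `y` into an equal descent of `z` inside the family.
  obtain ⟨η, hη, H⟩ := F.holonomy hpy hW hpW h₁ hyW₁
  have hcont : ContinuousAt z₁ y :=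
    (F.isBox h₁).continuousOn.continuousAt ((F.isBox h₁).isOpen.mem_nhds hyW₁)
  obtain ⟨y', hy'O, hy'W, hlt, hslope⟩ := hK y hyK W₁ z₁ h₁ hyW₁ _
    (hcont.eventually (Metric.ball_mem_nhds _ (lt_min hη (sub_pos.2 hsb))))
  have hy'O : |z₁ y' - z₁ y| < min η (s - b) := hy'O
  obtain ⟨p', hp'W, hp'z, hp'R⟩ := H y' hy'W (hy'O.trans_le (min_le_left _ _))
  have hlow := (abs_lt.1 (hy'O.trans_le (min_le_right _ _))).1
  have hmem : (z p', y') ∈ leafGraph R W z (Icc b t) :=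
    ⟨⟨by dsimp only; linarith, by dsimp only; linarith⟩, p', hp'W, rfl, hp'R⟩
  have h2 : s + ε * dist q y ≤ z p' + ε * dist q y' := by simpa using hmin hmem
  have h3 : ε * dist q y' ≤ ε * dist q y + ε * dist y y' := by
    rw [← mul_add]; exact mul_le_mul_of_nonneg_left (dist_triangle _ _ _) hε.le
  linarith

/-- The union of a family of compact classes parametrised by a bounded interval of levels is
totally bounded. -/
theorem totallyBounded_classes [LocallyCompactSpace M] {K : Set M} (hKc : IsCompact K) {ε : ℝ}
    (hε : 0 < ε) (hK : HasSlope Ch K ε) {W : Set M} {z : M → ℝ} (hW : Ch W z) {a c : ℝ}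
    (hac : a < c) (hsub : Icc a c ⊆ z '' W)
    (h : ∀ y ∈ W, z y ∈ Ico a c → IsCompact {q | R y q}) :
    TotallyBounded {q | ∃ p ∈ W, z p ∈ Ico a c ∧ R p q} := by
  have hA : ∀ b < c, IsCompact (leafGraph R W z (Icc a b)) := fun b hb =>
    F.isCompact_leafGraph_Icc hW ((Icc_subset_Icc_right hb.le).trans hsub)
      fun y hy hyb => h y hy ⟨hyb.1, hyb.2.trans_lt hb⟩
  rw [Metric.totallyBounded_iff]
  intro r hr
  -- Choose `b` with `(c - b)/ε < r/2`: classes above `b` then lie within `r/2` of the compact set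
  -- formed by `K` and the classes at heights `[a, b]`.
  obtain ⟨b, hb, hbc⟩ : ∃ b, (a ≤ b ∧ c - ε * (r / 2) < b) ∧ b < c := by
    have : max a (c - ε * (r / 2)) < c := max_lt hac (by have := mul_pos hε (half_pos hr); linarith)
    obtain ⟨b, h1, h2⟩ := exists_between this
    exact ⟨b, ⟨((le_max_left _ _).trans_lt h1).le, (le_max_right _ _).trans_lt h1⟩, h2⟩
  have hcomp : IsCompact (K ∪ Prod.snd '' leafGraph R W z (Icc a b)) :=
    hKc.union ((hA b hbc).image continuous_snd)
  obtain ⟨T, hT, hcov⟩ := Metric.totallyBounded_iff.1 hcomp.totallyBounded (r / 2) (half_pos hr)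
  refine ⟨T, hT, ?_⟩
  rintro q ⟨p, hpW, hp, hpq⟩
  obtain ⟨q', hq', hd⟩ : ∃ q' ∈ K ∪ Prod.snd '' leafGraph R W z (Icc a b), dist q q' < r / 2 := by
    obtain hpb | hpb := le_total (z p) b
    · exact ⟨q, Or.inr ⟨(z p, q), ⟨⟨hp.1, hpb⟩, p, hpW, rfl, hpq⟩, rfl⟩, by simpa using half_pos hr⟩
    · have hcb : IsCompact (leafGraph R W z (Icc b (z p))) :=
        F.isCompact_leafGraph_Icc hW ((Icc_subset_Icc hb.1 hp.2.le).trans hsub)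
          fun y hy hyb => h y hy ⟨hb.1.trans hyb.1, hyb.2.trans_lt hp.2⟩
      obtain ⟨q', hq', hd⟩ := F.exists_dist_le hε hK hW hcb
        (q := q) ⟨⟨hpb, le_rfl⟩, p, hpW, rfl, hpq⟩
      refine ⟨q', ?_, hd.trans_lt ?_⟩
      · obtain hq' | ⟨_, y, hy, hyb, hyq⟩ := hq'
        · exact Or.inl hq'
        · exact Or.inr ⟨(b, q'), ⟨⟨hb.1, le_rfl⟩, y, hy, hyb, hyq⟩, rfl⟩
      · rw [div_lt_iff₀ hε]
        linarith [hp.2, hb.2]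
  obtain ⟨i, hi, hqi⟩ := mem_iUnion₂.1 (hcov hq')
  refine mem_iUnion₂.2 ⟨i, hi, ?_⟩
  rw [Metric.mem_ball] at hqi ⊢
  linarith [dist_triangle q q' i]

/-- Continuation: below a point of the class of `x`, the classes are those below `x`. -/
theorem mem_leafGraph_of_below [LocallyCompactSpace M] {W : Set M} {z : M → ℝ} (hW : Ch W z)
    {a : ℝ} {x : M} (hx : x ∈ W) (hsub : Icc a (z x) ⊆ z '' W)
    (h : ∀ y ∈ W, z y ∈ Ico a (z x) → IsCompact {q | R y q})
    {W₁ : Set M} {z₁ : M → ℝ} (h₁ : Ch W₁ z₁) {q₂ : M} (hq₂ : q₂ ∈ W₁) (hR : R x q₂)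
    {σ : ℝ} (hσ : 0 < σ) (hσa : σ ≤ z x - a) (hsub₁ : Icc (z₁ q₂ - σ) (z₁ q₂) ⊆ z₁ '' W₁) :
    ∀ y ∈ W₁, z₁ y = z₁ q₂ - σ → ∃ p ∈ W, z p = z x - σ ∧ R p y := by
  let S : Set ℝ := {s | ∀ y ∈ W₁, z₁ y = z₁ q₂ - s → ∃ p ∈ W, z p = z x - s ∧ R p y}
  obtain ⟨η, hη, H⟩ := F.holonomy hR hW hx h₁ hq₂
  -- The start is at positive depth because the class of `x` itself may be non-compact; at depth
  -- `s₀` and below, the family is compact.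
  set s₀ := min (η / 2) σ
  have hs₀ : 0 < s₀ := lt_min (half_pos hη) hσ
  have hs₀S : s₀ ∈ S := by
    intro y hy hyz
    obtain ⟨p, hp, hpz, hpR⟩ := H y hy (by
      rw [hyz, sub_sub_cancel_left, abs_neg, abs_of_pos hs₀]
      exact (min_le_left _ _).trans_lt (by linarith))
    exact ⟨p, hp, by linarith, hpR⟩
  have hA : IsCompact (leafGraph R W z (Icc a (z x - s₀))) :=
    F.isCompact_leafGraph_Icc hW ((Icc_subset_Icc_right (by linarith)).trans hsub)
      fun y hy hyb => h y hy ⟨hyb.1, hyb.2.trans_lt (by linarith)⟩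
  -- Points at limiting depths are limits of points of the compact family, hence belong to it.
  -- Holonomy gives the openness needed for continuous induction on the depth.
  have hcl : IsClosed (S ∩ Icc s₀ σ) := by
    refine isClosed_of_closure_subset fun s hs => ?_
    have hsI : s ∈ Icc s₀ σ := closure_minimal inter_subset_right isClosed_Icc hs
    refine ⟨fun y hy hyz => ?_, hsI⟩
    suffices (z x - s, y) ∈ leafGraph R W z (Icc a (z x - s₀)) by
      obtain ⟨-, p, hp, hpz, hpR⟩ := this
      exact ⟨p, hp, hpz, hpR⟩
    rw [← hA.isClosed.closure_eq, Metric.mem_closure_iff]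
    intro r hr
    obtain ⟨η', hη', H'⟩ := (F.isBox h₁).relOpen y hy _ (Metric.ball_mem_nhds y hr)
    obtain ⟨s', ⟨hs'S, hs'I⟩, hd⟩ := Metric.mem_closure_iff.1 hs _ (lt_min hη' hr)
    rw [Real.dist_eq] at hd
    obtain ⟨y₁, hy₁W, hy₁z⟩ := hsub₁ (show z₁ q₂ - s' ∈ Icc (z₁ q₂ - σ) (z₁ q₂) from
      ⟨by linarith [hs'I.2], by linarith [hs'I.1]⟩)
    obtain ⟨y', hy'd, hy'W, hy'z⟩ := H' y₁ hy₁W (by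
      rw [hy₁z, hyz, sub_sub_sub_cancel_left]
      exact hd.trans_le (min_le_left _ _))
    obtain ⟨p, hp, hpz, hpR⟩ := hs'S y' hy'W (hy'z.trans hy₁z)
    refine ⟨(z x - s', y'), ⟨⟨?_, ?_⟩, p, hp, hpz, hpR⟩, ?_⟩
    · dsimp only; linarith [hs'I.2]
    · dsimp only; linarith [hs'I.1]
    · rw [Prod.dist_eq, max_lt_iff]
      refine ⟨?_, by rw [dist_comm]; exact hy'd⟩
      rw [Real.dist_eq, sub_sub_sub_cancel_left, abs_sub_comm]
      exact hd.trans_le (min_le_right _ _)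
  have hIcc : Icc s₀ σ ⊆ S := by
    refine hcl.Icc_subset_of_forall_mem_nhdsWithin hs₀S ?_
    rintro s ⟨hsS, hsI⟩
    obtain ⟨y, hyW, hyz⟩ := hsub₁ (show z₁ q₂ - s ∈ Icc (z₁ q₂ - σ) (z₁ q₂) from
      ⟨by linarith [hsI.2], by linarith [hsI.1]⟩)
    obtain ⟨p, hp, hpz, hpR⟩ := hsS y hyW hyz
    obtain ⟨η', hη', H'⟩ := F.holonomy hpR hW hp h₁ hyW
    apply mem_nhdsWithin_of_mem_nhds
    filter_upwards [Metric.ball_mem_nhds s hη'] with s' hs' y' hy' hy'z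
    obtain ⟨p', hp', hp'z, hp'R⟩ := H' y' hy' (by
      rw [hy'z, hyz, sub_sub_sub_cancel_left, abs_sub_comm]
      exact hs')
    exact ⟨p', hp', by linarith, hp'R⟩
  exact hIcc ⟨min_le_right _ _, le_rfl⟩

/-- A class which is the upper end of a family of compact classes is compact. -/
theorem isCompact_class_of_Ico [LocallyCompactSpace M] [CompleteSpace M] {K : Set M}
    (hKc : IsCompact K) {ε : ℝ}
    (hε : 0 < ε) (hK : HasSlope Ch K ε) {W : Set M} {z : M → ℝ} (hW : Ch W z) {a : ℝ} {x : M}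
    (hx : x ∈ W) (hax : a < z x) (hsub : Icc a (z x) ⊆ z '' W)
    (h : ∀ y ∈ W, z y ∈ Ico a (z x) → IsCompact {q | R y q}) :
    IsCompact {q | R x q} := by
  -- The contradiction hypothesis is kept while compactness is proved: non-compactness is what keeps
  -- returns of the class to a box apart.
  by_contra hnc
  apply hnc
  set U : Set M := {q | ∃ p ∈ W, z p ∈ Ico a (z x) ∧ R p q}
  have hU : IsCompact (closure U) :=
    isCompact_iff_totallyBounded_isComplete.2
      ⟨(F.totallyBounded_classes hKc hε hK hW hax hsub h).closure, isClosed_closure.isComplete⟩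
  refine hU.of_isClosed_subset ?_ ?_
  · refine isClosed_of_closure_subset fun q hq => ?_
    obtain ⟨W₁, z₁, h₁, hqW₁, -⟩ := F.exists_box q univ univ_mem
    -- Two returns of the class to a box at different levels differ by more than `z x - a`.
    -- Otherwise continuation would put the lower one on a compact class of the family. Hence the
    -- class is closed.
    have hsep : ∀ q₁ ∈ W₁, ∀ q₂ ∈ W₁, R x q₁ → R x q₂ → z₁ q₁ < z₁ q₂ →
        z x - a < z₁ q₂ - z₁ q₁ := by
      intro q₁ hq₁ q₂ hq₂ hR₁ hR₂ hlt
      by_contra! hle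
      have hord := ((F.isBox h₁).preconnected.image z₁ (F.isBox h₁).continuousOn).ordConnected
      have hsub₁ := hord.out (mem_image_of_mem z₁ hq₁) (mem_image_of_mem z₁ hq₂)
      obtain ⟨p, hp, hpz, hpR⟩ := F.mem_leafGraph_of_below hW hx hsub h h₁ hq₂ hR₂
        (sub_pos.2 hlt) hle (by simpa using hsub₁) q₁ hq₁ (by ring)
      apply hnc
      rw [F.class_eq hR₁, ← F.class_eq hpR]
      exact h p hp ⟨by linarith, by linarith⟩
    have hcont : ContinuousAt z₁ q :=
      (F.isBox h₁).continuousOn.continuousAt ((F.isBox h₁).isOpen.mem_nhds hqW₁)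
    have hO : W₁ ∩ z₁ ⁻¹' Metric.ball (z₁ q) ((z x - a) / 2) ∈ 𝓝 q :=
      inter_mem ((F.isBox h₁).isOpen.mem_nhds hqW₁)
        (hcont (Metric.ball_mem_nhds _ (by linarith)))
    obtain ⟨q₀, ⟨hq₀W, hq₀z⟩, hq₀R⟩ := mem_closure_iff_nhds.1 hq _ hO
    have hq₀R : R x q₀ := hq₀R
    have heq : z₁ q₀ = z₁ q := by
      by_contra hne
      have hO' := inter_mem hO (hcont (Metric.ball_mem_nhds (z₁ q)
        (abs_pos.2 (sub_ne_zero.2 hne))))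
      obtain ⟨q', ⟨⟨hq'W, hq'z⟩, hq'n⟩, hq'R⟩ := mem_closure_iff_nhds.1 hq _ hO'
      have hq'R : R x q' := hq'R
      simp only [mem_preimage, Metric.mem_ball, Real.dist_eq] at hq₀z hq'z hq'n
      rw [abs_lt] at hq₀z hq'z
      obtain hl | hl | hl := lt_trichotomy (z₁ q₀) (z₁ q')
      · have := hsep _ hq₀W _ hq'W hq₀R hq'R hl
        linarith [hq₀z.1, hq'z.2]
      · rw [hl] at hq'n
        exact lt_irrefl _ hq'n
      · have := hsep _ hq'W _ hq₀W hq'R hq₀R hl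
        linarith [hq₀z.2, hq'z.1]
    exact F.equiv.trans hq₀R ((F.isBox h₁).level _ hq₀W _ hqW₁ heq)
  -- Every neighbourhood of a point of the class meets nearby lower classes by holonomy, so the
  -- class lies in the closure of the family.
  · intro q hq
    rw [mem_closure_iff_nhds]
    intro O hO
    obtain ⟨W₁, z₁, h₁, hqW₁, hW₁O⟩ := F.exists_box q O hO
    obtain ⟨η, hη, H⟩ := F.holonomy (F.equiv.symm hq) h₁ hqW₁ hW hx
    obtain ⟨t, ht, htx⟩ := exists_between (max_lt hax (sub_lt_self (z x) hη))
    obtain ⟨y', hy'W, rfl⟩ := hsub ⟨((le_max_left _ _).trans_lt ht).le, htx.le⟩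
    obtain ⟨y, hyW, -, hyR⟩ := H y' hy'W (by
      rw [abs_sub_comm, abs_of_pos (sub_pos.2 htx)]
      linarith [(le_max_right _ _).trans_lt ht])
    exact ⟨y, hW₁O hyW, y', hy'W, ⟨((le_max_left _ _).trans_lt ht).le, htx⟩, F.equiv.symm hyR⟩

/-- The levels carrying non-compact classes are closed in `[z y, z x]`, because the compact classes
have open union. A lowest such level would be the upper end of a family of compact classes, hence
compact. -/
theorem isCompact_class_of_lt [LocallyCompactSpace M] [CompleteSpace M] {K : Set M}
    (hKc : IsCompact K) {ε : ℝ} (hε : 0 < ε) (hK : HasSlope Ch K ε) {W : Set M} {z : M → ℝ}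
    (hW : Ch W z) {y x : M} (hy : y ∈ W) (hx : x ∈ W) (hyx : z y < z x)
    (hc : IsCompact {q | R y q}) : IsCompact {q | R x q} := by
  by_contra hnc
  have hord := ((F.isBox hW).preconnected.image z (F.isBox hW).continuousOn).ordConnected
  have hsub := hord.out (mem_image_of_mem z hy) (mem_image_of_mem z hx)
  set B : Set ℝ := {t | t ∈ Icc (z y) (z x) ∧ ∃ p ∈ W, z p = t ∧ ¬ IsCompact {q | R p q}}
  have hB : IsClosed B := by
    refine isClosed_of_closure_subset fun t ht => ?_
    have htI : t ∈ Icc (z y) (z x) := closure_minimal (fun _ h => h.1) isClosed_Icc ht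
    obtain ⟨p, hp, rfl⟩ := hsub htI
    refine ⟨htI, p, hp, rfl, fun hpc => ?_⟩
    obtain ⟨η, hη, H⟩ := (F.isBox hW).relOpen p hp _ (F.isOpen_isCompact_class.mem_nhds hpc)
    obtain ⟨t', ⟨-, p', hp', rfl, hn⟩, hd⟩ := Metric.mem_closure_iff.1 ht η hη
    obtain ⟨p'', h1, h2, h3⟩ := H p' hp' (by rw [← Real.dist_eq, dist_comm]; exact hd)
    apply hn
    rw [← F.class_eq ((F.isBox hW).level _ h2 _ hp' h3)]
    exact h1
  have hBb : BddBelow B := ⟨z y, fun t ht => ht.1.1⟩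
  obtain ⟨hτI, p, hpW, hpz, hpn⟩ := hB.csInf_mem ⟨z x, ⟨hyx.le, le_rfl⟩, x, hx, rfl, hnc⟩ hBb
  have hyτ : z y < z p := by
    rw [hpz]
    refine lt_of_le_of_ne hτI.1 fun e => hpn ?_
    rw [← F.class_eq ((F.isBox hW).level _ hy _ hpW (e.trans hpz.symm))]
    exact hc
  refine hpn (F.isCompact_class_of_Ico hKc hε hK hW hpW hyτ
    ((Icc_subset_Icc_right (hpz ▸ hτI.2)).trans hsub) fun p' hp' hI => ?_)
  by_contra hn
  exact notMem_of_lt_csInf (hpz ▸ hI.2) hBb ⟨⟨hI.1, hI.2.le.trans (hpz ▸ hτI.2)⟩, p', hp', rfl, hn⟩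

/-- If one class is compact then all classes are. -/
theorem isCompact_class [LocallyCompactSpace M] [CompleteSpace M] [PreconnectedSpace M]
    {K : Set M} (hKc : IsCompact K) {ε : ℝ} (hε : 0 < ε) (hK : HasSlope Ch K ε)
    (hK' : HasSlope (fun W z => Ch W (-z)) K ε) {x : M} (hx : IsCompact {y | R x y}) (y : M) :
    IsCompact {q | R y q} := by
  have hcl : IsClopen {x | IsCompact {y | R x y}} := by
    refine ⟨isClosed_of_closure_subset fun y hy => ?_, F.isOpen_isCompact_class⟩
    obtain ⟨W, z, hW, hyW, -⟩ := F.exists_box y univ univ_mem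
    obtain ⟨p, hpW, hp⟩ := mem_closure_iff_nhds.1 hy _ ((F.isBox hW).isOpen.mem_nhds hyW)
    -- Compactness passes from `p` upwards, along the level, or downwards; changing the sign of all
    -- local functions reduces the last case to the first.
    obtain hl | hl | hl := lt_trichotomy (z p) (z y)
    · exact F.isCompact_class_of_lt hKc hε hK hW hpW hyW hl hp
    · change IsCompact _
      rw [← F.class_eq ((F.isBox hW).level _ hpW _ hyW hl)]
      exact hp
    · exact F.neg.isCompact_class_of_lt hKc hε hK' (W := W) (z := -z) (by simpa using hW) hpW hyW
        (by simpa using hl) hp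
  obtain h | h := isClopen_iff.1 hcl
  · exact absurd (show x ∈ ({x | IsCompact {y | R x y}} : Set M) from hx) (by simp [h])
  · exact (h ▸ mem_univ y : y ∈ {x | IsCompact {y | R x y}})

end Foliation

end LevelFoliation

/-! ### Hadamard's lemma, cutoffs and the implicit function theorem. -/

namespace Splitting

open Filter Topology Asymptotics

section Parametric

variable {X : Type*} [NormedAddCommGroup X] [NormedSpace ℝ X] [FiniteDimensional ℝ X]

theorem hasFDerivAt_intervalIntegral {f : X × ℝ → ℝ} (hf : ContDiff ℝ 1 f) (x : X) :
    HasFDerivAt (fun x => ∫ τ in (0 : ℝ)..1, f (x, τ))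
      (∫ τ in (0 : ℝ)..1, (fderiv ℝ f (x, τ)).comp (.inl ℝ X ℝ)) x := by
  have hc : Continuous fun p : X × ℝ => (fderiv ℝ f p).comp (.inl ℝ X ℝ) :=
    (hf.continuous_fderiv one_ne_zero).clm_comp continuous_const
  obtain ⟨C, hC⟩ := ((isCompact_closedBall x 1).prod
    (isCompact_Icc (a := (0 : ℝ)) (b := 1))).exists_bound_of_continuousOn hc.continuousOn
  refine intervalIntegral.hasFDerivAt_integral_of_dominated_of_fderiv_le
    (F' := fun x τ => (fderiv ℝ f (x, τ)).comp (.inl ℝ X ℝ)) (bound := fun _ => C)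
    (Metric.closedBall_mem_nhds x one_pos) ?_ ?_ ?_ ?_ ?_ ?_
  · exact Eventually.of_forall fun y =>
      (hf.continuous.comp (by fun_prop : Continuous fun τ : ℝ => (y, τ))).aestronglyMeasurable
  · exact (hf.continuous.comp (by fun_prop : Continuous fun τ : ℝ => (x, τ))).intervalIntegrable _ _
  · exact (hc.comp (by fun_prop : Continuous fun τ : ℝ => (x, τ))).aestronglyMeasurable
  · refine Eventually.of_forall fun τ hτ y hy => hC (y, τ) ⟨hy, ?_⟩
    rw [uIoc_of_le zero_le_one] at hτ
    exact ⟨hτ.1.le, hτ.2⟩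
  · exact intervalIntegrable_const
  · refine Eventually.of_forall fun τ _ y _ => ?_
    have h1 := (hf.differentiable one_ne_zero (y, τ)).hasFDerivAt
    have h2 : HasFDerivAt (fun y : X => (y, τ)) (.inl ℝ X ℝ) y := hasFDerivAt_prodMk_left y τ
    exact h1.comp y h2

theorem contDiff_intervalIntegral {n : ℕ} {f : X × ℝ → ℝ} (hf : ContDiff ℝ n f) :
    ContDiff ℝ n fun x => ∫ τ in (0 : ℝ)..1, f (x, τ) := by
  induction n generalizing f with
  | zero =>
    rw [Nat.cast_zero, contDiff_zero] at hf ⊢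
    exact intervalIntegral.continuous_parametric_intervalIntegral_of_continuous'
      (f := fun x τ => f (x, τ)) hf 0 1
  | succ n ih =>
    have h1 : ContDiff ℝ 1 f := hf.of_le (by exact_mod_cast Nat.le_add_left 1 n)
    rw [Nat.cast_add, Nat.cast_one] at hf ⊢
    rw [contDiff_succ_iff_fderiv_apply]
    refine ⟨fun x => (hasFDerivAt_intervalIntegral h1 x).differentiableAt, by simp, fun y => ?_⟩
    have hc : Continuous fun p : X × ℝ => (fderiv ℝ f p).comp (.inl ℝ X ℝ) :=
      (h1.continuous_fderiv one_ne_zero).clm_comp continuous_const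
    have : (fun x => fderiv ℝ (fun x => ∫ τ in (0 : ℝ)..1, f (x, τ)) x y) =
        fun x => ∫ τ in (0 : ℝ)..1, fderiv ℝ f (x, τ) (y, 0) := by
      ext x
      rw [(hasFDerivAt_intervalIntegral h1 x).fderiv, ContinuousLinearMap.intervalIntegral_apply]
      · simp
      · exact (hc.comp (by fun_prop : Continuous fun τ : ℝ => (x, τ))).intervalIntegrable _ _
    rw [this]
    exact ih (((contDiff_succ_iff_fderiv.1 hf).2.2).clm_apply contDiff_const)

end Parametric

section Hadamard

variable {F : Type*} [NormedAddCommGroup F] [NormedSpace ℝ F] [FiniteDimensional ℝ F]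

/-- The quotient is the mean of the first partial derivative along the segment from `(0, w)` to `(t,
w)`, which costs one derivative. -/
theorem exists_eq_add_mul {n : ℕ} {f : ℝ × F → ℝ} (hf : ContDiff ℝ (n + 1) f) :
    ∃ g : ℝ × F → ℝ, ContDiff ℝ n g ∧ ∀ t w, f (t, w) = f (0, w) + t * g (t, w) := by
  have hd : ContDiff ℝ n fun p => fderiv ℝ f p (1, 0) :=
    ((contDiff_succ_iff_fderiv.1 hf).2.2).clm_apply contDiff_const
  refine ⟨fun p => ∫ τ in (0 : ℝ)..1, fderiv ℝ f (τ * p.1, p.2) (1, 0),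
    contDiff_intervalIntegral (f := fun q : (ℝ × F) × ℝ => fderiv ℝ f (q.2 * q.1.1, q.1.2) (1, 0))
      (hd.comp (by fun_prop)), fun t w => ?_⟩
  have h1 : ∀ τ ∈ uIcc (0 : ℝ) 1,
      HasDerivAt (fun τ => f (τ * t, w)) (fderiv ℝ f (τ * t, w) (1, 0) * t) τ := by
    intro τ _
    have h2 : HasDerivAt (fun τ : ℝ => (τ * t, w)) (t, 0) τ := by
      simpa using ((hasDerivAt_id τ).mul_const t).prodMk (hasDerivAt_const τ w)
    have h3 := ((hf.differentiable (by simp)) (τ * t, w)).hasFDerivAt.comp_hasDerivAt τ h2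
    convert! h3 using 1
    have : ((t, 0) : ℝ × F) = t • (1, 0) := by simp
    rw [this, map_smul, smul_eq_mul, mul_comm]
  have h4 := intervalIntegral.integral_eq_sub_of_hasDerivAt h1
    ((((hd.continuous).comp (by fun_prop : Continuous fun τ : ℝ => (τ * t, w))).mul
      continuous_const).intervalIntegrable _ _)
  simp only [one_mul, zero_mul] at h4
  rw [intervalIntegral.integral_mul_const] at h4
  simp only
  linarith

/-- Second order Hadamard lemma. -/
theorem exists_eq_add_mul_add_sq_mul {n : ℕ} {f : ℝ × F → ℝ} (hf : ContDiff ℝ (n + 2) f) :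
    ∃ β : ℝ × F → ℝ, ContDiff ℝ n β ∧
      ∀ t w, f (t, w) = f (0, w) + t * fderiv ℝ f (0, w) (1, 0) + t ^ 2 * β (t, w) := by
  obtain ⟨g, hg, hfg⟩ := exists_eq_add_mul (n := n + 1) (f := f) (by exact_mod_cast hf)
  obtain ⟨β, hβ, hgβ⟩ := exists_eq_add_mul (n := n) (f := g) (by exact_mod_cast hg)
  refine ⟨β, hβ, fun t w => ?_⟩
  have hg0 : fderiv ℝ f (0, w) (1, 0) = g (0, w) := by
    have h1 : HasDerivAt (fun t : ℝ => f (t, w)) (fderiv ℝ f (0, w) (1, 0)) 0 := by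
      have h2 : HasDerivAt (fun t : ℝ => (t, w)) (1, 0) 0 :=
        (hasDerivAt_id 0).prodMk (hasDerivAt_const 0 w)
      exact ((hf.differentiable (by simp)) (0, w)).hasFDerivAt.comp_hasDerivAt 0 h2
    have h3 : HasDerivAt (fun t : ℝ => f (t, w)) (g (0, w)) 0 := by
      have h4 : (fun t : ℝ => f (t, w)) = fun t => f (0, w) + t * g (t, w) := by
        ext t; exact hfg t w
      rw [h4]
      have hgd : DifferentiableAt ℝ (fun t : ℝ => g (t, w)) 0 :=
        ((hg.differentiable (by simp)) (0, w)).comp 0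
          (by fun_prop : DifferentiableAt ℝ (fun t : ℝ => (t, w)) 0)
      have := ((hasDerivAt_id (0 : ℝ)).mul hgd.hasDerivAt).const_add (f (0, w))
      simpa using! this
    exact h1.unique h3
  rw [hfg, hgβ, hg0]
  ring

end Hadamard

section Cutoff

variable {X : Type*} [NormedAddCommGroup X] [NormedSpace ℝ X] [FiniteDimensional ℝ X]

/-- Hadamard's lemma integrates along whole segments and is stated for global functions; a bump
function makes a germ global. -/
theorem exists_contDiff_eventuallyEq {n : ℕ} {f : X → ℝ} {x : X} (hf : ContDiffAt ℝ n f x) :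
    ∃ g : X → ℝ, ContDiff ℝ n g ∧ g =ᶠ[𝓝 x] f := by
  have hev : ∀ᶠ y in 𝓝 x, ContDiffAt ℝ n f y := hf.eventually (by simp)
  obtain ⟨r, hr, hball⟩ := Metric.eventually_nhds_iff_ball.1 hev
  let χ : ContDiffBump x := ⟨r / 4, r / 2, by linarith, by linarith⟩
  refine ⟨fun y => χ y * f y, contDiff_iff_contDiffAt.2 fun y => ?_, ?_⟩
  · by_cases hy : y ∈ Metric.ball x r
    · exact χ.contDiff.contDiffAt.mul (hball y hy)
    · have : (fun y => χ y * f y) =ᶠ[𝓝 y] fun _ => 0 := by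
        have hmem : (Metric.closedBall x (r / 2))ᶜ ∈ 𝓝 y := by
          refine Metric.isClosed_closedBall.isOpen_compl.mem_nhds ?_
          simp only [Metric.mem_ball, not_lt, mem_compl_iff, Metric.mem_closedBall] at hy ⊢
          linarith
        filter_upwards [hmem] with y' hy'
        have : χ y' = 0 := χ.zero_of_le_dist (by
          simp only [mem_compl_iff, Metric.mem_closedBall, not_le] at hy'
          exact hy'.le)
        simp [this]
      exact contDiffAt_const.congr_of_eventuallyEq this
  · filter_upwards [χ.eventuallyEq_one] with y hy
    simp [hy]

end Cutoff

section Implicit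

variable {𝕜 : Type*} [RCLike 𝕜] {F : Type*} [NormedAddCommGroup F] [NormedSpace 𝕜 F]
  [CompleteSpace F]

/-- Needed over both fields: over `ℝ` for the critical points in the Morse lemma, over `ℂ` for a
holomorphic curve of zeros of `V`. -/
theorem exists_implicit {n : WithTop ℕ∞} (hn : n ≠ 0) {g : 𝕜 × F → 𝕜} (hg : ContDiffAt 𝕜 n g 0)
    (h0 : g 0 = 0) (h1 : fderiv 𝕜 g 0 (1, 0) ≠ 0) :
    ∃ m : F → 𝕜, ContDiffAt 𝕜 n m 0 ∧ m 0 = 0 ∧ ∀ᶠ w in 𝓝 0, g (m w, w) = 0 := by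
  set f : F × 𝕜 → 𝕜 := fun p => g (p.2, p.1) with hf
  have hfc : ContDiffAt 𝕜 n f 0 := ContDiffAt.comp (g := g) (f := fun p : F × 𝕜 => (p.2, p.1)) 0 hg
    (contDiffAt_snd.prodMk contDiffAt_fst)
  have hfd : fderiv 𝕜 f 0 =
      (fderiv 𝕜 g 0).comp ((ContinuousLinearMap.snd 𝕜 F 𝕜).prod (.fst 𝕜 F 𝕜)) := by
    have h2 : HasFDerivAt g (fderiv 𝕜 g 0) ((0 : F × 𝕜).2, (0 : F × 𝕜).1) :=
      (hg.differentiableAt hn).hasFDerivAt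
    have h3 : HasFDerivAt (fun p : F × 𝕜 => (p.2, p.1))
      ((ContinuousLinearMap.snd 𝕜 F 𝕜).prod (.fst 𝕜 F 𝕜)) 0 :=
      hasFDerivAt_snd.prodMk hasFDerivAt_fst
    exact (h2.comp (0 : F × 𝕜) h3).fderiv
  have hinv : (fderiv 𝕜 f 0 ∘L .inr 𝕜 F 𝕜).IsInvertible := by
    refine ⟨ContinuousLinearEquiv.unitsEquivAut 𝕜 (Units.mk0 _ h1), ?_⟩
    ext
    simp [hfd]
  have hf0 : f 0 = 0 := h0
  refine ⟨hfc.implicitFunction hn hinv, hfc.contDiffAt_implicitFunction hn hinv,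
    hfc.implicitFunction_apply_self hn hinv, ?_⟩
  filter_upwards [hfc.eventually_apply_implicitFunction hn hinv] with w hw
  rw [hf0] at hw
  exact hw

end Implicit

end Splitting

/-! ### The Morse lemma with parameters in one real variable. -/

namespace Splitting

open Filter Topology Asymptotics

theorem coeff_eq_zero_of_isLittleO {c : ℝ} {u : ℝ → ℝ} (hu : ContinuousAt u 0)
    (h : (fun t => t * c + t ^ 2 * u t) =o[𝓝 0] fun t => t ^ 2) : c = 0 ∧ u 0 = 0 := by
  have h' : (fun t => t * c + t ^ 2 * u t) =o[𝓝[≠] 0] fun t : ℝ => t ^ 2 :=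
    h.mono nhdsWithin_le_nhds
  have ht0 : Tendsto (fun t : ℝ => t) (𝓝[≠] 0) (𝓝 0) := nhdsWithin_le_nhds
  have hut : Tendsto u (𝓝[≠] 0) (𝓝 (u 0)) := hu.tendsto.mono_left nhdsWithin_le_nhds
  have hlim := (isLittleO_iff_tendsto' (by
    filter_upwards [self_mem_nhdsWithin] with t ht ht'
    exact absurd (pow_eq_zero_iff two_ne_zero |>.1 ht') ht)).1 h'
  have hc : c = 0 := by
    have h1 : Tendsto (fun t => c + t * u t) (𝓝[≠] 0) (𝓝 (c + 0 * u 0)) :=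
      (tendsto_const_nhds).add (ht0.mul hut)
    have h2 : Tendsto (fun t => t * ((t * c + t ^ 2 * u t) / t ^ 2)) (𝓝[≠] 0) (𝓝 (0 * 0)) :=
      ht0.mul hlim
    have h3 : (fun t => t * ((t * c + t ^ 2 * u t) / t ^ 2)) =ᶠ[𝓝[≠] 0] fun t => c + t * u t := by
      filter_upwards [self_mem_nhdsWithin] with t ht
      have ht : t ≠ 0 := ht
      field_simp
    have := tendsto_nhds_unique (h2.congr' h3) h1
    simpa using this.symm
  refine ⟨hc, ?_⟩
  have h3 : (fun t => (t * c + t ^ 2 * u t) / t ^ 2) =ᶠ[𝓝[≠] 0] u := by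
    filter_upwards [self_mem_nhdsWithin] with t ht
    have ht : t ≠ 0 := ht
    rw [hc]
    field_simp
    ring
  exact (tendsto_nhds_unique (hlim.congr' h3) hut).symm

variable {F : Type*} [NormedAddCommGroup F] [NormedSpace ℝ F]

theorem hasDerivAt_fst_line {k : ℝ × F → ℝ} {t : ℝ} {w : F} (hk : DifferentiableAt ℝ k (t, w)) :
    HasDerivAt (fun t : ℝ => k (t, w)) (fderiv ℝ k (t, w) (1, 0)) t := by
  have h2 : HasDerivAt (fun t : ℝ => (t, w)) (1, 0) t :=
    (hasDerivAt_id t).prodMk (hasDerivAt_const t w)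
  exact hk.hasFDerivAt.comp_hasDerivAt t h2

/-- A differentiable `m` with `m 0 = 0` satisfies `m w = O(‖w‖)`, so the second order expansion may
be restricted to its graph. -/
theorem isLittleO_restrict {f : ℝ × F → ℝ} {a : ℝ} {Q : F → ℝ}
    (hfQ : (fun p => f p - (a * p.1 ^ 2 + Q p.2)) =o[𝓝 0] fun p => ‖p‖ ^ 2) {m : F → ℝ}
    (hm0 : m 0 = 0) (hm : DifferentiableAt ℝ m 0) :
    (fun w => f (m w, w) - (a * m w ^ 2 + Q w)) =o[𝓝 0] fun w => ‖w‖ ^ 2 := by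
  have hO : (fun w => (m w, w)) =O[𝓝 0] fun w : F => w := by
    refine IsBigO.prod_left ?_ (isBigO_refl _ _)
    simpa [hm0] using hm.isBigO_sub
  have ht : Tendsto (fun w => (m w, w)) (𝓝 (0 : F)) (𝓝 (0 : ℝ × F)) := by
    have : ContinuousAt (fun w => (m w, w)) (0 : F) := hm.continuousAt.prodMk continuousAt_id
    simpa [ContinuousAt, hm0] using! this
  exact (hfQ.comp_tendsto ht).trans_isBigO (hO.norm_norm.pow 2)

theorem coeff_of_isLittleO {n : ℕ} {f β : ℝ × F → ℝ} (hβ : ContDiff ℝ n β) {a c : ℝ} {Q : F → ℝ}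
    (hfQ : (fun p => f p - (a * p.1 ^ 2 + Q p.2)) =o[𝓝 0] fun p => ‖p‖ ^ 2)
    (h : ∀ t, f (t, 0) = f 0 + t * c + t ^ 2 * β (t, 0)) : c = 0 ∧ β 0 = a := by
  have hf0 : f 0 = Q 0 := by
    have := (hfQ.def one_pos).self_of_nhds
    simpa [sub_eq_zero] using this
  have ht : Tendsto (fun t : ℝ => (t, (0 : F))) (𝓝 0) (𝓝 0) := by
    have : Continuous (fun t : ℝ => (t, (0 : F))) := by fun_prop
    simpa using! this.tendsto 0
  have h1 := hfQ.comp_tendsto ht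
  have h2 : (fun t : ℝ => t * c + t ^ 2 * (β (t, 0) - a)) =o[𝓝 0] fun t : ℝ => t ^ 2 := by
    refine (h1.congr_left fun t => ?_).congr_right fun t => ?_
    · simp only [Function.comp_apply, h, hf0]; ring
    · simp [Prod.norm_def]
  obtain ⟨hc, hu⟩ := coeff_eq_zero_of_isLittleO (u := fun t => β (t, 0) - a) (by
    have := hβ.continuous
    fun_prop) h2
  exact ⟨hc, sub_eq_zero.1 hu⟩

variable [FiniteDimensional ℝ F]

/-- The second derivative in the first variable, from the second order expansion. -/
theorem fderiv_fderiv_of_isLittleO {n : ℕ} (hn : 1 ≤ n) {f : ℝ × F → ℝ}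
    (hf : ContDiff ℝ (n + 2) f) {a : ℝ} {Q : F → ℝ}
    (hfQ : (fun p => f p - (a * p.1 ^ 2 + Q p.2)) =o[𝓝 0] fun p => ‖p‖ ^ 2) :
    fderiv ℝ f 0 (1, 0) = 0 ∧ fderiv ℝ (fun p => fderiv ℝ f p (1, 0)) 0 (1, 0) = 2 * a := by
  obtain ⟨β, hβ, hfβ⟩ := exists_eq_add_mul_add_sq_mul hf
  obtain ⟨hc, hβ0⟩ := coeff_of_isLittleO hβ hfQ fun t => hfβ t 0
  refine ⟨hc, ?_⟩
  have hn0 : (n : WithTop ℕ∞) ≠ 0 := by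
    have : n ≠ 0 := by omega
    exact_mod_cast this
  have hline : ∀ (k : ℝ × F → ℝ) (t : ℝ), DifferentiableAt ℝ k (t, 0) →
      HasDerivAt (fun t : ℝ => k (t, 0)) (fderiv ℝ k (t, 0) (1, 0)) t :=
    fun k t hk => hasDerivAt_fst_line hk
  -- Differentiating the Hadamard form once and then taking a difference quotient at zero requires
  -- only one derivative of `β`.
  have hg : ∀ t : ℝ, fderiv ℝ f (t, 0) (1, 0) =
      t * (2 * β (t, 0) + t * fderiv ℝ β (t, 0) (1, 0)) := by
    intro t
    have h1 := hline f t ((hf.differentiable (by simp)) _)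
    have h2 := hline β t ((hβ.differentiable hn0) _)
    have h3 : (fun t : ℝ => f (t, 0)) = fun t => f 0 + t ^ 2 * β (t, 0) := by
      ext t; rw [hfβ t 0]
      change f 0 + t * fderiv ℝ f (0, 0) (1, 0) + _ = _
      rw [hc]; ring
    have h4 := (((hasDerivAt_id t).pow 2).mul h2).const_add (f 0)
    rw [h3] at h1
    rw [h1.unique h4]
    simp only [id, Nat.cast_ofNat, Pi.pow_apply]
    ring
  have hgd : DifferentiableAt ℝ (fun p => fderiv ℝ f p (1, 0)) 0 := by
    have : ContDiff ℝ (n + 1 : ℕ) (fun p => fderiv ℝ f p (1, 0)) :=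
      ((contDiff_succ_iff_fderiv (n := ((n + 1 : ℕ) : WithTop ℕ∞)).1
        (by exact_mod_cast hf)).2.2).clm_apply contDiff_const
    exact this.differentiable (by exact_mod_cast Nat.succ_ne_zero n) 0
  have h1 := hline (fun p => fderiv ℝ f p (1, 0)) 0 hgd
  have h2 : HasDerivAt (fun t : ℝ => fderiv ℝ f (t, 0) (1, 0)) (2 * a) 0 := by
    have hu : ContinuousAt (fun t : ℝ => 2 * β (t, 0) + t * fderiv ℝ β (t, 0) (1, 0)) 0 := by
      have h1 := hβ.continuous
      have h2 := (hβ.continuous_fderiv hn0)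
      fun_prop
    rw [hasDerivAt_iff_tendsto_slope]
    refine Tendsto.congr' ?_ ((hu.tendsto.mono_left nhdsWithin_le_nhds).trans ?_)
    · filter_upwards [self_mem_nhdsWithin] with t ht
      have ht : t ≠ 0 := ht
      rw [slope_def_field, hg t, hg 0]
      field_simp
      ring
    · apply le_of_eq
      congr 1
      have : β (0, 0) = a := hβ0
      simp [this]
  exact h1.unique h2

/-- Splitting off a square: the Morse lemma with parameters in one variable. -/
theorem exists_split {n : ℕ} (hn : 1 ≤ n) {f : ℝ × F → ℝ} (hf : ContDiffAt ℝ (n + 3 : ℕ) f 0)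
    {a : ℝ} (ha : a ≠ 0) {Q : F → ℝ}
    (hfQ : (fun p => f p - (a * p.1 ^ 2 + Q p.2)) =o[𝓝 0] fun p => ‖p‖ ^ 2) :
    ∃ (s : ℝ × F → ℝ) (h : F → ℝ), ContDiffAt ℝ n s 0 ∧ s 0 = 0 ∧ fderiv ℝ s 0 (1, 0) ≠ 0 ∧
      ContDiffAt ℝ (n + 2 : ℕ) h 0 ∧ (fun w => h w - Q w) =o[𝓝 0] (fun w => ‖w‖ ^ 2) ∧
      ∀ᶠ p in 𝓝 0, f p = a * s p ^ 2 + h p.2 := by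
  obtain ⟨f₀, hf₀, hff⟩ := exists_contDiff_eventuallyEq hf
  suffices ∃ (s : ℝ × F → ℝ) (h : F → ℝ), ContDiffAt ℝ n s 0 ∧ s 0 = 0 ∧ fderiv ℝ s 0 (1, 0) ≠ 0 ∧
      ContDiffAt ℝ (n + 2 : ℕ) h 0 ∧ (fun w => h w - Q w) =o[𝓝 0] (fun w => ‖w‖ ^ 2) ∧
      ∀ᶠ p in 𝓝 0, f₀ p = a * s p ^ 2 + h p.2 by
    obtain ⟨s, h, h1, h2, h3, h4, h5, h6⟩ := this
    refine ⟨s, h, h1, h2, h3, h4, h5, ?_⟩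
    filter_upwards [h6, hff] with p hp hp'
    rw [← hp', hp]
  replace hfQ : (fun p => f₀ p - (a * p.1 ^ 2 + Q p.2)) =o[𝓝 0] fun p => ‖p‖ ^ 2 :=
    hfQ.congr' (by filter_upwards [hff] with p hp; rw [hp]) EventuallyEq.rfl
  clear hff hf
  -- the critical point in the first variable
  obtain ⟨hd0, hd1⟩ := fderiv_fderiv_of_isLittleO (n := n + 1) (by omega)
    (by exact_mod_cast hf₀) hfQ
  have hg : ContDiff ℝ (n + 2 : ℕ) (fun p => fderiv ℝ f₀ p (1, 0)) :=
    ((contDiff_succ_iff_fderiv (n := ((n + 2 : ℕ) : WithTop ℕ∞)).1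
      (by exact_mod_cast hf₀)).2.2).clm_apply contDiff_const
  have hn2 : ((n + 2 : ℕ) : WithTop ℕ∞) ≠ 0 := by exact_mod_cast Nat.succ_ne_zero (n + 1)
  obtain ⟨m₀, hm₀, hm₀0, hm₀z⟩ := exists_implicit hn2 hg.contDiffAt hd0
    (by rw [hd1]; exact mul_ne_zero two_ne_zero ha)
  obtain ⟨m, hm, hmm⟩ := exists_contDiff_eventuallyEq hm₀
  have hm0 : m 0 = 0 := by rw [hmm.self_of_nhds, hm₀0]
  have hmz : ∀ᶠ w in 𝓝 0, fderiv ℝ f₀ (m w, w) (1, 0) = 0 := by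
    filter_upwards [hm₀z, hmm] with w hw hw'
    rw [hw', hw]
  -- translate the critical points to zero
  set f₁ : ℝ × F → ℝ := fun p => f₀ (m p.2 + p.1, p.2) with hf₁
  have hf₁c : ContDiff ℝ (n + 2 : ℕ) f₁ :=
    (hf₀.of_le (by exact_mod_cast Nat.le_succ _)).comp (by fun_prop)
  obtain ⟨β, hβ, hfβ⟩ := exists_eq_add_mul_add_sq_mul (n := n) (f := f₁) (by exact_mod_cast hf₁c)
  have hf₁d : ∀ w, fderiv ℝ f₁ (0, w) (1, 0) = fderiv ℝ f₀ (m w, w) (1, 0) := by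
    intro w
    have h1 : HasDerivAt (fun t : ℝ => f₁ (t, w)) (fderiv ℝ f₁ (0, w) (1, 0)) 0 :=
      hasDerivAt_fst_line ((hf₁c.differentiable hn2) (0, w))
    have h3 : HasDerivAt (fun t : ℝ => f₁ (t, w)) (fderiv ℝ f₀ (m w, w) (1, 0)) 0 := by
      have h2 : HasDerivAt (fun t : ℝ => (m w + t, w)) (1, 0) 0 :=
        ((hasDerivAt_id 0).const_add (m w)).prodMk (hasDerivAt_const 0 w)
      have h4 := ((hf₀.differentiable (by exact_mod_cast Nat.succ_ne_zero (n + 2)))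
        (m w + 0, w)).hasFDerivAt.comp_hasDerivAt 0 h2
      simpa using! h4
    exact h1.unique h3
  set h : F → ℝ := fun w => f₀ (m w, w) with hh
  have hhc : ContDiff ℝ (n + 2 : ℕ) h :=
    (hf₀.of_le (by exact_mod_cast Nat.le_succ _)).comp (by fun_prop)
  have hsplit : ∀ᶠ p : ℝ × F in 𝓝 0,
      f₀ p = (p.1 - m p.2) ^ 2 * β (p.1 - m p.2, p.2) + h p.2 := by
    have hsnd : Tendsto (fun p : ℝ × F => p.2) (𝓝 0) (𝓝 0) := continuous_snd.tendsto 0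
    filter_upwards [hsnd.eventually hmz] with p hp
    have h1 := hfβ (p.1 - m p.2) p.2
    rw [hf₁d, hp] at h1
    simp only [hf₁, add_sub_cancel, add_zero] at h1
    rw [show f₀ p = f₀ (p.1, p.2) from rfl, h1]
    ring
  have hhQ1 := isLittleO_restrict hfQ hm0 (hm.differentiable hn2 0)
  have hβ0 : β 0 = a := by
    have hd : Tendsto (fun t : ℝ => (t, (0 : F))) (𝓝 0) (𝓝 0) := by
      have : Continuous (fun t : ℝ => (t, (0 : F))) := by fun_prop
      simpa using! this.tendsto 0
    have h1 := hfQ.comp_tendsto hd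
    have h2 : f₁ 0 = Q 0 := by
      have := (hfQ.def one_pos).self_of_nhds
      have h0 : f₁ 0 = f₀ 0 := by simp [hf₁, hm0]; rfl
      rw [h0]
      simpa [sub_eq_zero] using this
    have h3 : (fun t : ℝ => t * 0 + t ^ 2 * (β (t, 0) - a)) =o[𝓝 0] fun t : ℝ => t ^ 2 := by
      refine (h1.congr_left fun t => ?_).congr_right fun t => ?_
      · have h4 := hfβ t 0
        rw [hf₁d, hmz.self_of_nhds] at h4
        have h5 : f₁ (t, 0) = f₀ (t, 0) := by simp [hf₁, hm0]
        simp only [Function.comp_apply]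
        rw [← h5, h4, show f₁ (0, 0) = f₁ 0 from rfl, h2]
        ring
      · simp [Prod.norm_def]
    exact sub_eq_zero.1 (coeff_eq_zero_of_isLittleO (u := fun t => β (t, 0) - a) (by
      have := hβ.continuous
      fun_prop) h3).2
  -- The factor `β / a` equals one at the origin, so its root is as regular as `β`. The new
  -- coordinate is `(x - m) √(β / a)`.
  set r : ℝ × F → ℝ := fun p => √(β (p.1 - m p.2, p.2) / a) with hr
  have hr0 : r 0 = 1 := by
    have : β (0, 0) = a := hβ0
    simp [hr, hm0, this, ha]
  have hin : ContDiff ℝ n (fun p : ℝ × F => β (p.1 - m p.2, p.2) / a) := by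
    refine (hβ.comp ?_).div_const a
    have : ContDiff ℝ n m := hm.of_le (by exact_mod_cast Nat.le_add_right n 2)
    fun_prop
  have hin0 : β ((0 : ℝ × F).1 - m (0 : ℝ × F).2, (0 : ℝ × F).2) / a = 1 := by
    have : β (0, 0) = a := hβ0
    simp [hm0, this, ha]
  have hrc : ContDiffAt ℝ n r 0 := hin.contDiffAt.sqrt (by rw [hin0]; exact one_ne_zero)
  have hl : ContDiff ℝ n (fun p : ℝ × F => p.1 - m p.2) := by
    have : ContDiff ℝ n m := hm.of_le (by exact_mod_cast Nat.le_add_right n 2)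
    fun_prop
  have hn0 : (n : WithTop ℕ∞) ≠ 0 := by
    have : n ≠ 0 := by omega
    exact_mod_cast this
  have heq : ∀ᶠ p in 𝓝 0, f₀ p = a * ((p.1 - m p.2) * r p) ^ 2 + h p.2 := by
    have hpos : ∀ᶠ p : ℝ × F in 𝓝 0, 0 < β (p.1 - m p.2, p.2) / a :=
      hin.continuous.continuousAt.eventually (lt_mem_nhds (by
        change 0 < β ((0 : ℝ × F).1 - m (0 : ℝ × F).2, (0 : ℝ × F).2) / a
        rw [hin0]; exact one_pos))
    filter_upwards [hsplit, hpos] with p h1 h2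
    rw [h1, mul_pow, hr]
    simp only
    rw [Real.sq_sqrt h2.le]
    field_simp
  refine ⟨fun p => (p.1 - m p.2) * r p, h, hl.contDiffAt.mul hrc, by simp [hm0], ?_,
    hhc.contDiffAt, ?_, heq⟩
  · have h1 := ((hl.differentiable hn0) 0).hasFDerivAt.mul (hrc.differentiableAt hn0).hasFDerivAt
    have h2 : HasFDerivAt (fun p : ℝ × F => p.1 - m p.2)
        (.fst ℝ ℝ F - (fderiv ℝ m 0).comp (.snd ℝ ℝ F)) 0 :=
      hasFDerivAt_fst.sub (((hm.differentiable hn2) _).hasFDerivAt.comp (0 : ℝ × F) hasFDerivAt_snd)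
    have h3 : HasFDerivAt (fun p : ℝ × F => (p.1 - m p.2) * r p) _ 0 := h1
    rw [h3.fderiv, h2.fderiv]
    simp [hm0, hr0]
  · have h0 := isLittleO_restrict hfQ (m := fun _ => 0) rfl (differentiableAt_const _)
    have hw0 : Tendsto (fun w : F => ((0 : ℝ), w)) (𝓝 0) (𝓝 0) := by
      have : Continuous (fun w : F => ((0 : ℝ), w)) := by fun_prop
      simpa using! this.tendsto 0
    -- Comparing `f₀ (m w, w) = h w` with `f₀ (0, w) = a S² + h w` bounds `h - Q` from both sides,
    -- because `a m²` and `a S²` both have the sign of `a`. No finer estimate of `m` is needed.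
    refine (IsBigO.of_bound 1 ?_).trans_isLittleO (hhQ1.norm_left.add h0.norm_left)
    filter_upwards [hw0.eventually heq] with w hw
    simp only [Real.norm_eq_abs, one_mul]
    rw [abs_of_nonneg (a := |_| + |_|) (by positivity)]
    set S := (0 - m w) * r (0, w)
    have hw : f₀ (0, w) = a * S ^ 2 + h w := hw
    rw [abs_le]
    obtain ha' | ha' := lt_or_gt_of_ne ha
    · have h1 : a * m w ^ 2 ≤ 0 := mul_nonpos_of_nonpos_of_nonneg ha'.le (sq_nonneg _)
      have h2 : a * S ^ 2 ≤ 0 := mul_nonpos_of_nonpos_of_nonneg ha'.le (sq_nonneg _)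
      have h3 := le_abs_self (f₀ (m w, w) - (a * m w ^ 2 + Q w))
      have h4 := neg_abs_le (f₀ (m w, w) - (a * m w ^ 2 + Q w))
      have h5 := le_abs_self (f₀ (0, w) - (a * 0 ^ 2 + Q w))
      have h6 := neg_abs_le (f₀ (0, w) - (a * 0 ^ 2 + Q w))
      have h7 := abs_nonneg (f₀ (m w, w) - (a * m w ^ 2 + Q w))
      have h8 := abs_nonneg (f₀ (0, w) - (a * 0 ^ 2 + Q w))
      have h9 : h w = f₀ (m w, w) := rfl
      constructor <;> linarith
    · have h1 : 0 ≤ a * m w ^ 2 := mul_nonneg ha'.le (sq_nonneg _)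
      have h2 : 0 ≤ a * S ^ 2 := mul_nonneg ha'.le (sq_nonneg _)
      have h3 := le_abs_self (f₀ (m w, w) - (a * m w ^ 2 + Q w))
      have h4 := neg_abs_le (f₀ (m w, w) - (a * m w ^ 2 + Q w))
      have h5 := le_abs_self (f₀ (0, w) - (a * 0 ^ 2 + Q w))
      have h6 := neg_abs_le (f₀ (0, w) - (a * 0 ^ 2 + Q w))
      have h7 := abs_nonneg (f₀ (m w, w) - (a * m w ^ 2 + Q w))
      have h8 := abs_nonneg (f₀ (0, w) - (a * 0 ^ 2 + Q w))
      have h9 : h w = f₀ (m w, w) := rfl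
      constructor <;> linarith

end Splitting

/-! ### Morse and Morse-Bott normal forms in two complex variables. -/

namespace Splitting

open Filter Topology Asymptotics

theorem isLittleO_comp_clm {X Y : Type*} [NormedAddCommGroup X] [NormedSpace ℝ X]
    [NormedAddCommGroup Y] [NormedSpace ℝ Y] {f : Y → ℝ} (hf : f =o[𝓝 0] fun p => ‖p‖ ^ 2)
    (L : X →L[ℝ] Y) : (fun p => f (L p)) =o[𝓝 0] fun p => ‖p‖ ^ 2 := by
  have ht : Tendsto L (𝓝 0) (𝓝 0) := by simpa using L.continuous.tendsto 0
  exact (hf.comp_tendsto ht).trans_isBigO ((L.isBigO_id (𝓝 0)).norm_norm.pow 2)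

variable {F : Type*} [NormedAddCommGroup F] [NormedSpace ℝ F] [FiniteDimensional ℝ F]

/-- Splitting off the square of the modulus of a complex variable. -/
theorem exists_split_complex {n : ℕ} (hn : 1 ≤ n) {f : ℂ × F → ℝ}
    (hf : ContDiffAt ℝ (n + 4 : ℕ) f 0) {a : ℝ} (ha : a ≠ 0) {Q : F → ℝ}
    (hfQ : (fun p => f p - (a * ‖p.1‖ ^ 2 + Q p.2)) =o[𝓝 0] fun p => ‖p‖ ^ 2) :
    ∃ (S : ℂ × F → ℂ) (h : F → ℝ), ContDiffAt ℝ n S 0 ∧ S 0 = 0 ∧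
      (∀ u, fderiv ℝ S 0 (u, 0) = 0 → u = 0) ∧
      ContDiffAt ℝ (n + 2 : ℕ) h 0 ∧ (fun w => h w - Q w) =o[𝓝 0] (fun w => ‖w‖ ^ 2) ∧
      ∀ᶠ p in 𝓝 0, f p = a * ‖S p‖ ^ 2 + h p.2 := by
  let e : ℝ × (ℝ × F) →L[ℝ] ℂ × F :=
    (Complex.ofRealCLM.comp (.fst ℝ ℝ (ℝ × F)) +
      (Complex.I • Complex.ofRealCLM).comp ((ContinuousLinearMap.fst ℝ ℝ F).comp
        (.snd ℝ ℝ (ℝ × F)))).prod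
    ((ContinuousLinearMap.snd ℝ ℝ F).comp (.snd ℝ ℝ (ℝ × F)))
  have he : ∀ x y w, e (x, (y, w)) = (x + Complex.I * y, w) := fun x y w => by simp [e]
  have hnorm : ∀ x y : ℝ, ‖(x : ℂ) + Complex.I * y‖ ^ 2 = x ^ 2 + y ^ 2 := by
    intro x y
    rw [Complex.sq_norm, Complex.normSq_apply]
    simp
    ring
  have hfe : ContDiffAt ℝ (n + 1 + 3 : ℕ) (fun p => f (e p)) 0 := by
    refine ContDiffAt.comp (g := f) (f := e) 0 ?_ e.contDiff.contDiffAt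
    rw [map_zero]
    exact hf
  -- The real part is split off with the imaginary part as a parameter, then the imaginary part. The
  -- first splitting keeps the second order expansion of the remainder, so the second one applies.
  obtain ⟨s₁, h₁, hs₁, hs₁0, hs₁d, hh₁, hh₁Q, hf₁⟩ := exists_split (n := n + 1) (by omega) hfe ha
    (Q := fun q => a * q.1 ^ 2 + Q q.2) ((isLittleO_comp_clm hfQ e).congr_left (by
      rintro ⟨x, y, w⟩
      simp only [he, hnorm]
      ring))
  obtain ⟨s₂, h₂, hs₂, hs₂0, hs₂d, hh₂, hh₂Q, hf₂⟩ := exists_split hn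
    (by exact_mod_cast hh₁) ha hh₁Q
  let P : ℂ × F →L[ℝ] ℝ × F :=
    (Complex.imCLM.comp (.fst ℝ ℂ F)).prod (.snd ℝ ℂ F)
  let E : ℂ × F →L[ℝ] ℝ × (ℝ × F) := (Complex.reCLM.comp (.fst ℝ ℂ F)).prod P
  have hE : ∀ p, E p = (p.1.re, (p.1.im, p.2)) := fun p => rfl
  have hP : ∀ p, P p = (p.1.im, p.2) := fun p => rfl
  have heE : ∀ p, e (E p) = p := by
    rintro ⟨u, w⟩
    rw [hE, he]
    ext1
    · simp only
      rw [mul_comm]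
      exact Complex.re_add_im u
    · rfl
  have hsE : ContDiffAt ℝ (n + 1 : ℕ) (fun p => s₁ (E p)) 0 :=
    ContDiffAt.comp (g := s₁) (f := E) 0 (by rw [map_zero]; exact hs₁) E.contDiff.contDiffAt
  have hsP : ContDiffAt ℝ n (fun p => s₂ (P p)) 0 :=
    ContDiffAt.comp (g := s₂) (f := P) 0 (by rw [map_zero]; exact hs₂) P.contDiff.contDiffAt
  have hn0 : (n : WithTop ℕ∞) ≠ 0 := by
    have : n ≠ 0 := by omega
    exact_mod_cast this
  have hd₁ : HasFDerivAt (fun p => s₁ (E p)) ((fderiv ℝ s₁ 0).comp E) 0 := by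
    have : HasFDerivAt s₁ (fderiv ℝ s₁ 0) (E 0) := by
      rw [map_zero]
      exact (hs₁.differentiableAt (by exact_mod_cast Nat.succ_ne_zero n)).hasFDerivAt
    exact this.comp 0 E.hasFDerivAt
  have hd₂ : HasFDerivAt (fun p => s₂ (P p)) ((fderiv ℝ s₂ 0).comp P) 0 := by
    have : HasFDerivAt s₂ (fderiv ℝ s₂ 0) (P 0) := by
      rw [map_zero]
      exact (hs₂.differentiableAt hn0).hasFDerivAt
    exact this.comp 0 P.hasFDerivAt
  refine ⟨fun p => (s₁ (E p) : ℂ) + Complex.I * (s₂ (P p) : ℂ), h₂, ?_, ?_, ?_, hh₂, hh₂Q, ?_⟩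
  · have h1 := Complex.ofRealCLM.contDiff.contDiffAt.comp (0 : ℂ × F)
      (hsE.of_le (m := n) (by exact_mod_cast Nat.le_succ n))
    have h2 := Complex.ofRealCLM.contDiff.contDiffAt.comp (0 : ℂ × F) hsP
    exact h1.add (contDiffAt_const.mul h2)
  · simp [hs₁0, hs₂0]
  · intro u hu
    have hd : HasFDerivAt (fun p => (s₁ (E p) : ℂ) + Complex.I * (s₂ (P p) : ℂ))
        (Complex.ofRealCLM.comp ((fderiv ℝ s₁ 0).comp E) +
          Complex.I • Complex.ofRealCLM.comp ((fderiv ℝ s₂ 0).comp P)) 0 :=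
      (Complex.ofRealCLM.hasFDerivAt.comp 0 hd₁).add
        ((Complex.ofRealCLM.hasFDerivAt.comp 0 hd₂).const_mul Complex.I)
    rw [hd.fderiv] at hu
    simp only [add_apply, ContinuousLinearMap.comp_apply,
      smul_apply, Complex.ofRealCLM_apply, smul_eq_mul, hE, hP] at hu
    -- The derivative is triangular: `s₂` does not depend on the real part, so the imaginary part of
    -- `u` vanishes first.
    have him := congrArg Complex.im hu
    have hre := congrArg Complex.re hu
    simp only [Complex.add_im, Complex.ofReal_im, Complex.mul_im, Complex.I_re, Complex.I_im,
      Complex.ofReal_re, zero_mul, one_mul, zero_add, Complex.zero_im] at him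
    have e1 : ((u.im, 0) : ℝ × F) = u.im • (1, 0) := by simp
    rw [e1, map_smul, smul_eq_mul] at him
    have hu0 : u.im = 0 := (mul_eq_zero.1 him).resolve_right hs₂d
    simp only [Complex.add_re, Complex.ofReal_re, Complex.mul_re, Complex.I_re, Complex.I_im,
      Complex.ofReal_im, zero_mul, mul_zero, sub_zero, add_zero, Complex.zero_re, hu0] at hre
    have e2 : ((u.re, (0, 0)) : ℝ × (ℝ × F)) = u.re • (1, 0) := by simp
    rw [e2, map_smul, smul_eq_mul] at hre
    have hu1 : u.re = 0 := (mul_eq_zero.1 hre).resolve_right hs₁d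
    exact Complex.ext hu1 hu0
  · have hE0 : Tendsto E (𝓝 0) (𝓝 0) := by simpa using E.continuous.tendsto 0
    have hP0 : Tendsto P (𝓝 0) (𝓝 0) := by simpa using P.continuous.tendsto 0
    filter_upwards [hE0.eventually hf₁, hP0.eventually hf₂] with p hp1 hp2
    rw [heE] at hp1
    have h3 : (E p).2 = P p := rfl
    have h4 : (P p).2 = p.2 := rfl
    rw [h3] at hp1
    rw [hp1, hp2, hnorm, h4]
    ring

/-- A `C¹` change of coordinates which brings `f` into the normal form `q + c` near zero. -/
def HasNormalForm (f : ℂ × ℂ → ℝ) : Prop :=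
  ∃ (Φ : ℂ × ℂ → ℂ × ℂ) (a b c : ℝ), ContDiffAt ℝ 1 Φ 0 ∧
    Function.Injective (fderiv ℝ Φ 0) ∧ Φ 0 = 0 ∧
    ∀ᶠ p in 𝓝 0, f p = a * ‖(Φ p).1‖ ^ 2 + b * ‖(Φ p).2‖ ^ 2 + c

/-- The Morse lemma for a critical point whose Hessian is `a ‖u‖ ^ 2 + b ‖w‖ ^ 2`. -/
theorem hasNormalForm_of_nondegenerate {f : ℂ × ℂ → ℝ} (hf : ContDiffAt ℝ (7 : ℕ) f 0) {a b : ℝ}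
    (ha : a ≠ 0) (hb : b ≠ 0)
    (hfQ : (fun p => f p - (a * ‖p.1‖ ^ 2 + b * ‖p.2‖ ^ 2)) =o[𝓝 0] fun p => ‖p‖ ^ 2) :
    HasNormalForm f := by
  obtain ⟨S, h, hS, hS0, hSd, hh, hhQ, hfS⟩ := exists_split_complex (n := 3) (by norm_num) hf ha
    (Q := fun w => b * ‖w‖ ^ 2) hfQ
  -- The remainder depends on one complex variable only; splitting it with the trivial parameter
  -- space `Fin 0 → ℝ` leaves a constant.
  obtain ⟨T, k, hT, hT0, hTd, -, -, hhT⟩ := exists_split_complex (F := Fin 0 → ℝ) (n := 1) le_rfl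
    (f := fun p => h p.1) (ContDiffAt.comp (g := h) (f := Prod.fst) 0 hh contDiffAt_fst) hb
    (Q := fun _ => 0) (by
      simpa using isLittleO_comp_clm hhQ (.fst ℝ ℂ (Fin 0 → ℝ)))
  let P : ℂ × ℂ →L[ℝ] ℂ × (Fin 0 → ℝ) := (ContinuousLinearMap.snd ℝ ℂ ℂ).prod 0
  have hP : ∀ p, P p = (p.2, 0) := fun p => rfl
  have hTP : ContDiffAt ℝ 1 (fun p => T (P p)) 0 :=
    ContDiffAt.comp (g := T) (f := P) 0 (by rw [map_zero]; exact_mod_cast hT) P.contDiff.contDiffAt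
  have hdT : HasFDerivAt (fun p => T (P p)) ((fderiv ℝ T 0).comp P) 0 := by
    have : HasFDerivAt T (fderiv ℝ T 0) (P 0) := by
      rw [map_zero]
      exact (hT.differentiableAt (by norm_num)).hasFDerivAt
    exact this.comp 0 P.hasFDerivAt
  have hdS : HasFDerivAt S (fderiv ℝ S 0) 0 := (hS.differentiableAt (by norm_num)).hasFDerivAt
  refine ⟨fun p => (S p, T (P p)), a, b, k 0, (hS.of_le (by norm_num)).prodMk hTP, ?_, ?_, ?_⟩
  · rw [(hdS.prodMk hdT).fderiv]
    refine (injective_iff_map_eq_zero _).2 ?_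
    rintro ⟨u, w⟩ huw
    simp only [ContinuousLinearMap.prod_apply, ContinuousLinearMap.comp_apply, hP,
      Prod.mk_eq_zero] at huw
    have hw : w = 0 := hTd w huw.2
    subst hw
    rw [hSd u huw.1]
    rfl
  · simp [hS0, hT0]
  · have hP0 : Tendsto P (𝓝 0) (𝓝 0) := by simpa using P.continuous.tendsto 0
    filter_upwards [hfS, hP0.eventually hhT] with p h1 h2
    have h3 : (P p).1 = p.2 := rfl
    rw [h3] at h2
    rw [h1, h2, Subsingleton.elim (P p).2 0]
    ring

/-- The Morse-Bott lemma for a function which is critical along a curve transverse to the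
nondegenerate directions. -/
theorem hasNormalForm_of_degenerate {f : ℂ × ℂ → ℝ} (hf : ContDiffAt ℝ (5 : ℕ) f 0) {a : ℝ}
    (ha : a ≠ 0)
    (hfQ : (fun p => f p - a * ‖p.1‖ ^ 2) =o[𝓝 0] fun p => ‖p‖ ^ 2)
    {μ : ℂ → ℂ} (hμ : ContinuousAt μ 0) (hμ0 : μ 0 = 0)
    (hcrit : ∀ᶠ w in 𝓝 0, HasFDerivAt f (0 : ℂ × ℂ →L[ℝ] ℝ) (μ w, w)) :
    HasNormalForm f := by
  obtain ⟨S, h, hS, hS0, hSd, hh, -, hfS⟩ := exists_split_complex (n := 1) le_rfl hf ha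
    (Q := fun _ => 0) (by simpa using hfQ)
  rw [Nat.cast_one] at hS
  have hdS : HasFDerivAt S (fderiv ℝ S 0) 0 := (hS.differentiableAt (by norm_num)).hasFDerivAt
  set Φ : ℂ × ℂ → ℂ × ℂ := fun p => (S p, p.2) with hΦdef
  have hΦ0 : Φ 0 = 0 := by simp [hΦdef, hS0]
  have hΦ : ContDiffAt ℝ 1 Φ 0 := hS.prodMk contDiffAt_snd
  have hdΦ : HasFDerivAt Φ ((fderiv ℝ S 0).prod (.snd ℝ ℂ ℂ)) 0 := hdS.prodMk hasFDerivAt_snd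
  have hinj : Function.Injective ((fderiv ℝ S 0).prod (.snd ℝ ℂ ℂ)) := by
    refine (injective_iff_map_eq_zero _).2 ?_
    rintro ⟨u, w⟩ huw
    simp only [ContinuousLinearMap.prod_apply, ContinuousLinearMap.coe_snd',
      Prod.mk_eq_zero] at huw
    obtain ⟨hu, rfl⟩ := huw
    rw [hSd u hu]
    rfl
  let A : (ℂ × ℂ) ≃L[ℝ] ℂ × ℂ :=
    (LinearEquiv.ofInjectiveEndo _ hinj).toContinuousLinearEquiv
  have hA : HasFDerivAt Φ (A : ℂ × ℂ →L[ℝ] ℂ × ℂ) 0 := by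
    convert hdΦ using 1
    ext p <;> rfl
  set I := hΦ.localInverse hA one_ne_zero with hI
  have hIc : ContDiffAt ℝ 1 I 0 := by
    have := hΦ.to_localInverse hA one_ne_zero
    rwa [hΦ0] at this
  have hleft : ∀ᶠ p in 𝓝 0, I (Φ p) = p :=
    (hΦ.hasStrictFDerivAt' hA one_ne_zero).eventually_left_inverse
  have hright : ∀ᶠ p in 𝓝 0, Φ (I p) = p := by
    have := (hΦ.hasStrictFDerivAt' hA one_ne_zero).eventually_right_inverse
    rwa [hΦ0] at this
  have hI0 : I 0 = 0 := by have := hleft.self_of_nhds; rwa [hΦ0] at this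
  have hIev : ∀ᶠ q in 𝓝 0, DifferentiableAt ℝ I q :=
    (hIc.eventually (by norm_num)).mono fun q hq => hq.differentiableAt one_ne_zero
  -- in the new coordinates the function is `k`
  have hk : ∀ᶠ q in 𝓝 0, f (I q) = a * ‖q.1‖ ^ 2 + h q.2 := by
    have hIt : Tendsto I (𝓝 0) (𝓝 0) := by
      have := hIc.continuousAt.tendsto; rwa [hI0] at this
    filter_upwards [hIt.eventually hfS, hright] with q h1 h2
    have h3 : S (I q) = q.1 := congrArg Prod.fst h2
    have h4 : (I q).2 = q.2 := by have := congrArg Prod.snd h2; exact this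
    rw [h1, h3, h4]
  have hμt : Tendsto (fun w => (μ w, w)) (𝓝 0) (𝓝 (0 : ℂ × ℂ)) := by
    have : ContinuousAt (fun w => (μ w, w)) (0 : ℂ) := hμ.prodMk continuousAt_id
    simpa [ContinuousAt, hμ0] using! this
  have hΦt : Tendsto Φ (𝓝 0) (𝓝 0) := by have := hΦ.continuousAt.tendsto; rwa [hΦ0] at this
  -- In the new coordinates `f` is `a ‖q.1‖² + h q.2`, so a critical point of `f` gives one of `h`.
  -- The critical curve passes over every small `w`, so `h` is locally constant.
  have hdh : ∀ᶠ w in 𝓝 0, HasFDerivAt h (0 : ℂ →L[ℝ] ℝ) w := by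
    filter_upwards [hcrit, hμt.eventually hleft,
      (hΦt.comp hμt).eventually hk.eventually_nhds, (hΦt.comp hμt).eventually hIev]
      with w h1 h2 h3 h4
    simp only [Function.comp_apply] at h3 h4
    have h5 : HasFDerivAt (fun q => f (I q)) (0 : ℂ × ℂ →L[ℝ] ℝ) (Φ (μ w, w)) := by
      have h6 : HasFDerivAt f (0 : ℂ × ℂ →L[ℝ] ℝ) (I (Φ (μ w, w))) := by rw [h2]; exact h1
      simpa using! h6.comp _ h4.hasFDerivAt
    have h6 : HasFDerivAt (fun q : ℂ × ℂ => a * ‖q.1‖ ^ 2 + h q.2) (0 : ℂ × ℂ →L[ℝ] ℝ)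
      (S (μ w, w), w) := h5.congr_of_eventuallyEq (by filter_upwards [h3] with q hq using hq.symm)
    have h7 : HasFDerivAt (fun y : ℂ => (S (μ w, w), y)) (.inr ℝ ℂ ℂ) w :=
      hasFDerivAt_prodMk_right _ w
    have h8 := (h6.comp w h7).sub_const (a * ‖S (μ w, w)‖ ^ 2)
    simpa [Function.comp_def] using! h8
  obtain ⟨r, hr, hball⟩ := Metric.eventually_nhds_iff_ball.1 hdh
  have hconst : ∀ᶠ w in 𝓝 0, h w = h 0 := by
    filter_upwards [Metric.ball_mem_nhds 0 hr] with w hw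
    exact Metric.isOpen_ball.is_const_of_fderiv_eq_zero (convex_ball _ _).isPreconnected
      (fun y hy => (hball y hy).differentiableAt.differentiableWithinAt)
      (fun y hy => (hball y hy).fderiv) hw (Metric.mem_ball_self hr)
  have hsnd : Tendsto (Prod.snd : ℂ × ℂ → ℂ) (𝓝 0) (𝓝 0) := continuous_snd.tendsto 0
  refine ⟨Φ, a, 0, h 0, hΦ, by rw [hdΦ.fderiv]; exact hinj, hΦ0, ?_⟩
  filter_upwards [hfS, hsnd.eventually hconst] with p h1 h2
  rw [h1, h2]
  simp [hΦdef]

end Splitting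

/-! ### Neighbourhoods with connected levels. -/

namespace Splitting

open Filter Topology

section Box

variable {X : Type*} [NormedAddCommGroup X] [NormedSpace ℝ X]

/-- Two points are joined by a `C¹` curve in `W` along which `ζ` is constant. -/
def JoinedBy (ζ : X → ℝ) (W : Set X) (y y' : X) : Prop :=
  ∃ c : ℝ → X, ContDiff ℝ 1 c ∧ c 0 = y ∧ c 1 = y' ∧ ∀ t, c t ∈ W ∧ ζ (c t) = ζ y

/-- The levels of `ζ` in the open set `W` are connected by `C¹` curves, and `ζ` is open onto its
image. -/
structure IsLevelBox (ζ : X → ℝ) (W : Set X) : Prop where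
  isOpen : IsOpen W
  preconnected : IsPreconnected W
  level : ∀ y ∈ W, ∀ y' ∈ W, ζ y = ζ y' → Relation.EqvGen (JoinedBy ζ W) y y'
  relOpen : ∀ y ∈ W, ∀ O ∈ 𝓝 y, ∃ η > 0, ∀ y' ∈ W, |ζ y' - ζ y| < η →
    ∃ p ∈ O, p ∈ W ∧ ζ p = ζ y'

/-- Reparametrization by a smooth step confines the whole real line to the part of the curve over
`[0, 1]`. -/
theorem JoinedBy.of_Icc {ζ : X → ℝ} {W : Set X} {c : ℝ → X} (hc : ContDiff ℝ 1 c)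
    (h : ∀ t ∈ Icc (0 : ℝ) 1, c t ∈ W ∧ ζ (c t) = ζ (c 0)) : JoinedBy ζ W (c 0) (c 1) := by
  refine ⟨fun t => c (Real.smoothTransition t), hc.comp Real.smoothTransition.contDiff, by simp,
    by simp, fun t => ?_⟩
  exact h _ ⟨Real.smoothTransition.nonneg t, Real.smoothTransition.le_one t⟩

/-- The image of a small ball is an interval. On each side of `ζ y` either it contains a one-sided
neighbourhood, or `ζ` takes no values on that side anywhere in `W`. -/
theorem relOpen_of_exists {ζ : X → ℝ} {W : Set X} (hW : IsOpen W) (hζ : ContinuousOn ζ W)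
    (hup : ∀ y ∈ W, ∀ O ∈ 𝓝 y, (∃ p ∈ O, ζ y < ζ p) ∨ ∀ x ∈ W, ζ x ≤ ζ y)
    (hdown : ∀ y ∈ W, ∀ O ∈ 𝓝 y, (∃ p ∈ O, ζ p < ζ y) ∨ ∀ x ∈ W, ζ y ≤ ζ x)
    (y : X) (hy : y ∈ W) (O : Set X) (hO : O ∈ 𝓝 y) :
    ∃ η > 0, ∀ y' ∈ W, |ζ y' - ζ y| < η → ∃ p ∈ O, p ∈ W ∧ ζ p = ζ y' := by
  obtain ⟨r, hr, hball⟩ := Metric.mem_nhds_iff.1 (inter_mem hO (hW.mem_nhds hy))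
  have hyb : y ∈ Metric.ball y r := Metric.mem_ball_self hr
  have hord := ((convex_ball y r).isPreconnected.image ζ
    (hζ.mono fun x hx => (hball hx).2)).ordConnected
  have key : ∀ p ∈ Metric.ball y r, ∀ p' ∈ Metric.ball y r, ∀ s, ζ p ≤ s → s ≤ ζ p' →
      ∃ x ∈ O, x ∈ W ∧ ζ x = s := by
    intro p hp p' hp' s h1 h2
    obtain ⟨x, hx, rfl⟩ := hord.out (mem_image_of_mem ζ hp) (mem_image_of_mem ζ hp') ⟨h1, h2⟩
    exact ⟨x, (hball hx).1, (hball hx).2, rfl⟩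
  have h1 : ∃ η > 0, ∀ y' ∈ W, ζ y' - ζ y < η → ζ y ≤ ζ y' →
      ∃ p ∈ O, p ∈ W ∧ ζ p = ζ y' := by
    obtain ⟨p, hp, hlt⟩ | hmax := hup y hy _ (Metric.ball_mem_nhds y hr)
    · exact ⟨ζ p - ζ y, sub_pos.2 hlt, fun y' _ h h' => key y hyb p hp _ h' (by linarith)⟩
    · exact ⟨1, one_pos, fun y' hy' _ h' => key y hyb y hyb _ h' (hmax y' hy')⟩
  have h2 : ∃ η > 0, ∀ y' ∈ W, ζ y - ζ y' < η → ζ y' ≤ ζ y →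
      ∃ p ∈ O, p ∈ W ∧ ζ p = ζ y' := by
    obtain ⟨p, hp, hlt⟩ | hmin := hdown y hy _ (Metric.ball_mem_nhds y hr)
    · exact ⟨ζ y - ζ p, sub_pos.2 hlt, fun y' _ h h' => key p hp y hyb _ (by linarith) h'⟩
    · exact ⟨1, one_pos, fun y' hy' _ h' => key y hyb y hyb _ (hmin y' hy') h'⟩
  obtain ⟨η₁, hη₁, H₁⟩ := h1
  obtain ⟨η₂, hη₂, H₂⟩ := h2
  refine ⟨min η₁ η₂, lt_min hη₁ hη₂, fun y' hy' h => ?_⟩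
  rw [abs_lt] at h
  obtain hle | hle := le_total (ζ y) (ζ y')
  · exact H₁ y' hy' (h.2.trans_le (min_le_left _ _)) hle
  · exact H₂ y' hy' (by linarith [h.1, min_le_right η₁ η₂]) hle

theorem isLevelBox_linear {l : X →L[ℝ] ℝ} {v : X} (hv : 0 < l v) (x : X) {r : ℝ} :
    IsLevelBox l (Metric.ball x r) where
  isOpen := Metric.isOpen_ball
  preconnected := (convex_ball x r).isPreconnected
  level := by
    intro y hy y' hy' h
    refine Relation.EqvGen.rel _ _ ?_
    have := JoinedBy.of_Icc (ζ := l) (W := Metric.ball x r) (c := fun t : ℝ => y + t • (y' - y))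
      (by fun_prop) fun t ht => ⟨?_, by simp [h]⟩
    · simpa using this
    · exact (convex_ball x r).add_smul_sub_mem hy hy' ht
  relOpen := by
    have hlim : ∀ (y w : X), ∀ O ∈ 𝓝 y, ∃ t : ℝ, 0 < t ∧ y + t • w ∈ O := by
      intro y w O hO
      have hc : Continuous fun t : ℝ => y + t • w := by fun_prop
      have ht : Tendsto (fun t : ℝ => y + t • w) (𝓝[>] 0) (𝓝 y) := by
        simpa using (hc.tendsto 0).mono_left nhdsWithin_le_nhds
      obtain ⟨t, h1, h2⟩ := ((ht.eventually hO).and self_mem_nhdsWithin).exists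
      exact ⟨t, h2, h1⟩
    refine relOpen_of_exists Metric.isOpen_ball l.continuous.continuousOn ?_ ?_
    · intro y _ O hO
      obtain ⟨t, ht, hO⟩ := hlim y v O hO
      exact Or.inl ⟨_, hO, by simpa using mul_pos ht hv⟩
    · intro y _ O hO
      obtain ⟨t, ht, hO⟩ := hlim y (-v) O hO
      exact Or.inl ⟨_, hO, by simpa using mul_pos ht hv⟩

/-- Boxes are transported by the local inverse of `Φ`. A `C¹` change of coordinates suffices because
the joining curves are only `C¹`. -/
theorem IsLevelBox.exists_of_contDiffAt {Y : Type*} [NormedAddCommGroup Y] [NormedSpace ℝ Y]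
    [CompleteSpace X] {Φ : X → Y} {x₀ : X} (hΦ : ContDiffAt ℝ 1 Φ x₀) {A : X ≃L[ℝ] Y}
    (hA : HasFDerivAt Φ (A : X →L[ℝ] Y) x₀) {ζ : X → ℝ} {q : Y → ℝ} {c : ℝ}
    (hζ : ∀ᶠ x in 𝓝 x₀, ζ x = q (Φ x) + c)
    (hq : ∀ N ∈ 𝓝 (Φ x₀), ∃ D ⊆ N, Φ x₀ ∈ D ∧ IsLevelBox q D) :
    ∀ O ∈ 𝓝 x₀, ∃ W ⊆ O, x₀ ∈ W ∧ IsLevelBox ζ W := by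
  intro O hO
  set e := hΦ.toOpenPartialHomeomorph Φ hA one_ne_zero
  have he : ∀ x, e x = Φ x := fun _ => rfl
  have hx₀ : x₀ ∈ e.source := hΦ.mem_toOpenPartialHomeomorph_source hA one_ne_zero
  have hy₀ : Φ x₀ ∈ e.target := hΦ.image_mem_toOpenPartialHomeomorph_target hA one_ne_zero
  have hsymm : e.symm (Φ x₀) = x₀ := e.left_inv hx₀
  have hec : ∀ᶠ y in 𝓝 (Φ x₀), ContDiffAt ℝ 1 e.symm y :=
    (hΦ.to_localInverse hA one_ne_zero).eventually (by norm_num)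
  have het : Tendsto e.symm (𝓝 (Φ x₀)) (𝓝 x₀) := by
    have := e.symm.continuousAt (x := Φ x₀) hy₀
    rwa [ContinuousAt, hsymm] at this
  obtain ⟨D, hDN, hD₀, hD⟩ := hq _ (inter_mem (e.open_target.mem_nhds hy₀)
    (inter_mem hec (het.eventually (inter_mem hO hζ))))
  have hDt : ∀ {d}, d ∈ D → d ∈ e.target := fun hd => (hDN hd).1
  have hζD : ∀ d ∈ D, ζ (e.symm d) = q d + c := by
    intro d hd
    have h1 : ζ (e.symm d) = q (Φ (e.symm d)) + c := (hDN hd).2.2.2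
    rwa [← he, e.right_inv (hDt hd)] at h1
  have hjoin : ∀ d d', JoinedBy q D d d' → JoinedBy ζ (e.symm '' D) (e.symm d) (e.symm d') := by
    rintro d d' ⟨γ, hγ, rfl, rfl, h⟩
    refine ⟨fun t => e.symm (γ t), contDiff_iff_contDiffAt.2 fun t =>
      ContDiffAt.comp t (hDN (h t).1).2.1 hγ.contDiffAt, rfl, rfl,
      fun t => ⟨mem_image_of_mem _ (h t).1, ?_⟩⟩
    rw [hζD _ (h t).1, hζD _ (h 0).1, (h t).2]
  refine ⟨e.symm '' D, ?_, ⟨Φ x₀, hD₀, hsymm⟩, ?_, ?_, ?_, ?_⟩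
  · rintro _ ⟨d, hd, rfl⟩
    exact (hDN hd).2.2.1
  · exact e.isOpen_image_symm_of_subset_target hD.isOpen fun d hd => hDt hd
  · exact hD.preconnected.image _ (e.continuousOn_symm.mono fun d hd => hDt hd)
  · rintro _ ⟨d, hd, rfl⟩ _ ⟨d', hd', rfl⟩ h
    rw [hζD d hd, hζD d' hd'] at h
    have := hD.level d hd d' hd' (by linarith)
    induction this with
    | rel x y hxy => exact .rel _ _ (hjoin _ _ hxy)
    | refl x => exact .refl _
    | symm x y _ ih => exact .symm _ _ (ih hd' hd h.symm)
    | trans x y z h1 _ ih1 ih2 =>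
      -- Intermediate points of a chain are not assumed to lie in `D` or on the level; every link
      -- forces both.
      have hxy : y ∈ D ∧ q y = q x := by
        clear ih1 ih2 h
        have aux : ∀ x y, Relation.EqvGen (JoinedBy q D) x y →
            (x ∈ D ↔ y ∈ D) ∧ q x = q y := by
          intro x y hxy
          induction hxy with
          | rel x y h =>
            obtain ⟨γ, -, rfl, rfl, h⟩ := h
            exact ⟨⟨fun _ => (h 1).1, fun _ => (h 0).1⟩, (h 1).2.symm⟩
          | refl x => exact ⟨Iff.rfl, rfl⟩
          | symm x y _ ih => exact ⟨ih.1.symm, ih.2.symm⟩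
          | trans x y z _ _ ih1 ih2 => exact ⟨ih1.1.trans ih2.1, ih1.2.trans ih2.2⟩
        obtain ⟨h3, h4⟩ := aux _ _ h1
        exact ⟨h3.1 hd, h4.symm⟩
      exact .trans _ (e.symm y) _ (ih1 hd hxy.1 (by rw [hxy.2])) (ih2 hxy.1 hd' (by rw [hxy.2, h]))
  · rintro _ ⟨d, hd, rfl⟩ O' hO'
    obtain ⟨η, hη, H⟩ := hD.relOpen d hd _ ((e.symm.continuousAt (x := d) (hDt hd)) hO')
    refine ⟨η, hη, ?_⟩
    rintro _ ⟨d', hd', rfl⟩ h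
    rw [hζD d hd, hζD d' hd', add_sub_add_right_eq_sub] at h
    obtain ⟨p, hpO, hpD, hpq⟩ := H d' hd' h
    exact ⟨e.symm p, hpO, mem_image_of_mem _ hpD, by rw [hζD p hpD, hζD d' hd', hpq]⟩

end Box

section Model

/-- Applied to two moduli with the same weights, this interpolates `a|u|² + b|w|²` between its end
values, so the form stays constant between points of one level. The weights `cos²` and `sin²` keep
the root differentiable when an end value is zero. -/
theorem exists_curve_sq {x₀ x₁ : ℝ} (h₀ : 0 ≤ x₀) (h₁ : 0 ≤ x₁) :
    ∃ X : ℝ → ℝ, ContDiff ℝ 1 X ∧ X 0 = x₀ ∧ X 1 = x₁ ∧ ∀ t,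
      X t ^ 2 = Real.cos (Real.pi / 2 * t) ^ 2 * x₀ ^ 2 +
        Real.sin (Real.pi / 2 * t) ^ 2 * x₁ ^ 2 := by
  have hs : ContDiff ℝ 1 fun t : ℝ => Real.sin (Real.pi / 2 * t) :=
    Real.contDiff_sin.comp (contDiff_const.mul contDiff_id)
  have hc : ContDiff ℝ 1 fun t : ℝ => Real.cos (Real.pi / 2 * t) :=
    Real.contDiff_cos.comp (contDiff_const.mul contDiff_id)
  obtain rfl | h₀' := h₀.eq_or_lt
  · exact ⟨fun t => Real.sin (Real.pi / 2 * t) * x₁, hs.mul contDiff_const, by simp, by simp,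
      fun t => by ring⟩
  obtain rfl | h₁' := h₁.eq_or_lt
  · exact ⟨fun t => Real.cos (Real.pi / 2 * t) * x₀, hc.mul contDiff_const, by simp, by simp,
      fun t => by ring⟩
  have hpos : ∀ t, 0 < Real.cos (Real.pi / 2 * t) ^ 2 * x₀ ^ 2 +
        Real.sin (Real.pi / 2 * t) ^ 2 * x₁ ^ 2 := by
    intro t
    have h1 := Real.sin_sq_add_cos_sq (Real.pi / 2 * t)
    have h2 : 0 < x₀ ^ 2 := by positivity
    have h3 : 0 < x₁ ^ 2 := by positivity
    obtain h4 | h4 := (sq_nonneg (Real.cos (Real.pi / 2 * t))).eq_or_lt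
    · rw [← h4] at h1 ⊢
      have : Real.sin (Real.pi / 2 * t) ^ 2 = 1 := by linarith
      rw [this]; linarith
    · have := mul_pos h4 h2
      have := mul_nonneg (sq_nonneg (Real.sin (Real.pi / 2 * t))) h3.le
      linarith
  refine ⟨fun t => √(Real.cos (Real.pi / 2 * t) ^ 2 * x₀ ^ 2 +
        Real.sin (Real.pi / 2 * t) ^ 2 * x₁ ^ 2),
    (((hc.pow 2).mul contDiff_const).add ((hs.pow 2).mul contDiff_const)).sqrt
      fun t => (hpos t).ne', by simp [h₀], by simp [h₁], fun t => Real.sq_sqrt (hpos t).le⟩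

/-- The form has no local maxima besides global ones: a positive coefficient allows an increase in
its variable, and a negative value of a form with no positive coefficient increases on shrinking
towards the origin. -/
theorem exists_larger (a b : ℝ) (y : ℂ × ℂ) (O : Set (ℂ × ℂ)) (hO : O ∈ 𝓝 y) :
    (∃ p ∈ O, a * ‖y.1‖ ^ 2 + b * ‖y.2‖ ^ 2 < a * ‖p.1‖ ^ 2 + b * ‖p.2‖ ^ 2) ∨
      ∀ x : ℂ × ℂ, a * ‖x.1‖ ^ 2 + b * ‖x.2‖ ^ 2 ≤ a * ‖y.1‖ ^ 2 + b * ‖y.2‖ ^ 2 := by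
  have hlim : ∀ w : ℂ × ℂ, ∃ t : ℝ, (0 < t ∧ t < 1) ∧ y + t • w ∈ O := by
    intro w
    have hc : Continuous fun t : ℝ => y + t • w := by fun_prop
    have ht : Tendsto (fun t : ℝ => y + t • w) (𝓝[>] 0) (𝓝 y) := by
      simpa using (hc.tendsto 0).mono_left nhdsWithin_le_nhds
    obtain ⟨t, h1, h2⟩ := ((ht.eventually hO).and (Ioo_mem_nhdsGT one_pos)).exists
    exact ⟨t, h2, h1⟩
  have hlarge : ∀ u : ℂ, ∃ d : ℂ, ∀ t : ℝ, 0 < t → ‖u‖ ^ 2 < ‖u + t • d‖ ^ 2 := by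
    intro u
    by_cases hu : u = 0
    · refine ⟨1, fun t ht => ?_⟩
      rw [hu, zero_add, norm_zero, norm_smul, Real.norm_eq_abs, abs_of_pos ht, norm_one, mul_one]
      nlinarith
    · refine ⟨u, fun t ht => ?_⟩
      have h1 : u + t • u = (1 + t) • u := by rw [add_smul, one_smul]
      rw [h1, norm_smul, Real.norm_eq_abs, abs_of_pos (by linarith), mul_pow]
      have h2 : 0 < ‖u‖ ^ 2 := by positivity
      exact lt_mul_of_one_lt_left h2 (by nlinarith)
  obtain ha | ha := lt_or_ge 0 a
  · obtain ⟨d, hd⟩ := hlarge y.1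
    obtain ⟨t, ⟨ht, -⟩, hO⟩ := hlim (d, 0)
    refine Or.inl ⟨_, hO, ?_⟩
    simpa using mul_lt_mul_of_pos_left (hd t ht) ha
  obtain hb | hb := lt_or_ge 0 b
  · obtain ⟨d, hd⟩ := hlarge y.2
    obtain ⟨t, ⟨ht, -⟩, hO⟩ := hlim (0, d)
    refine Or.inl ⟨_, hO, ?_⟩
    simpa using mul_lt_mul_of_pos_left (hd t ht) hb
  have hneg : ∀ x : ℂ × ℂ, a * ‖x.1‖ ^ 2 + b * ‖x.2‖ ^ 2 ≤ 0 := fun x =>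
    add_nonpos (mul_nonpos_of_nonpos_of_nonneg ha (by positivity))
      (mul_nonpos_of_nonpos_of_nonneg hb (by positivity))
  obtain h0 | h0 := (hneg y).eq_or_lt
  · right
    rw [h0]
    exact hneg
  · obtain ⟨t, ⟨ht, ht1⟩, hO⟩ := hlim (-y)
    refine Or.inl ⟨_, hO, ?_⟩
    have h1 : y + t • -y = (1 - t) • y := by rw [sub_smul, one_smul, smul_neg, sub_eq_add_neg]
    rw [h1, Prod.smul_fst, Prod.smul_snd, norm_smul, norm_smul, Real.norm_eq_abs,
      abs_of_pos (by linarith)]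
    have h2 : (1 - t) ^ 2 < 1 := by nlinarith
    have h3 := mul_lt_mul_of_neg_right h2 h0
    linarith

/-- Both variables are rotated to nonnegative reals and their squared moduli are interpolated. As
the variables are complex, this works for all signs of `a` and `b` and on the singular level. The
ball is a polydisc, so the two moduli are bounded separately. -/
theorem isLevelBox_quadratic (a b : ℝ) (r : ℝ) :
    IsLevelBox (fun p : ℂ × ℂ => a * ‖p.1‖ ^ 2 + b * ‖p.2‖ ^ 2) (Metric.ball 0 r) where
  isOpen := Metric.isOpen_ball
  preconnected := (convex_ball _ r).isPreconnected
  level := by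
    have hmem : ∀ p : ℂ × ℂ, p ∈ Metric.ball (0 : ℂ × ℂ) r ↔ ‖p.1‖ < r ∧ ‖p.2‖ < r := by
      intro p; simp [Prod.norm_def]
    set q : ℂ × ℂ → ℝ := fun p : ℂ × ℂ => a * ‖p.1‖ ^ 2 + b * ‖p.2‖ ^ 2
    have hrot : ∀ u : ℂ, ∃ c : ℝ → ℂ, ContDiff ℝ 1 c ∧ c 0 = (‖u‖ : ℂ) ∧ c 1 = u ∧
        ∀ t, ‖c t‖ = ‖u‖ := by
      intro u
      refine ⟨fun t => ‖u‖ * Complex.exp (t * (Complex.arg u * Complex.I)), ?_, by simp, ?_, ?_⟩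
      · have : ContDiff ℝ 1 fun t : ℝ => (t : ℂ) := Complex.ofRealCLM.contDiff
        exact contDiff_const.mul (this.mul contDiff_const).cexp
      · simp [Complex.norm_mul_exp_arg_mul_I]
      · intro t
        rw [norm_mul, ← mul_assoc, ← Complex.ofReal_mul, Complex.norm_exp_ofReal_mul_I]
        simp
    have hreal : ∀ p ∈ Metric.ball (0 : ℂ × ℂ) r,
        Relation.EqvGen (JoinedBy q (Metric.ball 0 r)) ((‖p.1‖ : ℂ), (‖p.2‖ : ℂ)) p := by
      rintro ⟨u, v⟩ hp
      rw [hmem] at hp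
      obtain ⟨c, hc, hc0, hc1, hcn⟩ := hrot u
      obtain ⟨d, hd, hd0, hd1, hdn⟩ := hrot v
      refine .rel _ _ ⟨fun t => (c t, d t), hc.prodMk hd, by simp [hc0, hd0], by simp [hc1, hd1],
        fun t => ⟨?_, ?_⟩⟩
      · rw [hmem]; simpa [hcn, hdn] using hp
      · simp [q, hcn, hdn]
    intro y hy y' hy' h
    refine .trans _ _ _ (.symm _ _ (hreal y hy)) (.trans _ _ _ (.rel _ _ ?_) (hreal y' hy'))
    obtain ⟨X, hX, hX0, hX1, hXs⟩ := exists_curve_sq (norm_nonneg y.1) (norm_nonneg y'.1)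
    obtain ⟨Y, hY, hY0, hY1, hYs⟩ := exists_curve_sq (norm_nonneg y.2) (norm_nonneg y'.2)
    rw [hmem] at hy hy'
    have hlt : ∀ (t s₀ s₁ z : ℝ), 0 ≤ s₀ → 0 ≤ s₁ → s₀ < r → s₁ < r →
        z ^ 2 = Real.cos (Real.pi / 2 * t) ^ 2 * s₀ ^ 2 +
          Real.sin (Real.pi / 2 * t) ^ 2 * s₁ ^ 2 → |z| < r := by
      intro t s₀ s₁ z h0 h1 h0r h1r hz
      have hsc := Real.sin_sq_add_cos_sq (Real.pi / 2 * t)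
      have e0 : s₀ ^ 2 < r ^ 2 := by nlinarith
      have e1 : s₁ ^ 2 < r ^ 2 := by nlinarith
      refine abs_lt_of_sq_lt_sq ?_ (h0.trans h0r.le)
      rw [hz]
      obtain h4 | h4 := (sq_nonneg (Real.cos (Real.pi / 2 * t))).eq_or_lt
      · rw [← h4] at hsc ⊢
        have : Real.sin (Real.pi / 2 * t) ^ 2 = 1 := by linarith
        rw [this]; linarith
      · have e2 := mul_lt_mul_of_pos_left e0 h4
        have e3 := mul_le_mul_of_nonneg_left e1.le (sq_nonneg (Real.sin (Real.pi / 2 * t)))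
        have e4 : Real.cos (Real.pi / 2 * t) ^ 2 * r ^ 2 +
          Real.sin (Real.pi / 2 * t) ^ 2 * r ^ 2 = r ^ 2 := by
          rw [← add_mul, add_comm, hsc, one_mul]
        linarith
    have hofR : ContDiff ℝ 1 fun t : ℝ => (t : ℂ) := Complex.ofRealCLM.contDiff
    refine ⟨fun t => ((X t : ℂ), (Y t : ℂ)), (hofR.comp hX).prodMk (hofR.comp hY),
      by simp [hX0, hY0], by simp [hX1, hY1], fun t => ⟨?_, ?_⟩⟩
    · rw [hmem]
      simp only [Complex.norm_real, Real.norm_eq_abs]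
      exact ⟨hlt t _ _ _ (norm_nonneg _) (norm_nonneg _) hy.1 hy'.1 (hXs t),
        hlt t _ _ _ (norm_nonneg _) (norm_nonneg _) hy.2 hy'.2 (hYs t)⟩
    · have hsc := Real.sin_sq_add_cos_sq (Real.pi / 2 * t)
      simp only [q, Complex.norm_real, Real.norm_eq_abs, sq_abs, hXs, hYs] at h ⊢
      linear_combination (Real.sin (Real.pi / 2 * t) ^ 2) * (-h) +
        (a * ‖y.1‖ ^ 2 + b * ‖y.2‖ ^ 2) * hsc
  relOpen := by
    refine relOpen_of_exists Metric.isOpen_ball (by fun_prop) ?_ ?_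
    · intro y _ O hO
      exact (exists_larger a b y O hO).imp id fun h x _ => h x
    · intro y _ O hO
      refine (exists_larger (-a) (-b) y O hO).imp ?_ fun h x _ => ?_
      · rintro ⟨p, hp, h⟩
        exact ⟨p, hp, by linarith⟩
      · have := h x
        linarith

theorem HasNormalForm.exists_isLevelBox {f : ℂ × ℂ → ℝ} (hf : HasNormalForm f) :
    ∀ O ∈ 𝓝 (0 : ℂ × ℂ), ∃ W ⊆ O, 0 ∈ W ∧ IsLevelBox f W := by
  obtain ⟨Φ, a, b, c, hΦ, hinj, hΦ0, hfΦ⟩ := hf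
  let A : (ℂ × ℂ) ≃L[ℝ] ℂ × ℂ := (LinearEquiv.ofInjectiveEndo _ hinj).toContinuousLinearEquiv
  have hA : HasFDerivAt Φ (A : ℂ × ℂ →L[ℝ] ℂ × ℂ) 0 := by
    have h : (A : ℂ × ℂ →L[ℝ] ℂ × ℂ) = fderiv ℝ Φ 0 := ContinuousLinearMap.ext fun p => rfl
    rw [h]
    exact (hΦ.differentiableAt one_ne_zero).hasFDerivAt
  refine IsLevelBox.exists_of_contDiffAt hΦ hA
    (q := fun p : ℂ × ℂ => a * ‖p.1‖ ^ 2 + b * ‖p.2‖ ^ 2) (c := c) hfΦ ?_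
  rw [hΦ0]
  intro N hN
  obtain ⟨r, hr, hrN⟩ := Metric.mem_nhds_iff.1 hN
  exact ⟨_, hrN, Metric.mem_ball_self hr, isLevelBox_quadratic a b r⟩

/-- Level boxes around a regular point. -/
theorem exists_isLevelBox_of_regular {X : Type*} [NormedAddCommGroup X] [NormedSpace ℝ X]
    [CompleteSpace X] {ζ : X → ℝ} {x₀ : X} (hζ : ContDiffAt ℝ 1 ζ x₀) (h : fderiv ℝ ζ x₀ ≠ 0) :
    ∀ O ∈ 𝓝 x₀, ∃ W ⊆ O, x₀ ∈ W ∧ IsLevelBox ζ W := by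
  set l := fderiv ℝ ζ x₀
  have hl : HasFDerivAt ζ l x₀ := (hζ.differentiableAt one_ne_zero).hasFDerivAt
  obtain ⟨w, hw⟩ : ∃ w, l w ≠ 0 := by
    by_contra! hcon
    exact h (ContinuousLinearMap.ext hcon)
  set v := (l w)⁻¹ • w
  have hv : l v = 1 := by simp [v, hw]
  -- As `l v = 1`, applying `l` to this map gives `ζ`, and its derivative at `x₀` is the identity.
  -- It therefore straightens `ζ` to the linear function `l`.
  have hΦ : ContDiffAt ℝ 1 (fun x => x + (ζ x - l x) • v) x₀ :=
    contDiffAt_id.add ((hζ.sub l.contDiff.contDiffAt).smul contDiffAt_const)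
  have hA : HasFDerivAt (fun x => x + (ζ x - l x) • v)
      ((ContinuousLinearEquiv.refl ℝ X : X ≃L[ℝ] X) : X →L[ℝ] X) x₀ := by
    have := (hasFDerivAt_id x₀).add ((hl.sub l.hasFDerivAt).smul_const v)
    convert! this using 1
    ext x
    simp
  refine IsLevelBox.exists_of_contDiffAt hΦ hA (q := l) (c := 0)
    (Eventually.of_forall fun x => by simp [hv]) ?_
  intro N hN
  obtain ⟨r, hr, hrN⟩ := Metric.mem_nhds_iff.1 hN
  exact ⟨_, hrN, Metric.mem_ball_self hr, isLevelBox_linear (by rw [hv]; exact one_pos) _⟩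

/-- Level boxes of a locally constant function. -/
theorem exists_isLevelBox_of_const {X : Type*} [NormedAddCommGroup X] [NormedSpace ℝ X]
    {ζ : X → ℝ} {x₀ : X} {c : ℝ} (h : ∀ᶠ x in 𝓝 x₀, ζ x = c) :
    ∀ O ∈ 𝓝 x₀, ∃ W ⊆ O, x₀ ∈ W ∧ IsLevelBox ζ W := by
  intro O hO
  obtain ⟨r, hr, hrN⟩ := Metric.mem_nhds_iff.1 (inter_mem hO h)
  have hc : ∀ y ∈ Metric.ball x₀ r, ζ y = c := fun y hy => (hrN hy).2
  refine ⟨_, fun y hy => (hrN hy).1, Metric.mem_ball_self hr, Metric.isOpen_ball,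
    (convex_ball _ _).isPreconnected, fun y hy y' hy' _ => ?_, fun y hy O hO => ?_⟩
  · refine Relation.EqvGen.rel _ _ ?_
    have := JoinedBy.of_Icc (ζ := ζ) (W := Metric.ball x₀ r) (c := fun t : ℝ => y + t • (y' - y))
      (by fun_prop) fun t ht => ?_
    · simpa using this
    · have h1 := (convex_ball x₀ r).add_smul_sub_mem hy hy' ht
      refine ⟨h1, ?_⟩
      rw [hc _ h1]
      simp [hc y hy]
  · exact ⟨1, one_pos, fun y' hy' _ => ⟨y, mem_of_mem_nhds hO, hy, by rw [hc y hy, hc y' hy']⟩⟩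

end Model

end Splitting

/-! ### Killing fields of a Kähler metric in a holomorphic chart. -/

namespace KillingField

set_option maxSynthPendingDepth 3

open Filter Topology

variable {E : Type*} [NormedAddCommGroup E] [NormedSpace ℂ E]

/-- Multiplication by `i` as a real linear map. -/
noncomputable def mulI (E : Type*) [NormedAddCommGroup E] [NormedSpace ℂ E] : E →L[ℝ] E :=
  (Complex.I • ContinuousLinearMap.id ℂ E).restrictScalars ℝ

@[simp] theorem mulI_apply (v : E) : mulI E v = Complex.I • v := rfl

/-- A Kähler metric `g` on an open set of a complex vector space, and a holomorphic Killing
field `V`. -/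
structure IsKahlerKilling (U : Set E) (g : E → E →L[ℝ] E →L[ℝ] ℝ) (V : E → E) : Prop where
  isOpen : IsOpen U
  contDiffAt_metric : ∀ y ∈ U, ContDiffAt ℝ ∞ g y
  contDiffAt_field : ∀ y ∈ U, ContDiffAt ℝ ∞ V y
  symm : ∀ y ∈ U, ∀ u v, g y u v = g y v u
  pos : ∀ y ∈ U, ∀ u, u ≠ 0 → 0 < g y u u
  hermitian : ∀ y ∈ U, ∀ u v, g y (Complex.I • u) (Complex.I • v) = g y u v
  killing : ∀ y ∈ U, ∀ u v, fderiv ℝ g y (V y) u v + g y (fderiv ℝ V y u) v +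
    g y u (fderiv ℝ V y v) = 0
  holomorphic : ∀ y ∈ U, ∀ u, fderiv ℝ V y (Complex.I • u) = Complex.I • fderiv ℝ V y u
  closed : ∀ y ∈ U, ∀ u v w, fderiv ℝ g y u (Complex.I • v) w + fderiv ℝ g y v (Complex.I • w) u +
    fderiv ℝ g y w (Complex.I • u) v = 0

theorem one_add_one_le_infty : (1 + 1 : WithTop ℕ∞) ≤ ∞ := by
  have : ((2 : ℕ∞) : WithTop ℕ∞) ≤ ((⊤ : ℕ∞) : WithTop ℕ∞) := WithTop.coe_le_coe.2 le_top
  simpa [one_add_one_eq_two] using! this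

theorem exists_eventually_fderiv_le {X Y : Type*} [NormedAddCommGroup X] [NormedSpace ℝ X]
    [NormedAddCommGroup Y] [NormedSpace ℝ Y] {f : X → Y} {x : X} (hf : ContDiffAt ℝ ∞ f x) :
    ∃ C > 0, ∀ᶠ y in 𝓝 x, (∀ a, ‖fderiv ℝ f y a‖ ≤ C * ‖a‖) ∧
      ∀ a b, ‖fderiv ℝ (fderiv ℝ f) y a b‖ ≤ C * ‖a‖ * ‖b‖ := by
  have h1 : ContDiffAt ℝ 1 (fderiv ℝ f) x := hf.fderiv_right (m := 1) one_add_one_le_infty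
  have hc2 : ContinuousAt (fderiv ℝ (fderiv ℝ f)) x :=
    (h1.fderiv_right (m := 0) (by simp)).continuousAt
  refine ⟨‖fderiv ℝ f x‖ + ‖fderiv ℝ (fderiv ℝ f) x‖ + 1, by positivity, ?_⟩
  filter_upwards [h1.continuousAt.norm.eventually_lt_const (lt_add_one _),
    hc2.norm.eventually_lt_const (lt_add_one _)] with y e1 e2
  have n1 := norm_nonneg (fderiv ℝ f x)
  have n2 := norm_nonneg (fderiv ℝ (fderiv ℝ f) x)
  refine ⟨fun a => (fderiv ℝ f y).le_of_opNorm_le (by linarith) a, fun a b => ?_⟩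
  refine (fderiv ℝ (fderiv ℝ f) y a).le_of_opNorm_le ?_ b
  exact (fderiv ℝ (fderiv ℝ f) y).le_of_opNorm_le (by linarith) a

namespace IsKahlerKilling

variable {U : Set E} {g : E → E →L[ℝ] E →L[ℝ] ℝ} {V : E → E} (h : IsKahlerKilling U g V)
include h

theorem hasFDerivAt_metric {y : E} (hy : y ∈ U) : HasFDerivAt g (fderiv ℝ g y) y :=
  ((h.contDiffAt_metric y hy).differentiableAt (by simp)).hasFDerivAt

theorem hasFDerivAt_field {y : E} (hy : y ∈ U) : HasFDerivAt V (fderiv ℝ V y) y :=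
  ((h.contDiffAt_field y hy).differentiableAt (by simp)).hasFDerivAt

theorem hasFDerivAt_fderiv_metric {y : E} (hy : y ∈ U) :
    HasFDerivAt (fderiv ℝ g) (fderiv ℝ (fderiv ℝ g) y) y :=
  (((h.contDiffAt_metric y hy).fderiv_right (m := 1) one_add_one_le_infty).differentiableAt
    (by simp)).hasFDerivAt

theorem hasFDerivAt_fderiv_field {y : E} (hy : y ∈ U) :
    HasFDerivAt (fderiv ℝ V) (fderiv ℝ (fderiv ℝ V) y) y :=
  (((h.contDiffAt_field y hy).fderiv_right (m := 1) one_add_one_le_infty).differentiableAt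
    (by simp)).hasFDerivAt

theorem apply_I_left {y : E} (hy : y ∈ U) (u v : E) :
    g y (Complex.I • u) v = - g y u (Complex.I • v) := by
  rw [← h.hermitian y hy u, smul_smul, Complex.I_mul_I, neg_one_smul, map_neg, neg_neg]

theorem apply_I_swap {y : E} (hy : y ∈ U) (u v : E) :
    g y (Complex.I • u) v = - g y (Complex.I • v) u := by
  rw [h.apply_I_left hy, h.symm y hy]

theorem fderiv_apply_I_swap {y : E} (hy : y ∈ U) (z u v : E) :
    fderiv ℝ g y z (Complex.I • u) v = - fderiv ℝ g y z (Complex.I • v) u := by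
  have hg := h.hasFDerivAt_metric hy
  have h1 := (hg.clm_apply (hasFDerivAt_const (Complex.I • u) y)).clm_apply (hasFDerivAt_const v y)
  have h2 := ((hg.clm_apply (hasFDerivAt_const (Complex.I • v) y)).clm_apply
    (hasFDerivAt_const u y)).neg
  have h3 := h1.unique (h2.congr_of_eventuallyEq ?_)
  · simpa using! congrArg (fun l => l z) h3
  · filter_upwards [h.isOpen.mem_nhds hy] with x hx
    exact h.apply_I_swap hx u v

/-- The derivative of the Killing equation. -/
theorem fderiv_killing {y : E} (hy : y ∈ U) (z u v : E) :
    g y (fderiv ℝ (fderiv ℝ V) y z u) v + g y u (fderiv ℝ (fderiv ℝ V) y z v) =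
      -(fderiv ℝ (fderiv ℝ g) y z (V y) u v + fderiv ℝ g y (fderiv ℝ V y z) u v +
        fderiv ℝ g y z (fderiv ℝ V y u) v + fderiv ℝ g y z u (fderiv ℝ V y v)) := by
  have hg := h.hasFDerivAt_metric hy
  have hV := h.hasFDerivAt_field hy
  have hg' := h.hasFDerivAt_fderiv_metric hy
  have hV' := h.hasFDerivAt_fderiv_field hy
  have hu := hasFDerivAt_const (𝕜 := ℝ) u y
  have hv := hasFDerivAt_const (𝕜 := ℝ) v y
  have h1 := (((hg'.clm_apply hV).clm_apply hu).clm_apply hv).add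
    ((hg.clm_apply (hV'.clm_apply hu)).clm_apply hv)
  have h2 := h1.add ((hg.clm_apply hu).clm_apply (hV'.clm_apply hv))
  have h3 := h2.unique ((hasFDerivAt_const (0 : ℝ) y).congr_of_eventuallyEq ?_)
  · have := congrArg (fun l => l z) h3
    simp at this
    linarith
  · filter_upwards [h.isOpen.mem_nhds hy] with x hx
    exact h.killing x hx u v

theorem exists_le_apply_self [FiniteDimensional ℂ E] {x₀ : E} (hx₀ : x₀ ∈ U) :
    ∃ m > 0, ∀ᶠ y in 𝓝 x₀, ∀ u, m * ‖u‖ ^ 2 ≤ g y u u := by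
  have : FiniteDimensional ℝ E := FiniteDimensional.complexToReal E
  have : ProperSpace E := FiniteDimensional.proper ℝ E
  have hcont : Continuous fun u => g x₀ u u := (g x₀).continuous.clm_apply continuous_id
  obtain ⟨m, hm, hle⟩ := (isCompact_sphere (0 : E) 1).exists_forall_le' hcont.continuousOn
    (a := 0) fun u hu => h.pos x₀ hx₀ u fun h0 => by simp [h0] at hu
  refine ⟨m / 2, half_pos hm, ?_⟩
  have hcg : ContinuousAt g x₀ := (h.contDiffAt_metric x₀ hx₀).continuousAt
  filter_upwards [hcg.eventually (Metric.ball_mem_nhds _ (half_pos hm))] with y hy u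
  rw [dist_eq_norm] at hy
  have h1 : |(g y - g x₀) u u| ≤ m / 2 * ‖u‖ * ‖u‖ := ((g y - g x₀) u).le_of_opNorm_le
    ((g y - g x₀).le_of_opNorm_le hy.le u) u
  have h2 : m * ‖u‖ ^ 2 ≤ g x₀ u u := by
    obtain rfl | hu := eq_or_ne u 0
    · simp
    · have hn : 0 < ‖u‖ := norm_pos_iff.2 hu
      have := hle ((‖u‖)⁻¹ • u) (by simp [norm_smul, hn.ne'])
      simp only [map_smul, smul_apply, smul_eq_mul] at this
      rw [← mul_assoc, ← mul_inv, ← sq, inv_mul_eq_div, le_div_iff₀ (by positivity)] at this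
      exact this
  have h3 := (abs_le.1 h1).1
  simp only [sub_apply] at h3
  nlinarith

/-- The Killing equation is of finite type. As in the Koszul formula, a cyclic combination of its
derivative solves for the second derivative of `V` in terms of `V` and its first derivative. -/
theorem exists_norm_fderiv_fderiv_le [FiniteDimensional ℂ E] {x₀ : E} (hx₀ : x₀ ∈ U) :
    ∃ C, ∀ᶠ y in 𝓝 x₀, ∀ z u,
      ‖fderiv ℝ (fderiv ℝ V) y z u‖ ≤ C * (‖V y‖ + ‖fderiv ℝ V y‖) * ‖z‖ * ‖u‖ := by
  have : FiniteDimensional ℝ E := FiniteDimensional.complexToReal E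
  obtain ⟨m, hm, hm'⟩ := h.exists_le_apply_self hx₀
  obtain ⟨C, hC, hC'⟩ := exists_eventually_fderiv_le (h.contDiffAt_metric x₀ hx₀)
  refine ⟨9 * C / m, ?_⟩
  filter_upwards [hm', hC', h.isOpen.mem_nhds hx₀] with y hmy ⟨hC1, hC2⟩ hy z u
  set S := ‖V y‖ + ‖fderiv ℝ V y‖
  have hS1 : ‖V y‖ ≤ S := le_add_of_nonneg_right (norm_nonneg _)
  have hS2 : ‖fderiv ℝ V y‖ ≤ S := le_add_of_nonneg_left (norm_nonneg _)
  have hS : 0 ≤ S := (norm_nonneg _).trans hS1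
  have hdV : ∀ a, ‖fderiv ℝ V y a‖ ≤ S * ‖a‖ := fun a => (fderiv ℝ V y).le_of_opNorm_le hS2 a
  have hdg : ∀ a b c, |fderiv ℝ g y a b c| ≤ C * ‖a‖ * ‖b‖ * ‖c‖ := fun a b c =>
    ((fderiv ℝ g y a b).le_opNorm c).trans (by
      gcongr
      exact (fderiv ℝ g y a).le_of_opNorm_le (hC1 a) b)
  have hddg : ∀ a b c d, |fderiv ℝ (fderiv ℝ g) y a b c d| ≤ C * ‖a‖ * ‖b‖ * ‖c‖ * ‖d‖ :=
    fun a b c d => ((fderiv ℝ (fderiv ℝ g) y a b c).le_opNorm d).trans (by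
      gcongr
      exact (fderiv ℝ (fderiv ℝ g) y a b).le_of_opNorm_le (hC2 a b) c)
  have hR : ∀ a b c, |g y (fderiv ℝ (fderiv ℝ V) y a b) c + g y b (fderiv ℝ (fderiv ℝ V) y a c)|
      ≤ 4 * C * S * ‖a‖ * ‖b‖ * ‖c‖ := by
    intro a b c
    rw [h.fderiv_killing hy, abs_neg]
    have h1 : |fderiv ℝ (fderiv ℝ g) y a (V y) b c| ≤ C * ‖a‖ * S * ‖b‖ * ‖c‖ :=
      (hddg _ _ _ _).trans (by gcongr)
    have h2 : |fderiv ℝ g y (fderiv ℝ V y a) b c| ≤ C * (S * ‖a‖) * ‖b‖ * ‖c‖ :=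
      (hdg _ _ _).trans (by gcongr; exact hdV a)
    have h3 : |fderiv ℝ g y a (fderiv ℝ V y b) c| ≤ C * ‖a‖ * (S * ‖b‖) * ‖c‖ :=
      (hdg _ _ _).trans (by gcongr; exact hdV b)
    have h4 : |fderiv ℝ g y a b (fderiv ℝ V y c)| ≤ C * ‖a‖ * ‖b‖ * (S * ‖c‖) :=
      (hdg _ _ _).trans (by gcongr; exact hdV c)
    refine (abs_add_le _ _).trans ?_
    have h5 := abs_add_three (fderiv ℝ (fderiv ℝ g) y a (V y) b c)
      (fderiv ℝ g y (fderiv ℝ V y a) b c) (fderiv ℝ g y a (fderiv ℝ V y b) c)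
    linarith
  have hsymm : ∀ a b, fderiv ℝ (fderiv ℝ V) y a b = fderiv ℝ (fderiv ℝ V) y b a := fun a b =>
    ((h.contDiffAt_field y hy).isSymmSndFDerivAt
      (by simpa [one_add_one_eq_two] using one_add_one_le_infty)).eq a b
  set w := fderiv ℝ (fderiv ℝ V) y z u
  -- By symmetry of the second derivative, all terms but `2 g(w, w)` cancel in the sum of two cyclic
  -- permutations minus the third.
  have key : 2 * g y w w ≤ 3 * (4 * C * S * ‖z‖ * ‖u‖ * ‖w‖) := by
    have h1 := (abs_le.1 (hR z u w)).2
    have h2 := (abs_le.1 (hR u w z)).2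
    have h3 := (abs_le.1 (hR w z u)).1
    rw [hsymm u w, hsymm u z] at h2
    rw [hsymm w z] at h3
    have e1 := h.symm y hy u (fderiv ℝ (fderiv ℝ V) y z w)
    have e2 := h.symm y hy w (fderiv ℝ (fderiv ℝ V) y z u)
    have e3 := h.symm y hy z (fderiv ℝ (fderiv ℝ V) y w u)
    simp only [w] at *
    linarith
  have h5 := hmy w
  obtain h0 | h0 := (norm_nonneg w).eq_or_lt
  · rw [← h0]; positivity
  · have h6 : m * ‖w‖ * ‖w‖ ≤ 9 * C * S * ‖z‖ * ‖u‖ * ‖w‖ := by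
      have : 0 ≤ C * S * ‖z‖ * ‖u‖ * ‖w‖ := by positivity
      nlinarith
    have h7 := le_of_mul_le_mul_right h6 h0
    rw [div_mul_eq_mul_div, div_mul_eq_mul_div, div_mul_eq_mul_div, le_div_iff₀ hm]
    linarith

/-- A Killing field that vanishes to first order at a point vanishes near this point. -/
theorem eventually_eq_zero [FiniteDimensional ℂ E] {x₀ : E} (hx₀ : x₀ ∈ U) (h0 : V x₀ = 0)
    (h1 : fderiv ℝ V x₀ = 0) : ∀ᶠ y in 𝓝 x₀, V y = 0 := by
  obtain ⟨C, hC⟩ := h.exists_norm_fderiv_fderiv_le hx₀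
  obtain ⟨r, hr, hball⟩ := Metric.mem_nhds_iff.1 (inter_mem hC (h.isOpen.mem_nhds hx₀))
  filter_upwards [Metric.ball_mem_nhds x₀ hr] with y hy
  set c : ℝ → E := fun t => x₀ + t • (y - x₀)
  have hcb : ∀ t ∈ Icc (0 : ℝ) 1, c t ∈ Metric.ball x₀ r := fun t ht =>
    (convex_ball x₀ r).add_smul_sub_mem (Metric.mem_ball_self hr) hy ht
  have hc : ∀ t, HasDerivAt c (y - x₀) t := fun t => by
    have := ((hasDerivAt_id t).smul_const (y - x₀)).const_add x₀
    rwa [one_smul] at this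
  -- Along a ray the pair of `V` and its derivative satisfies a linear differential inequality, so
  -- Grönwall's lemma applies. In the constant `1 + 2|C|`, the `2` bounds the sum of two norms by
  -- twice the norm of the pair.
  set F : ℝ → E × (E →L[ℝ] E) := fun t => (V (c t), fderiv ℝ V (c t))
  set F' : ℝ → E × (E →L[ℝ] E) := fun t =>
    (fderiv ℝ V (c t) (y - x₀), fderiv ℝ (fderiv ℝ V) (c t) (y - x₀))
  have hF : ∀ t ∈ Icc (0 : ℝ) 1, HasDerivAt F (F' t) t := fun t ht =>
    ((h.hasFDerivAt_field (hball (hcb t ht)).2).comp_hasDerivAt t (hc t)).prodMk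
      ((h.hasFDerivAt_fderiv_field (hball (hcb t ht)).2).comp_hasDerivAt t (hc t))
  have hbound : ∀ t ∈ Ico (0 : ℝ) 1, ‖F' t‖ ≤ (1 + 2 * |C|) * ‖y - x₀‖ * ‖F t‖ + 0 := by
    intro t ht
    have hF1 : ‖V (c t)‖ ≤ ‖F t‖ := le_max_left _ _
    have hF2 : ‖fderiv ℝ V (c t)‖ ≤ ‖F t‖ := le_max_right _ _
    have hF0 := norm_nonneg (F t)
    have hn := norm_nonneg (y - x₀)
    rw [add_zero]
    refine max_le ?_ ?_
    · refine ((fderiv ℝ V (c t)).le_of_opNorm_le hF2 _).trans ?_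
      have : 0 ≤ |C| * (‖F t‖ * ‖y - x₀‖) := by positivity
      nlinarith
    · refine ContinuousLinearMap.opNorm_le_bound _ (by positivity) fun u => ?_
      refine ((hball (hcb t ⟨ht.1, ht.2.le⟩)).1 (y - x₀) u).trans ?_
      have : C * (‖V (c t)‖ + ‖fderiv ℝ V (c t)‖) ≤ (1 + 2 * |C|) * ‖F t‖ := by
        have h3 : C * (‖V (c t)‖ + ‖fderiv ℝ V (c t)‖) ≤
            |C| * (‖V (c t)‖ + ‖fderiv ℝ V (c t)‖) := by gcongr; exact le_abs_self C
        have h4 : |C| * (‖V (c t)‖ + ‖fderiv ℝ V (c t)‖) ≤ |C| * (‖F t‖ + ‖F t‖) := by gcongr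
        nlinarith
      have h5 : C * (‖V (c t)‖ + ‖fderiv ℝ V (c t)‖) * ‖y - x₀‖ * ‖u‖ ≤
        (1 + 2 * |C|) * ‖F t‖ * ‖y - x₀‖ * ‖u‖ := by gcongr
      linarith
  have := norm_le_gronwallBound_of_norm_deriv_right_le (δ := 0)
    (fun t ht => (hF t ht).continuousAt.continuousWithinAt)
    (fun t ht => (hF t ⟨ht.1, ht.2.le⟩).hasDerivWithinAt) (by simp [F, c, h0, h1]) hbound 1
    (by simp)
  rw [gronwallBound_ε0_δ0, norm_le_zero_iff] at this
  have h2 := congrArg Prod.fst this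
  simpa [F, c] using h2

/-- The 1-form `v ↦ g(iv, V)`. -/
noncomputable def oneForm (g : E → E →L[ℝ] E →L[ℝ] ℝ) (V : E → E) (y : E) : E →L[ℝ] ℝ :=
  (g y (V y)).comp (mulI E)

omit h in
@[simp] theorem oneForm_apply (y v : E) : oneForm g V y v = g y (V y) (Complex.I • v) := rfl

theorem contDiffAt_oneForm {y : E} (hy : y ∈ U) : ContDiffAt ℝ ∞ (oneForm g V) y :=
  ((h.contDiffAt_metric y hy).clm_apply (h.contDiffAt_field y hy)).clm_comp contDiffAt_const

theorem fderiv_oneForm {y : E} (hy : y ∈ U) (u v : E) :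
    fderiv ℝ (oneForm g V) y u v =
      fderiv ℝ g y u (V y) (Complex.I • v) + g y (fderiv ℝ V y u) (Complex.I • v) := by
  have h1 := (((h.hasFDerivAt_metric hy).clm_apply (h.hasFDerivAt_field hy)).clm_comp
    (hasFDerivAt_const (mulI E) y))
  have h2 : HasFDerivAt (oneForm g V) _ y := h1
  rw [h2.fderiv]
  simp [add_comm]

theorem fderiv_symm {y : E} (hy : y ∈ U) (z u v : E) :
    fderiv ℝ g y z u v = fderiv ℝ g y z v u := by
  have hg := h.hasFDerivAt_metric hy
  have h1 := (hg.clm_apply (hasFDerivAt_const u y)).clm_apply (hasFDerivAt_const v y)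
  have h2 := (hg.clm_apply (hasFDerivAt_const v y)).clm_apply (hasFDerivAt_const u y)
  have h3 := h1.unique (h2.congr_of_eventuallyEq ?_)
  · simpa using! congrArg (fun l => l z) h3
  · filter_upwards [h.isOpen.mem_nhds hy] with x hx
    exact h.symm x hx u v

/-- Cartan's formula in coordinates: the contraction of the closed Kähler form with a field
preserving it is closed. -/
theorem fderiv_oneForm_symm {y : E} (hy : y ∈ U) (u v : E) :
    fderiv ℝ (oneForm g V) y u v = fderiv ℝ (oneForm g V) y v u := by
  rw [h.fderiv_oneForm hy, h.fderiv_oneForm hy]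
  have h1 := h.closed y hy u v (V y)
  have h2 := h.killing y hy (Complex.I • u) v
  rw [h.holomorphic y hy] at h2
  have e1 := h.fderiv_symm hy u (V y) (Complex.I • v)
  have e2 := h.fderiv_symm hy v (V y) (Complex.I • u)
  have e3 := h.fderiv_apply_I_swap hy v (V y) u
  have e4 := h.apply_I_left hy (fderiv ℝ V y u) v
  have e5 := h.symm y hy (Complex.I • u) (fderiv ℝ V y v)
  linarith

theorem exists_primitive {x₀ : E} (hx₀ : x₀ ∈ U) :
    ∃ ζ : E → ℝ, ∀ᶠ y in 𝓝 x₀, HasFDerivAt ζ (oneForm g V y) y := by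
  obtain ⟨r, hr, hball⟩ := Metric.mem_nhds_iff.1 (h.isOpen.mem_nhds hx₀)
  have hd : DifferentiableOn ℝ (oneForm g V) (Metric.ball x₀ r) := fun y hy =>
    ((h.contDiffAt_oneForm (hball hy)).differentiableAt (by simp)).differentiableWithinAt
  obtain ⟨ζ, hζ⟩ := (convex_ball x₀ r).exists_forall_hasFDerivAt_of_fderiv_symmetric
    Metric.isOpen_ball hd
    (fun y hy u v => h.fderiv_oneForm_symm (hball hy) u v)
  exact ⟨ζ, by filter_upwards [Metric.ball_mem_nhds x₀ hr] with y hy using hζ y hy⟩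

end IsKahlerKilling

end KillingField

/-! ### Zeros of the field and level boxes around them. -/

namespace KillingField

set_option maxSynthPendingDepth 3

open Filter Topology Asymptotics

section Generic

theorem smul_eq_re_add_im {X : Type*} [AddCommGroup X] [Module ℂ X] (c : ℂ) (u : X) :
    c • u = c.re • u + c.im • Complex.I • u := by
  conv_lhs => rw [← Complex.re_add_im c]
  rw [add_smul, mul_smul]
  rfl

/-- Cauchy-Riemann makes the real derivative complex linear. Restriction of scalars is isometric, so
continuity of the complex derivative can be tested on the real one. -/
theorem contDiffAt_complex {X Y : Type*} [NormedAddCommGroup X] [NormedSpace ℂ X]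
    [NormedAddCommGroup Y] [NormedSpace ℂ Y] {f : X → Y} {x : X} (hf : ContDiffAt ℝ 1 f x)
    (hI : ∀ᶠ y in 𝓝 x, ∀ u, fderiv ℝ f y (Complex.I • u) = Complex.I • fderiv ℝ f y u) :
    ContDiffAt ℂ 1 f x := by
  obtain ⟨f', s, hs, hc, hf'⟩ := contDiffAt_one_iff.1 hf
  have hd : ∀ y ∈ s ∩ {y | ∀ u, fderiv ℝ f y (Complex.I • u) = Complex.I • fderiv ℝ f y u},
      DifferentiableAt ℂ f y := by
    rintro y ⟨hy, hyI⟩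
    have hyI : ∀ u, f' y (Complex.I • u) = Complex.I • f' y u := by
      simpa [(hf' y hy).fderiv] using hyI
    let l : X →L[ℂ] Y :=
      { toFun := f' y
        map_add' := map_add _
        map_smul' := fun c u => by
          simp only [RingHom.id_apply]
          rw [smul_eq_re_add_im, map_add, map_smul, map_smul, hyI, ← smul_eq_re_add_im]
        cont := (f' y).cont }
    have h1 : HasFDerivAt f (f' y) y := hf' y hy
    have h2 : l.restrictScalars ℝ = f' y := rfl
    have h3 : HasFDerivAt f l y := hasFDerivAt_of_restrictScalars ℝ h1 h2
    exact h3.differentiableAt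
  refine contDiffAt_one_iff.2 ⟨fderiv ℂ f, _, inter_mem hs hI, ?_,
    fun y hy => (hd y hy).hasFDerivAt⟩
  refine (ContinuousLinearMap.restrictScalarsIsometry ℂ X Y ℝ
    ℝ).isometry.isEmbedding.isInducing.continuousOn_iff.2 ?_
  refine (hc.mono inter_subset_left).congr fun y hy => ?_
  have := (hd y hy).fderiv_restrictScalars ℝ
  rw [(hf' y hy.1).fderiv] at this
  exact this.symm

/-- The remainder has derivative `α (x₀ + k) - D k`, which is `o(‖k‖)`; the mean value inequality on
the ball of radius `‖y‖` gives one more factor `‖y‖`. -/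
theorem isLittleO_taylor {X : Type*} [NormedAddCommGroup X] [NormedSpace ℝ X] {f : X → ℝ}
    {α : X → X →L[ℝ] ℝ} {x₀ : X} (hf : ∀ᶠ y in 𝓝 x₀, HasFDerivAt f (α y) y)
    {D : X →L[ℝ] X →L[ℝ] ℝ} (hα : HasFDerivAt α D x₀) (hα0 : α x₀ = 0)
    (hD : ∀ u v, D u v = D v u) :
    (fun y => f (x₀ + y) - f x₀ - D y y / 2) =o[𝓝 0] fun y => ‖y‖ ^ 2 := by
  rw [isLittleO_iff]
  intro c hc
  have h1 := (isLittleO_iff.1 hα.isLittleO hc)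
  obtain ⟨δ, hδ, hball⟩ := Metric.mem_nhds_iff.1 (inter_mem h1 hf)
  filter_upwards [Metric.ball_mem_nhds 0 hδ] with y hy
  rw [mem_ball_zero_iff] at hy
  have hmem : ∀ k ∈ Metric.closedBall (0 : X) ‖y‖, x₀ + k ∈ Metric.ball x₀ δ := by
    intro k hk
    rw [mem_closedBall_zero_iff] at hk
    simpa using hk.trans_lt hy
  have hder : ∀ k ∈ Metric.closedBall (0 : X) ‖y‖,
      HasFDerivWithinAt (fun k => f (x₀ + k) - D k k / 2) (α (x₀ + k) - D k)
        (Metric.closedBall (0 : X) ‖y‖) k := by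
    intro k hk
    have e1 : HasFDerivAt (fun k => f (x₀ + k)) (α (x₀ + k)) k := by
      have e0 : HasFDerivAt f (α (x₀ + k)) (x₀ + k) := (hball (hmem k hk)).2
      exact e0.comp k ((hasFDerivAt_id k).const_add x₀)
    have e2 := (D.hasFDerivAt (x := k)).clm_apply (hasFDerivAt_id k)
    have e3 := (e1.sub (e2.mul_const (1 / 2))).hasFDerivWithinAt
      (s := Metric.closedBall (0 : X) ‖y‖)
    convert! e3 using 1
    · ext z
      simp [div_eq_mul_inv]
    · ext z
      simp [hD z k]
      ring
  have hbound : ∀ k ∈ Metric.closedBall (0 : X) ‖y‖, ‖α (x₀ + k) - D k‖ ≤ c * ‖y‖ := by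
    intro k hk
    have := (hball (hmem k hk)).1
    simp only [mem_ofPred_eq, hα0, sub_zero, add_sub_cancel_left] at this
    exact this.trans (by gcongr; simpa using hk)
  have := (convex_closedBall (0 : X) ‖y‖).norm_image_sub_le_of_norm_hasFDerivWithin_le hder hbound
    (x := 0) (y := y) (by simp) (by simp)
  simp only [map_zero, zero_div, sub_zero, add_zero] at this
  rw [norm_pow, norm_norm, sq, ← mul_assoc]
  convert! this using 2
  ring

theorem continuousAt_comp_ofReal_mul {Y : Type*} [TopologicalSpace Y] {F : ℂ → Y} (ξ : ℂ)
    (hF : ContinuousAt F 0) : ContinuousAt (fun ρ : ℝ => F (ρ * ξ)) 0 := by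
  refine ContinuousAt.comp (g := F) ?_ (by fun_prop)
  simpa using hF

end Generic

variable {E : Type*} [NormedAddCommGroup E] [NormedSpace ℂ E]

/-- Diagonalization of a Hermitian form in complex dimension two. -/
theorem exists_adapted_basis (hE : Module.finrank ℂ E = 2) (B : E →L[ℝ] E →L[ℝ] ℝ)
    (hsymm : ∀ u v, B u v = B v u) (hI : ∀ u v, B (Complex.I • u) (Complex.I • v) = B u v)
    {e₁ : E} (he₁ : B e₁ e₁ ≠ 0) :
    ∃ (L : (ℂ × ℂ) ≃L[ℂ] E) (a b : ℝ), a ≠ 0 ∧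
      (∀ p, B (L p) (L p) = a * ‖p.1‖ ^ 2 + b * ‖p.2‖ ^ 2) ∧
      (b = 0 → ∀ v, B (L (0, 1)) v = 0) := by
  have hfin : FiniteDimensional ℂ E := FiniteDimensional.of_finrank_pos (by omega)
  have hII : ∀ v : E, Complex.I • Complex.I • v = -v := fun v => by
    rw [smul_smul, Complex.I_mul_I, neg_one_smul]
  have hskew : ∀ u v, B (Complex.I • u) v = - B u (Complex.I • v) := fun u v => by
    rw [← hI u, hII, map_neg, neg_neg]
  have hself : ∀ v, B v (Complex.I • v) = 0 := fun v => by
    have := hskew v v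
    rw [hsymm] at this
    linarith
  have hsq : ∀ (c : ℂ) v, B (c • v) (c • v) = B v v * ‖c‖ ^ 2 := by
    intro c v
    have h1 := hself v
    have h2 := hskew v v
    rw [smul_eq_re_add_im c v, Complex.sq_norm, Complex.normSq_apply]
    simp only [map_add, map_smul, add_apply, smul_apply, smul_eq_mul, hI, h1, h2]
    ring
  -- The pairing with `e₁` under the Hermitian form with real part `B`. A nonzero vector of its
  -- kernel is the second basis vector.
  let ℓ : E →ₗ[ℂ] ℂ :=
    { toFun := fun v => ⟨B v e₁, -B (Complex.I • v) e₁⟩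
      map_add' := fun u v => by
        apply Complex.ext <;> simp [smul_add]
        ring
      map_smul' := fun c v => by
        have h1 : Complex.I • c • v = c.re • Complex.I • v - c.im • v := by
          rw [smul_comm, smul_eq_re_add_im c (Complex.I • v), hII, smul_neg, sub_eq_add_neg]
        rw [h1, smul_eq_re_add_im c v]
        apply Complex.ext
        · simp
        · simp
          ring }
  have hℓ : ∀ v, ℓ v = ⟨B v e₁, -B (Complex.I • v) e₁⟩ := fun _ => rfl
  obtain ⟨e₂, he₂, he₂0⟩ := Submodule.exists_mem_ne_zero_of_ne_bot
    (ℓ.ker_ne_bot_of_finrank_lt (by simp [hE]))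
  rw [LinearMap.mem_ker] at he₂
  have hℓ₁ : ℓ e₁ ≠ 0 := fun h0 => he₁ (by simpa [hℓ] using congrArg Complex.re h0)
  have horth : ∀ c v : ℂ, B (c • e₂) (v • e₁) = 0 := by
    intro c v
    have h1 : ℓ (c • e₂) = 0 := by rw [map_smul, he₂, smul_zero]
    have h2 : B (c • e₂) e₁ = 0 := by simpa [hℓ] using congrArg Complex.re h1
    have h3 : B (Complex.I • c • e₂) e₁ = 0 := by simpa [hℓ] using congrArg Complex.im h1
    rw [hskew] at h3
    rw [smul_eq_re_add_im v, map_add, map_smul (B (c • e₂)) v.re, map_smul (B (c • e₂)) v.im, h2,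
      neg_eq_zero.1 h3]
    simp
  let T : ℂ × ℂ →ₗ[ℂ] E :=
    (LinearMap.toSpanSingleton ℂ E e₁).coprod (LinearMap.toSpanSingleton ℂ E e₂)
  have hT : ∀ p, T p = p.1 • e₁ + p.2 • e₂ := fun p => rfl
  have hinj : Function.Injective T := by
    refine (injective_iff_map_eq_zero T).2 fun p hp => ?_
    rw [hT] at hp
    have h1 : p.1 = 0 := by
      have := congrArg ℓ hp
      rw [map_add, map_smul ℓ, map_smul ℓ, he₂, smul_zero, add_zero, map_zero] at this
      exact (smul_eq_zero.1 this).resolve_right hℓ₁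
    rw [h1, zero_smul, zero_add, smul_eq_zero] at hp
    exact Prod.ext h1 (hp.resolve_right he₂0)
  let L := (LinearEquiv.ofInjectiveOfFinrankEq T hinj (by simp [hE])).toContinuousLinearEquiv
  have hL : ∀ p, L p = p.1 • e₁ + p.2 • e₂ := fun p => rfl
  refine ⟨L, B e₁ e₁, B e₂ e₂, he₁, fun p => ?_, fun hb v => ?_⟩
  · have h1 := horth p.2 p.1
    have h2 := hsymm (p.1 • e₁) (p.2 • e₂)
    rw [hL]
    simp only [map_add, add_apply, hsq, h1, h2]
    ring
  · obtain ⟨p, rfl⟩ := L.surjective v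
    have h1 := horth 1 p.1
    have h2 := hself e₂
    rw [hL, hL]
    simp only [one_smul, zero_smul, zero_add, map_add] at h1 ⊢
    rw [h1, smul_eq_re_add_im p.2 e₂]
    simp [hb, h2]

namespace IsKahlerKilling

variable {U : Set E} {g : E → E →L[ℝ] E →L[ℝ] ℝ} {V : E → E} (h : IsKahlerKilling U g V)
include h

theorem contDiffAt_complex_field {y : E} (hy : y ∈ U) : ContDiffAt ℂ 1 V y :=
  contDiffAt_complex ((h.contDiffAt_field y hy).of_le (by simp)) (by
    filter_upwards [h.isOpen.mem_nhds hy] with x hx using h.holomorphic x hx)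

theorem fderiv_real_eq {y : E} (hy : y ∈ U) (v : E) : fderiv ℝ V y v = fderiv ℂ V y v := by
  rw [((h.contDiffAt_complex_field hy).differentiableAt one_ne_zero).fderiv_restrictScalars ℝ]
  rfl

/-- If a Killing field vanishes at `x₀` and its derivative has rank one, then the field vanishes
along a complex curve. -/
theorem exists_curve_of_zeros {x₀ : E} (hx₀ : x₀ ∈ U) (h0 : V x₀ = 0) (L : (ℂ × ℂ) ≃L[ℂ] E)
    (h1 : (L.symm (fderiv ℝ V x₀ (L (1, 0)))).1 ≠ 0) (h2 : fderiv ℝ V x₀ (L (0, 1)) = 0) :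
    ∃ μ : ℂ → ℂ, ContinuousAt μ 0 ∧ μ 0 = 0 ∧ ∀ᶠ w in 𝓝 0, V (x₀ + L (μ w, w)) = 0 := by
  set e₂ := L (0, 1) with he₂
  have hVd : HasFDerivAt V (fderiv ℂ V x₀) x₀ :=
    ((h.contDiffAt_complex_field hx₀).differentiableAt one_ne_zero).hasFDerivAt
  rw [h.fderiv_real_eq hx₀] at h1 h2
  set A := fderiv ℂ V x₀
  set W : ℂ × ℂ → ℂ × ℂ := fun p => L.symm (V (x₀ + L p)) with hW
  have hLp : ContDiff ℂ 1 fun p => x₀ + L p := contDiff_const.add L.contDiff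
  have hx0 : x₀ + L 0 = x₀ := by simp
  have hWc : ContDiffAt ℂ 1 W 0 := L.symm.contDiff.contDiffAt.comp _
    (ContDiffAt.comp (0 : ℂ × ℂ) (by rw [hx0]; exact h.contDiffAt_complex_field hx₀)
      hLp.contDiffAt)
  have hWd : HasFDerivAt W ((L.symm : E →L[ℂ] ℂ × ℂ).comp (A.comp (L : ℂ × ℂ →L[ℂ] E))) 0 := by
    have e1 : HasFDerivAt (fun p => x₀ + L p) (L : ℂ × ℂ →L[ℂ] E) 0 := L.hasFDerivAt.const_add x₀
    have e2 : HasFDerivAt V A (x₀ + L 0) := by rwa [hx0]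
    exact L.symm.hasFDerivAt.comp (0 : ℂ × ℂ) (e2.comp (0 : ℂ × ℂ) e1)
  -- The first component of `V` is made to vanish along a holomorphic graph. There `V = f e₂` with
  -- `f` holomorphic, and the Killing equation must rule out a nonzero `f`.
  obtain ⟨μ, hμ, hμ0, hμW⟩ := Splitting.exists_implicit one_ne_zero (g := fun p => (W p).1)
    (contDiffAt_fst.comp _ hWc) (by simp [hW, h0]) (by
      have : HasFDerivAt (fun p => (W p).1) _ 0 := hWd.fst
      rw [this.fderiv]
      simpa using h1)
  refine ⟨μ, hμ.continuousAt, hμ0, ?_⟩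
  set f : ℂ → ℂ := fun w => (W (μ w, w)).2 with hf
  have hpair : ContDiffAt ℂ 1 (fun w => (μ w, w)) 0 := hμ.prodMk contDiffAt_id
  have hfc : ContDiffAt ℂ 1 f 0 := (ContDiffAt.comp (g := W)
    (f := fun w => (μ w, w)) 0 (by rw [hμ0]; exact hWc) hpair).snd
  have hfa : AnalyticAt ℂ f 0 := Complex.analyticAt_iff_eventually_differentiableAt.2
    ((hfc.eventually (by simp)).mono fun w hw => hw.differentiableAt one_ne_zero)
  set σ : ℂ → E := fun w => x₀ + L (μ w, w) with hσ
  have hσ0 : σ 0 = x₀ := by simp [hσ, hμ0]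
  have hVσ : ∀ᶠ w in 𝓝 0, V (σ w) = f w • e₂ := by
    filter_upwards [hμW] with w hw
    have e1 : W (μ w, w) = f w • (0, 1) := Prod.ext (by simpa using hw) (by simp [hf])
    have e2 := congrArg L e1
    simpa only [hW, L.apply_symm_apply, map_smul] using e2
  suffices ∀ᶠ w in 𝓝 0, f w = 0 by
    filter_upwards [this, hVσ] with w hw hw'
    rw [hσ] at hw'
    rw [hw', hw, zero_smul]
  by_contra hne
  set X : ℂ → E := fun w => L (deriv μ w, 1) with hX
  have hσd : ∀ᶠ w in 𝓝 0, HasDerivAt σ (X w) w := by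
    filter_upwards [hμ.eventually (by simp)] with w hw
    have e1 := (hw.differentiableAt one_ne_zero).hasDerivAt.prodMk (hasDerivAt_id w)
    exact (L.hasFDerivAt.comp_hasDerivAt w e1).const_add x₀
  have hσc : ContinuousAt σ 0 := hσd.self_of_nhds.continuousAt
  have hσU : ∀ᶠ w in 𝓝 0, σ w ∈ U := hσc.eventually (by
    rw [hσ0]; exact h.isOpen.mem_nhds hx₀)
  have hdV : ∀ᶠ w in 𝓝 0, fderiv ℝ V (σ w) (X w) = deriv f w • e₂ := by
    filter_upwards [hσd, hVσ.eventually_nhds, hσU, hfa.eventually_analyticAt] with w h1 h2 h3 h4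
    rw [h.fderiv_real_eq h3]
    have e1 := ((h.contDiffAt_complex_field h3).differentiableAt
      one_ne_zero).hasFDerivAt.comp_hasDerivAt w h1
    have e2 := h4.differentiableAt.hasDerivAt.smul_const e₂
    exact e1.unique (e2.congr_of_eventuallyEq h2)
  have hkill : ∀ᶠ w in 𝓝 0, fderiv ℝ g (σ w) (f w • e₂) (X w) (X w) +
      2 * g (σ w) (deriv f w • e₂) (X w) = 0 := by
    filter_upwards [hdV, hVσ, hσU] with w h1 h2 h3
    have e1 := h.killing _ h3 (X w) (X w)
    have e2 := h.symm _ h3 (X w) (fderiv ℝ V (σ w) (X w))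
    rw [h1, h2] at e1
    rw [h1] at e2
    linarith
  have he₂0 : e₂ ≠ 0 := by simp [he₂]
  -- At `w = 0` the relation `hdV` reads `μ'(0) A(L(1, 0)) = f'(0) e₂`, and `A(L(1, 0))` has a
  -- nonzero first component.
  have hdμ : deriv μ 0 = 0 ∧ deriv f 0 = 0 := by
    have e1 := hdV.self_of_nhds
    rw [hσ0, h.fderiv_real_eq hx₀] at e1
    have e3 : X 0 = deriv μ 0 • L (1, 0) + e₂ := by
      rw [he₂, ← map_smul, ← map_add]; simp [hX]
    rw [e3, map_add, map_smul, h2, add_zero] at e1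
    have e4 := congrArg (fun v => (L.symm v).1) e1
    simp only [he₂, map_smul, L.symm_apply_apply, Prod.smul_fst, smul_eq_mul,
      mul_zero, mul_eq_zero] at e4
    have e5 : deriv μ 0 = 0 := e4.resolve_right h1
    rw [e5, zero_smul] at e1
    exact ⟨e5, (smul_eq_zero.1 e1.symm).resolve_right he₂0⟩
  -- If `f` were not zero near the origin, it would be `w ^ k φ` with `φ 0 ≠ 0`, and `k ≥ 2` because
  -- `f` and `f'` vanish at zero.
  obtain ⟨k, φ, hφ, hφ0, hfφ⟩ := hfa.exists_eventuallyEq_pow_smul_nonzero_iff.2 hne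
  simp only [sub_zero, smul_eq_mul] at hfφ
  have hf' : ∀ᶠ w in 𝓝 0, deriv f w = k * w ^ (k - 1) * φ w + w ^ k * deriv φ w := by
    filter_upwards [hfφ.eventually_nhds, hφ.eventually_analyticAt] with w e1 e2
    have e3 := (hasDerivAt_pow k w).mul e2.differentiableAt.hasDerivAt
    exact (e3.congr_of_eventuallyEq e1).deriv
  have hf0 : f 0 = 0 := by
    have : ((0 : ℂ), (0 : ℂ)) = 0 := rfl
    simp [hf, hμ0, hW, h0, this]
  obtain ⟨n, rfl⟩ : ∃ n, k = n + 2 := by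
    match k, hfφ, hf' with
    | 0, e1, _ =>
      have e2 := e1.self_of_nhds
      simp only [hf0, pow_zero, one_mul] at e2
      exact absurd e2.symm hφ0
    | 1, _, e1 =>
      have e2 := e1.self_of_nhds
      simp [hdμ.2] at e2
      exact absurd e2.symm hφ0
    | n + 2, _, _ => exact ⟨n, rfl⟩
  -- The direction `ξ` makes the leading coefficient `ξ ^ (k - 1) φ 0` of the derivative, up to the
  -- factor `k`, equal to the positive real `‖φ 0‖`.
  obtain ⟨ξ, hξ⟩ := IsAlgClosed.exists_pow_nat_eq ((‖φ 0‖ : ℂ) / φ 0) n.succ_pos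
  have hlim : Tendsto (fun ρ : ℝ => (ρ : ℂ) * ξ) (𝓝 0) (𝓝 0) := by
    have : Continuous fun ρ : ℝ => (ρ : ℂ) * ξ := by fun_prop
    simpa using this.tendsto 0
  have hXc : ContinuousAt X 0 := by
    have e1 : ContinuousAt (deriv μ) 0 := by
      have : ContinuousAt (fun w => fderiv ℂ μ w 1) 0 :=
        (hμ.fderiv_right (m := 0) (by simp)).continuousAt.clm_apply continuousAt_const
      exact this
    exact L.continuous.continuousAt.comp (e1.prodMk continuousAt_const)
  have hgc : ContinuousAt (fun w => g (σ w)) 0 :=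
    ContinuousAt.comp (g := g) (by rw [hσ0]; exact (h.contDiffAt_metric x₀ hx₀).continuousAt) hσc
  have hg'c : ContinuousAt (fun w => fderiv ℝ g (σ w)) 0 :=
    ContinuousAt.comp (g := fderiv ℝ g) (by
      rw [hσ0]
      exact ((h.contDiffAt_metric x₀ hx₀).fderiv_right (m := 0) (by simp)).continuousAt) hσc
  -- The Killing equation along the ray, divided by `ρ ^ (k - 1)`. The metric derivative term has
  -- one more power of `ρ`, so the limit would give `2 k ‖φ 0‖ g(e₂, e₂) = 0`.
  set F : ℝ → ℝ := fun ρ =>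
    fderiv ℝ g (σ (ρ * ξ)) (((ρ : ℂ) * ξ ^ (n + 2) * φ (ρ * ξ)) • e₂) (X (ρ * ξ)) (X (ρ * ξ)) +
    2 * g (σ (ρ * ξ)) (((n + 2 : ℂ) * ξ ^ (n + 1) * φ (ρ * ξ) +
      ρ * ξ ^ (n + 2) * deriv φ (ρ * ξ)) • e₂) (X (ρ * ξ)) with hF
  have hρ : ContinuousAt (fun ρ : ℝ => (ρ : ℂ)) 0 := by fun_prop
  have hFc : ContinuousAt F 0 := by
    have e1 := continuousAt_comp_ofReal_mul ξ hφ.continuousAt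
    have e2 := continuousAt_comp_ofReal_mul ξ hφ.deriv.continuousAt
    refine ContinuousAt.add ?_ (continuousAt_const.mul ?_)
    · exact (((continuousAt_comp_ofReal_mul ξ hg'c).clm_apply
        (((hρ.mul continuousAt_const).mul e1).smul continuousAt_const)).clm_apply (continuousAt_comp_ofReal_mul ξ hXc)).clm_apply
        (continuousAt_comp_ofReal_mul ξ hXc)
    · exact ((continuousAt_comp_ofReal_mul ξ hgc).clm_apply (((continuousAt_const.mul e1).add
        ((hρ.mul continuousAt_const).mul e2)).smul continuousAt_const)).clm_apply
          (continuousAt_comp_ofReal_mul ξ hXc)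
  have hFz : ∀ᶠ ρ in 𝓝[≠] (0 : ℝ), F ρ = 0 := by
    have e1 := hlim.eventually (hkill.and (hfφ.and hf'))
    filter_upwards [nhdsWithin_le_nhds e1, self_mem_nhdsWithin] with ρ hρ hρ0
    obtain ⟨e1, e2, e3⟩ := hρ
    rw [e3, e2] at e1
    have hρ0 : ρ ^ (n + 1) ≠ 0 := pow_ne_zero _ hρ0
    have e4 : ((ρ : ℂ) * ξ) ^ (n + 2) * φ (ρ * ξ) =
        ((ρ ^ (n + 1) : ℝ) : ℂ) * ((ρ : ℂ) * ξ ^ (n + 2) * φ (ρ * ξ)) := by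
      push_cast; ring
    have e5 : ((n + 2 : ℕ) : ℂ) * ((ρ : ℂ) * ξ) ^ (n + 2 - 1) * φ (ρ * ξ) +
        ((ρ : ℂ) * ξ) ^ (n + 2) * deriv φ (ρ * ξ) =
        ((ρ ^ (n + 1) : ℝ) : ℂ) * ((n + 2 : ℂ) * ξ ^ (n + 1) * φ (ρ * ξ) +
          ρ * ξ ^ (n + 2) * deriv φ (ρ * ξ)) := by
      rw [show n + 2 - 1 = n + 1 from rfl]
      push_cast; ring
    have e7 : ∀ (r : ℝ) (c : ℂ), ((r : ℂ) * c) • e₂ = r • c • e₂ := fun r c => by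
      rw [mul_smul, Complex.coe_smul]
    rw [e4, e5, e7, e7, map_smul (fderiv ℝ g _) (ρ ^ (n + 1)),
      map_smul (g _) (ρ ^ (n + 1))] at e1
    have e6 : ρ ^ (n + 1) * F ρ = 0 := by
      rw [← e1]
      simp only [hF, smul_apply, smul_eq_mul]
      ring
    exact (mul_eq_zero.1 e6).resolve_left hρ0
  have hF0 : F 0 = 0 := tendsto_nhds_unique (hFc.mono_left nhdsWithin_le_nhds)
    (tendsto_const_nhds.congr' (hFz.mono fun ρ hρ => hρ.symm))
  have hX0 : X 0 = e₂ := by simp [hX, hdμ.1, he₂]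
  have e1 : ((n + 2 : ℂ) * ξ ^ (n + 1) * φ 0) = ((((n : ℝ) + 2) * ‖φ 0‖ : ℝ) : ℂ) := by
    rw [hξ, mul_assoc, div_mul_cancel₀ _ hφ0]
    push_cast; ring
  simp only [hF, Complex.ofReal_zero, zero_mul, zero_smul, map_zero, zero_apply, zero_add,
    add_zero, hσ0, hX0, e1, Complex.coe_smul, map_smul, smul_apply, smul_eq_mul] at hF0
  have e2 := h.pos x₀ hx₀ e₂ he₂0
  have e3 : 0 < ((n : ℝ) + 2) * ‖φ 0‖ := by positivity
  have e4 := mul_pos e3 e2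
  linarith

/-- Four cases: a regular point, a first order zero where `V` vanishes nearby, a nondegenerate
Hessian (Morse), and a Hessian with a complex kernel line, along which zeros of `V` form a critical
curve (Morse-Bott). -/
theorem exists_isLevelBox (hE : Module.finrank ℂ E = 2) {ζ : E → ℝ} {x₀ : E} (hx₀ : x₀ ∈ U)
    (hζ : ∀ᶠ y in 𝓝 x₀, HasFDerivAt ζ (oneForm g V y) y) :
    ∀ O ∈ 𝓝 x₀, ∃ W ⊆ O, x₀ ∈ W ∧ Splitting.IsLevelBox ζ W := by
  have hfin : FiniteDimensional ℂ E := FiniteDimensional.of_finrank_pos (by omega)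
  have hcomplete : CompleteSpace E := FiniteDimensional.complete ℂ E
  have hζc : ∀ n : ℕ, ContDiffAt ℝ (n + 1 : ℕ) ζ x₀ := fun n => by
    rw [Nat.cast_add, Nat.cast_one, contDiffAt_succ_iff_hasFDerivAt]
    exact ⟨oneForm g V, ⟨_, hζ, fun y hy => hy⟩,
      (h.contDiffAt_oneForm hx₀).of_le (by exact_mod_cast le_top)⟩
  have hII : ∀ v : E, Complex.I • Complex.I • v = -v := fun v => by
    rw [smul_smul, Complex.I_mul_I, neg_one_smul]
  by_cases h0 : V x₀ = 0
  swap
  · refine Splitting.exists_isLevelBox_of_regular (by simpa using! hζc 0) ?_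
    rw [hζ.self_of_nhds.fderiv]
    intro hzero
    have e1 := congrArg (fun l => l (Complex.I • V x₀)) hzero
    simp only [oneForm_apply, hII, map_neg, zero_apply, neg_eq_zero] at e1
    exact (h.pos x₀ hx₀ _ h0).ne' e1
  set A := fderiv ℝ V x₀ with hA
  set B := fderiv ℝ (oneForm g V) x₀ with hB
  have hBapply : ∀ u v, B u v = g x₀ (A u) (Complex.I • v) := fun u v => by
    rw [hB, h.fderiv_oneForm hx₀, h0]; simp [hA]
  have hBsymm : ∀ u v, B u v = B v u := h.fderiv_oneForm_symm hx₀
  have hskew : ∀ u v, g x₀ (A u) v = - g x₀ u (A v) := fun u v => by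
    have := h.killing x₀ hx₀ u v
    simp only [h0, map_zero, zero_apply] at this
    linarith
  have hBI : ∀ u v, B (Complex.I • u) (Complex.I • v) = B u v := fun u v => by
    rw [hBapply, hBapply, hA, h.holomorphic x₀ hx₀, h.hermitian x₀ hx₀]
  have hzero : ∀ u, (∀ v, B u v = 0) → A u = 0 := by
    intro u hu
    by_contra hne
    have e1 := hu (Complex.I • A u)
    rw [hBapply, hII, map_neg, neg_eq_zero] at e1
    exact (h.pos x₀ hx₀ _ hne).ne' e1
  by_cases hB0 : ∀ v, B v v = 0
  · have hBz : ∀ u v, B u v = 0 := by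
      intro u v
      have e1 := hB0 (u + v)
      have e2 := hBsymm u v
      simp only [map_add, add_apply, hB0] at e1
      linarith
    have hAz : A = 0 := ContinuousLinearMap.ext fun u => hzero u (hBz u)
    have hVz := h.eventually_eq_zero hx₀ h0 hAz
    obtain ⟨r, hr, hball⟩ := Metric.mem_nhds_iff.1 (inter_mem hVz hζ)
    refine Splitting.exists_isLevelBox_of_const (c := ζ x₀) ?_
    filter_upwards [Metric.ball_mem_nhds x₀ hr] with y hy
    refine (convex_ball x₀ r).is_const_of_fderivWithin_eq_zero (𝕜 := ℝ)
      (fun z hz => (hball hz).2.differentiableAt.differentiableWithinAt) (fun z hz => ?_) hy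
      (Metric.mem_ball_self hr)
    have e1 : V z = 0 := (hball hz).1
    rw [fderivWithin_of_isOpen Metric.isOpen_ball hz, (hball hz).2.fderiv]
    ext v
    simp [e1]
  push Not at hB0
  obtain ⟨e₁, he₁⟩ := hB0
  obtain ⟨L, a, b, ha, hLB, hb⟩ := exists_adapted_basis hE B hBsymm hBI he₁
  set LR : (ℂ × ℂ) ≃L[ℝ] E :=
    ⟨L.toLinearEquiv.restrictScalars ℝ, L.continuous, L.symm.continuous⟩ with hLR
  set f : ℂ × ℂ → ℝ := fun p => ζ (x₀ + L p) - ζ x₀ with hf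
  have hx0 : x₀ + L 0 = x₀ := by simp
  have hfc : ∀ n : ℕ, ContDiffAt ℝ (n + 1 : ℕ) f 0 := fun n =>
    (ContDiffAt.comp (g := ζ) (0 : ℂ × ℂ) (by
      have : x₀ + LR 0 = x₀ := hx0
      rw [this]; exact hζc n)
      (contDiffAt_const.add LR.contDiff.contDiffAt)).sub contDiffAt_const
  have hfQ : (fun p => f p - (a / 2 * ‖p.1‖ ^ 2 + b / 2 * ‖p.2‖ ^ 2)) =o[𝓝 0]
      fun p => ‖p‖ ^ 2 := by
    have e1 := isLittleO_taylor hζ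
      ((h.contDiffAt_oneForm hx₀).differentiableAt (by simp)).hasFDerivAt
      (by ext v; simp [h0]) hBsymm
    have e2 := Splitting.isLittleO_comp_clm e1 (LR : ℂ × ℂ →L[ℝ] E)
    refine e2.congr_left fun p => ?_
    have e3 : (LR : ℂ × ℂ →L[ℝ] E) p = L p := rfl
    have e4 := hLB p
    simp only [e3, hf, ← hB, e4]
    ring
  have hnf : Splitting.HasNormalForm f := by
    by_cases hb0 : b = 0
    swap
    · exact Splitting.hasNormalForm_of_nondegenerate (hfc 6) (by simpa using ha)
        (by simpa using hb0) hfQ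
    have hAe₂ : A (L (0, 1)) = 0 := hzero _ (hb hb0)
    -- Otherwise `A` would send `L (1, 0)` into the kernel, so `A² L (1, 0) = 0`. For a skew `A`
    -- this forces `A L (1, 0) = 0`, against `a ≠ 0`.
    have hAe₁ : (L.symm (A (L (1, 0)))).1 ≠ 0 := by
      intro hp
      have e1 : A (L (1, 0)) = (L.symm (A (L (1, 0)))).2 • L (0, 1) := by
        rw [← map_smul]
        conv_lhs => rw [← L.apply_symm_apply (A (L (1, 0)))]
        congr 1
        exact Prod.ext (by simpa using hp) (by simp)
      have e2 : A (A (L (1, 0))) = 0 := by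
        rw [e1, h.fderiv_real_eq hx₀ , map_smul, ← h.fderiv_real_eq hx₀, ← hA, hAe₂, smul_zero]
      have e3 : A (L (1, 0)) = 0 := by
        by_contra hne
        have e4 := hskew (L (1, 0)) (A (L (1, 0)))
        rw [e2, map_zero, neg_zero] at e4
        exact (h.pos x₀ hx₀ _ hne).ne' e4
      have e5 := hLB (1, 0)
      rw [hBapply, e3] at e5
      simp at e5
      exact ha e5.symm
    obtain ⟨μ, hμ, hμ0, hμV⟩ := h.exists_curve_of_zeros hx₀ h0 L hAe₁ hAe₂
    refine Splitting.hasNormalForm_of_degenerate (hfc 4) (a := a / 2) (by simpa using ha)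
      (by simpa [hb0] using hfQ) hμ hμ0 ?_
    have hlim : Tendsto (fun w : ℂ => x₀ + L (μ w, w)) (𝓝 0) (𝓝 x₀) := by
      have : ContinuousAt (fun w : ℂ => x₀ + L (μ w, w)) 0 :=
        continuousAt_const.add (L.continuous.continuousAt.comp (hμ.prodMk continuousAt_id))
      have h00 : ((0 : ℂ), (0 : ℂ)) = 0 := rfl
      rwa [ContinuousAt, hμ0, h00, hx0] at this
    filter_upwards [hμV, hlim.eventually hζ] with w e1 e2
    have e3 : oneForm g V (x₀ + L (μ w, w)) = 0 := by
      ext v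
      simp [e1]
    rw [e3] at e2
    have e4 : HasFDerivAt (fun p => x₀ + L p) (LR : ℂ × ℂ →L[ℝ] E) (μ w, w) :=
      LR.hasFDerivAt.const_add x₀
    have e5 := (HasFDerivAt.comp (μ w, w) (f := fun p => x₀ + L p) e2 e4).sub_const (ζ x₀)
    rwa [ContinuousLinearMap.zero_comp] at e5
  have hΦ : ContDiffAt ℝ 1 (fun x => LR.symm (x - x₀)) x₀ :=
    (LR.symm.contDiff.comp (contDiff_id.sub contDiff_const)).contDiffAt
  have hΦd : HasFDerivAt (fun x => LR.symm (x - x₀)) (LR.symm : E →L[ℝ] ℂ × ℂ) x₀ :=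
    LR.symm.hasFDerivAt.comp x₀ ((hasFDerivAt_id x₀).sub_const x₀)
  refine Splitting.IsLevelBox.exists_of_contDiffAt hΦ hΦd (q := f) (c := ζ x₀)
    (Eventually.of_forall fun x => ?_) ?_
  · have : L (LR.symm (x - x₀)) = x - x₀ := L.apply_symm_apply _
    simp only [hf]
    rw [this, add_sub_cancel, sub_add_cancel]
  · simpa using hnf.exists_isLevelBox

end IsKahlerKilling

end KillingField

/-! ### Vector fields and their brackets in holomorphic charts. -/

namespace Kahler

set_option maxSynthPendingDepth 3

open Filter Topology KillingField

section Chart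

variable {E : Type*} [NormedAddCommGroup E] [NormedSpace ℂ E] {M : Type*} [TopologicalSpace M]
  [ChartedSpace E M]

/-- The derivative of a chart. -/
noncomputable def chartDeriv (x₀ x : M) : TangentSpace 𝓘(ℝ, E) x →L[ℝ] E :=
  mfderiv 𝓘(ℝ, E) 𝓘(ℝ, E) (extChartAt 𝓘(ℝ, E) x₀) x

/-- The derivative of the inverse of a chart. -/
noncomputable def chartSymmDeriv (x₀ : M) (y : E) :
    E →L[ℝ] TangentSpace 𝓘(ℝ, E) ((extChartAt 𝓘(ℝ, E) x₀).symm y) :=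
  mfderiv 𝓘(ℝ, E) 𝓘(ℝ, E) (extChartAt 𝓘(ℝ, E) x₀).symm y

/-- The vector field on the domain of a chart with constant coordinates. -/
noncomputable def coordField (x₀ : M) (u : E) : VField E M :=
  VectorField.mpullback 𝓘(ℝ, E) 𝓘(ℝ, E) (extChartAt 𝓘(ℝ, E) x₀) (fun _ => u)

/-- A vector field in coordinates. -/
noncomputable def localField (V : VField E M) (x₀ : M) (y : E) : E :=
  VectorField.mpullback 𝓘(ℝ, E) 𝓘(ℝ, E) (extChartAt 𝓘(ℝ, E) x₀).symm V y

variable [IsManifold 𝓘(ℂ, E) ω M]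

/-- `J` at `x` is multiplication by `i` in the preferred chart at `x`, and the transition to the
chart at `x₀` is holomorphic. -/
theorem chartDeriv_J {x₀ x : M} (hx : x ∈ (extChartAt 𝓘(ℝ, E) x₀).source)
    (v : TangentSpace 𝓘(ℝ, E) x) :
    chartDeriv x₀ x (J x v) = Complex.I • chartDeriv x₀ x v := by
  have hx' : x ∈ (chartAt E x₀).source := by simpa using hx
  set F := (chartAt E x).symm ≫ₕ chartAt E x₀ with hF
  have h1 := (mem_groupoid_of_pregroupoid.1
    (HasGroupoid.compatible (G := contDiffGroupoid ω 𝓘(ℂ, E)) (chart_mem_atlas E x)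
      (chart_mem_atlas E x₀))).1
  have h2 : ContDiffOn ℂ ω F F.source := by
    simpa [contDiffPregroupoid, hF] using h1
  have hp : chartAt E x x ∈ F.source := by
    simp [hF, hx']
  have h3 : DifferentiableAt ℂ F (chartAt E x x) :=
    ((h2 _ hp).contDiffAt (F.open_source.mem_nhds hp)).differentiableAt (by simp)
  have h4 : HasMFDerivAt 𝓘(ℝ, E) 𝓘(ℝ, E) (extChartAt 𝓘(ℝ, E) x₀) x
      ((fderiv ℂ F (chartAt E x x)).restrictScalars ℝ) := by
    refine ⟨continuousAt_extChartAt' hx, ?_⟩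
    have h5 := (h3.hasFDerivAt.restrictScalars ℝ).hasFDerivWithinAt (s := range 𝓘(ℝ, E))
    rw [writtenInExtChartAt, extChartAt_model_space_eq_id]
    exact h5
  have h6 : ∀ w : E, fderiv ℂ F (chartAt E x x) (Complex.I • w) =
      Complex.I • fderiv ℂ F (chartAt E x x) w := fun w => map_smul _ _ _
  rw [chartDeriv, h4.mfderiv]
  exact h6 v

theorem contMDiffAt_extChartAt_symm {x₀ : M} {y : E} (hy : y ∈ (extChartAt 𝓘(ℝ, E) x₀).target) :
    ContMDiffAt 𝓘(ℝ, E) 𝓘(ℝ, E) ∞ (extChartAt 𝓘(ℝ, E) x₀).symm y :=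
  (contMDiffOn_extChartAt_symm x₀).contMDiffAt ((isOpen_extChartAt_target x₀).mem_nhds hy)

theorem isInvertible_mfderiv_extChartAt_symm {x₀ : M} {y : E}
    (hy : y ∈ (extChartAt 𝓘(ℝ, E) x₀).target) :
    (mfderiv 𝓘(ℝ, E) 𝓘(ℝ, E) (extChartAt 𝓘(ℝ, E) x₀).symm y).IsInvertible := by
  have := isInvertible_mfderivWithin_extChartAt_symm (I := 𝓘(ℝ, E)) (x := x₀) hy
  simpa using! this

theorem chartSymmDeriv_comp {x₀ : M} {y : E} (hy : y ∈ (extChartAt 𝓘(ℝ, E) x₀).target) (v : E) :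
    chartDeriv x₀ ((extChartAt 𝓘(ℝ, E) x₀).symm y) (chartSymmDeriv x₀ y v) = v := by
  have := mfderiv_extChartAt_comp_mfderivWithin_extChartAt_symm (I := 𝓘(ℝ, E)) hy
  rw [modelWithCornersSelf_coe, range_id, mfderivWithin_univ] at this
  exact congrArg (fun l : E →L[ℝ] E => l v) this

theorem chartSymmDeriv_comp' {x₀ : M} {y : E} (hy : y ∈ (extChartAt 𝓘(ℝ, E) x₀).target)
    (v : TangentSpace 𝓘(ℝ, E) ((extChartAt 𝓘(ℝ, E) x₀).symm y)) :
    chartSymmDeriv x₀ y (chartDeriv x₀ ((extChartAt 𝓘(ℝ, E) x₀).symm y) v) = v := by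
  have := mfderivWithin_extChartAt_symm_comp_mfderiv_extChartAt (I := 𝓘(ℝ, E)) hy
  rw [modelWithCornersSelf_coe, range_id, mfderivWithin_univ] at this
  exact congrArg (fun l : TangentSpace 𝓘(ℝ, E) ((extChartAt 𝓘(ℝ, E) x₀).symm y) →L[ℝ]
    TangentSpace 𝓘(ℝ, E) ((extChartAt 𝓘(ℝ, E) x₀).symm y) => l v) this

theorem chartSymmDeriv_I {x₀ : M} {y : E} (hy : y ∈ (extChartAt 𝓘(ℝ, E) x₀).target) (v : E) :
    chartSymmDeriv x₀ y (Complex.I • v) = J _ (chartSymmDeriv x₀ y v) := by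
  have h1 := chartDeriv_J ((extChartAt 𝓘(ℝ, E) x₀).map_target hy) (chartSymmDeriv x₀ y v)
  rw [chartSymmDeriv_comp hy] at h1
  rw [← h1, chartSymmDeriv_comp' hy]

theorem inverse_chartDeriv {x₀ : M} {y : E} (hy : y ∈ (extChartAt 𝓘(ℝ, E) x₀).target) :
    (chartDeriv x₀ ((extChartAt 𝓘(ℝ, E) x₀).symm y)).inverse = chartSymmDeriv x₀ y :=
  ContinuousLinearMap.inverse_eq (ContinuousLinearMap.ext (chartSymmDeriv_comp hy))
    (ContinuousLinearMap.ext (chartSymmDeriv_comp' hy))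

theorem coordField_apply {x₀ : M} {y : E} (hy : y ∈ (extChartAt 𝓘(ℝ, E) x₀).target) (u : E) :
    coordField x₀ u ((extChartAt 𝓘(ℝ, E) x₀).symm y) = chartSymmDeriv x₀ y u := by
  rw [← inverse_chartDeriv hy]
  rfl

theorem localField_apply (V : VField E M) {x₀ : M} {y : E}
    (hy : y ∈ (extChartAt 𝓘(ℝ, E) x₀).target) :
    localField V x₀ y = chartDeriv x₀ _ (V ((extChartAt 𝓘(ℝ, E) x₀).symm y)) := by
  have : (chartSymmDeriv x₀ y).inverse = chartDeriv x₀ ((extChartAt 𝓘(ℝ, E) x₀).symm y) :=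
    ContinuousLinearMap.inverse_eq (ContinuousLinearMap.ext (chartSymmDeriv_comp' hy))
      (ContinuousLinearMap.ext (chartSymmDeriv_comp hy))
  rw [← this]
  rfl

theorem chartSymmDeriv_localField (V : VField E M) {x₀ : M} {y : E}
    (hy : y ∈ (extChartAt 𝓘(ℝ, E) x₀).target) :
    chartSymmDeriv x₀ y (localField V x₀ y) = V ((extChartAt 𝓘(ℝ, E) x₀).symm y) := by
  rw [localField_apply V hy, chartSymmDeriv_comp' hy]

theorem mpullback_extChartAt {x₀ : M} {y : E} (hy : y ∈ (extChartAt 𝓘(ℝ, E) x₀).target)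
    (X : E → E) : VectorField.mpullback 𝓘(ℝ, E) 𝓘(ℝ, E) (extChartAt 𝓘(ℝ, E) x₀) X
      ((extChartAt 𝓘(ℝ, E) x₀).symm y) = chartSymmDeriv x₀ y (X y) := by
  have h : VectorField.mpullback 𝓘(ℝ, E) 𝓘(ℝ, E) (extChartAt 𝓘(ℝ, E) x₀) X
      ((extChartAt 𝓘(ℝ, E) x₀).symm y) =
      (chartDeriv x₀ ((extChartAt 𝓘(ℝ, E) x₀).symm y)).inverse
        (X (extChartAt 𝓘(ℝ, E) x₀ ((extChartAt 𝓘(ℝ, E) x₀).symm y))) := rfl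
  rw [h, inverse_chartDeriv hy, (extChartAt 𝓘(ℝ, E) x₀).right_inv hy]

theorem mpullback_localField (V : VField E M) {x₀ x : M}
    (hx : x ∈ (extChartAt 𝓘(ℝ, E) x₀).source) :
    V =ᶠ[𝓝 x] VectorField.mpullback 𝓘(ℝ, E) 𝓘(ℝ, E) (extChartAt 𝓘(ℝ, E) x₀)
      (localField V x₀) := by
  filter_upwards [(isOpen_extChartAt_source x₀).mem_nhds hx] with z hz
  obtain ⟨y, hy, rfl⟩ : ∃ y ∈ (extChartAt 𝓘(ℝ, E) x₀).target,
      (extChartAt 𝓘(ℝ, E) x₀).symm y = z :=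
    ⟨_, (extChartAt 𝓘(ℝ, E) x₀).map_source hz, (extChartAt 𝓘(ℝ, E) x₀).left_inv hz⟩
  rw [mpullback_extChartAt hy (localField V x₀), chartSymmDeriv_localField V hy]

variable [CompleteSpace E]

theorem smoothAt_coordField {x₀ x : M} (hx : x ∈ (extChartAt 𝓘(ℝ, E) x₀).source) (u : E) :
    SmoothAt (coordField x₀ u) x :=
  ContMDiffAt.mpullback_vectorField_preimage (n := ∞)
    (contMDiffAt_vectorSpace_iff_contDiffAt.2 contDiffAt_const)
    (contMDiffAt_extChartAt' (by simpa using hx)) (isInvertible_mfderiv_extChartAt hx) (by simp)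

theorem contDiffAt_localField {V : VField E M} {x₀ : M} {y : E}
    (hy : y ∈ (extChartAt 𝓘(ℝ, E) x₀).target)
    (hV : SmoothAt V ((extChartAt 𝓘(ℝ, E) x₀).symm y)) : ContDiffAt ℝ ∞ (localField V x₀) y := by
  have := ContMDiffAt.mpullback_vectorField_preimage (n := ∞) hV (contMDiffAt_extChartAt_symm hy)
    (isInvertible_mfderiv_extChartAt_symm hy) (by simp)
  exact contMDiffAt_vectorSpace_iff_contDiffAt.1 this

omit [CompleteSpace E] in
theorem mlieBracket_eq_lieBracket (X Y : (x : E) → TangentSpace 𝓘(ℝ, E) x) :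
    VectorField.mlieBracket 𝓘(ℝ, E) X Y = VectorField.lieBracket ℝ X Y := by
  rw [← VectorField.mlieBracketWithin_univ, VectorField.mlieBracketWithin_eq_lieBracketWithin]
  exact VectorField.lieBracketWithin_univ

theorem mlieBracket_mpullback {x₀ : M} {y : E} (hy : y ∈ (extChartAt 𝓘(ℝ, E) x₀).target)
    {X Y : E → E} (hX : ContDiffAt ℝ ∞ X y) (hY : ContDiffAt ℝ ∞ Y y) :
    VectorField.mlieBracket 𝓘(ℝ, E)
      (VectorField.mpullback 𝓘(ℝ, E) 𝓘(ℝ, E) (extChartAt 𝓘(ℝ, E) x₀) X)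
      (VectorField.mpullback 𝓘(ℝ, E) 𝓘(ℝ, E) (extChartAt 𝓘(ℝ, E) x₀) Y)
      ((extChartAt 𝓘(ℝ, E) x₀).symm y) =
      chartSymmDeriv x₀ y (fderiv ℝ Y y (X y) - fderiv ℝ X y (Y y)) := by
  have hys := (extChartAt 𝓘(ℝ, E) x₀).map_target hy
  have hr := (extChartAt 𝓘(ℝ, E) x₀).right_inv hy
  have hmd : ∀ {Z : E → E}, ContDiffAt ℝ ∞ Z y →
      MDifferentiableAt 𝓘(ℝ, E) 𝓘(ℝ, E).tangent (fun z => (⟨z, Z z⟩ : TangentBundle 𝓘(ℝ, E) E))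
        (extChartAt 𝓘(ℝ, E) x₀ ((extChartAt 𝓘(ℝ, E) x₀).symm y)) := by
    intro Z hZ
    rw [hr]
    have := (contMDiffAt_vectorSpace_iff_contDiffAt (V := Z)).2 hZ
    exact this.mdifferentiableAt (by simp)
  have : IsManifold 𝓘(ℝ, E) (minSmoothness ℝ 2) M := by
    rw [minSmoothness_of_isRCLikeNormedField]; infer_instance
  have : IsManifold 𝓘(ℝ, E) (minSmoothness ℝ 3) M := by
    rw [minSmoothness_of_isRCLikeNormedField]; infer_instance
  have h1 := VectorField.mpullback_mlieBracket (n := ∞) (hmd hX) (hmd hY)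
    (contMDiffAt_extChartAt' (n := ∞) (by simpa using hys)) (by
      rw [minSmoothness_of_isRCLikeNormedField]
      simpa [one_add_one_eq_two] using one_add_one_le_infty)
  refine h1.symm.trans ((mpullback_extChartAt hy (VectorField.mlieBracket 𝓘(ℝ, E) X Y)).trans ?_)
  exact congrArg (chartSymmDeriv x₀ y) (congrFun (mlieBracket_eq_lieBracket X Y) y)

/-- With constant-coordinate fields as test fields, the Lie derivative conditions become first order
equations for the coordinates of `V`. -/
theorem mlieBracket_coordField (V : VField E M) {x₀ : M} {y : E}
    (hy : y ∈ (extChartAt 𝓘(ℝ, E) x₀).target)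
    (hV : SmoothAt V ((extChartAt 𝓘(ℝ, E) x₀).symm y)) (u : E) :
    VectorField.mlieBracket 𝓘(ℝ, E) V (coordField x₀ u) ((extChartAt 𝓘(ℝ, E) x₀).symm y) =
      -chartSymmDeriv x₀ y (fderiv ℝ (localField V x₀) y u) := by
  have hys := (extChartAt 𝓘(ℝ, E) x₀).map_target hy
  refine ((mpullback_localField V hys).mlieBracket_vectorField_eq (EventuallyEq.refl _ _)).trans ?_
  refine (mlieBracket_mpullback hy (contDiffAt_localField hy hV) contDiffAt_const).trans ?_
  have : fderiv ℝ (fun _ : E => u) y (localField V x₀ y) - fderiv ℝ (localField V x₀) y u =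
      -fderiv ℝ (localField V x₀) y u := by simp
  rw [this]
  exact map_neg (chartSymmDeriv x₀ y) _

theorem mlieBracket_coordField_coordField {x₀ : M} {y : E}
    (hy : y ∈ (extChartAt 𝓘(ℝ, E) x₀).target) (u v : E) :
    VectorField.mlieBracket 𝓘(ℝ, E) (coordField x₀ u) (coordField x₀ v)
      ((extChartAt 𝓘(ℝ, E) x₀).symm y) = 0 := by
  refine (mlieBracket_mpullback hy contDiffAt_const contDiffAt_const).trans ?_
  have : fderiv ℝ (fun _ : E => v) y u - fderiv ℝ (fun _ : E => u) y v = 0 := by simp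
  rw [this]
  exact map_zero (chartSymmDeriv x₀ y)

end Chart

end Kahler

/-! ### The Kähler metric in coordinates. -/

namespace Kahler

set_option maxSynthPendingDepth 3

open Filter Topology KillingField

section LocalMetric

variable {E : Type*} [NormedAddCommGroup E] [NormedSpace ℂ E] {M : Type*} [TopologicalSpace M]
  [ChartedSpace E M] [RiemannianBundle (fun x : M => TangentSpace 𝓘(ℝ, E) x)]

/-- The Riemannian metric in coordinates. -/
noncomputable def localMetric (x₀ : M) (y : E) : E →L[ℝ] E →L[ℝ] ℝ :=
  (innerSL ℝ (E := TangentSpace 𝓘(ℝ, E) ((extChartAt 𝓘(ℝ, E) x₀).symm y))).bilinearComp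
    (chartSymmDeriv x₀ y) (chartSymmDeriv x₀ y)

theorem localMetric_apply (x₀ : M) (y u v : E) :
    localMetric x₀ y u v = inner ℝ (chartSymmDeriv x₀ y u) (chartSymmDeriv x₀ y v) := rfl

variable [IsManifold 𝓘(ℂ, E) ω M]

omit [RiemannianBundle (fun x : M => TangentSpace 𝓘(ℝ, E) x)] in
theorem dirDeriv_eq {x₀ : M} {y : E} (hy : y ∈ (extChartAt 𝓘(ℝ, E) x₀).target) {f : M → ℝ}
    {G : E → ℝ} (hG : DifferentiableAt ℝ G y)
    (h : ∀ z ∈ (extChartAt 𝓘(ℝ, E) x₀).target, f ((extChartAt 𝓘(ℝ, E) x₀).symm z) = G z)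
    (w : TangentSpace 𝓘(ℝ, E) ((extChartAt 𝓘(ℝ, E) x₀).symm y)) :
    dirDeriv f ((extChartAt 𝓘(ℝ, E) x₀).symm y) w = fderiv ℝ G y (chartDeriv x₀ _ w) := by
  have hys := (extChartAt 𝓘(ℝ, E) x₀).map_target hy
  have hr := (extChartAt 𝓘(ℝ, E) x₀).right_inv hy
  have h1 : HasMFDerivAt 𝓘(ℝ, E) 𝓘(ℝ, E) (extChartAt 𝓘(ℝ, E) x₀)
      ((extChartAt 𝓘(ℝ, E) x₀).symm y) (chartDeriv x₀ _) :=
    (mdifferentiableAt_extChartAt (by simpa using hys)).hasMFDerivAt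
  have h2 : HasMFDerivAt 𝓘(ℝ, E) 𝓘(ℝ, ℝ) G
      (extChartAt 𝓘(ℝ, E) x₀ ((extChartAt 𝓘(ℝ, E) x₀).symm y)) (fderiv ℝ G y) := by
    rw [hr]
    exact hG.hasFDerivAt.hasMFDerivAt
  have h3 := (h2.comp _ h1).congr_of_eventuallyEq (f₁ := f) (by
    filter_upwards [(isOpen_extChartAt_source x₀).mem_nhds hys] with z hz
    have := h _ ((extChartAt 𝓘(ℝ, E) x₀).map_source hz)
    rwa [(extChartAt 𝓘(ℝ, E) x₀).left_inv hz] at this)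
  rw [dirDeriv, h3.mfderiv]
  rfl

theorem inner_coordField {x₀ : M} {y : E} (hy : y ∈ (extChartAt 𝓘(ℝ, E) x₀).target) (u v : E) :
    inner ℝ (coordField x₀ u ((extChartAt 𝓘(ℝ, E) x₀).symm y))
      (coordField x₀ v ((extChartAt 𝓘(ℝ, E) x₀).symm y)) = localMetric x₀ y u v := by
  rw [coordField_apply hy, coordField_apply hy, localMetric_apply]

theorem kahlerForm_coordField {x₀ : M} {y : E} (hy : y ∈ (extChartAt 𝓘(ℝ, E) x₀).target)
    (u v : E) :
    kahlerForm ((extChartAt 𝓘(ℝ, E) x₀).symm y)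
      (coordField x₀ u ((extChartAt 𝓘(ℝ, E) x₀).symm y))
      (coordField x₀ v ((extChartAt 𝓘(ℝ, E) x₀).symm y)) = localMetric x₀ y (Complex.I • u) v := by
  rw [coordField_apply hy, coordField_apply hy, localMetric_apply, chartSymmDeriv_I hy]
  rfl

variable [IsContMDiffRiemannianBundle 𝓘(ℝ, E) ∞ E (fun x : M => TangentSpace 𝓘(ℝ, E) x)]

theorem contDiffAt_localMetric [FiniteDimensional ℝ E] {x₀ : M} {y : E}
    (hy : y ∈ (extChartAt 𝓘(ℝ, E) x₀).target) : ContDiffAt ℝ ∞ (localMetric x₀) y := by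
  have : CompleteSpace E := FiniteDimensional.complete ℝ E
  refine ContDiffOn.contDiffAt (s := (extChartAt 𝓘(ℝ, E) x₀).target) ?_
    ((isOpen_extChartAt_target x₀).mem_nhds hy)
  refine contDiffOn_clm_apply.2 fun u => contDiffOn_clm_apply.2 fun v z hz => ?_
  refine ContDiffAt.contDiffWithinAt ?_
  have hzs := (extChartAt 𝓘(ℝ, E) x₀).map_target hz
  have h1 : ContMDiffAt 𝓘(ℝ, E) 𝓘(ℝ, ℝ) ∞
      (fun x => inner ℝ (coordField x₀ u x) (coordField x₀ v x))
      ((extChartAt 𝓘(ℝ, E) x₀).symm z) :=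
    ContMDiffAt.inner_bundle (F := E) (smoothAt_coordField hzs u) (smoothAt_coordField hzs v)
  have h2 := ContMDiffAt.comp z h1 (contMDiffAt_extChartAt_symm hz)
  refine h2.contDiffAt.congr_of_eventuallyEq ?_
  filter_upwards [(isOpen_extChartAt_target x₀).mem_nhds hz] with w hw
  exact (inner_coordField hw u v).symm

theorem hasFDerivAt_localMetric [FiniteDimensional ℝ E] {x₀ : M} {y : E}
    (hy : y ∈ (extChartAt 𝓘(ℝ, E) x₀).target) (u v : E) :
    DifferentiableAt ℝ (fun z => localMetric x₀ z u v) y ∧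
      ∀ w, fderiv ℝ (fun z => localMetric x₀ z u v) y w =
        fderiv ℝ (localMetric x₀) y w u v := by
  have h := ((contDiffAt_localMetric hy).differentiableAt (by simp)).hasFDerivAt
  have h1 := (h.clm_apply (hasFDerivAt_const u y)).clm_apply (hasFDerivAt_const v y)
  refine ⟨h1.differentiableAt, fun w => ?_⟩
  rw [h1.fderiv]
  simp

theorem dirDeriv_metric_coordField [FiniteDimensional ℝ E] {x₀ : M} {y : E}
    (hy : y ∈ (extChartAt 𝓘(ℝ, E) x₀).target) (u v : E)
    (w : TangentSpace 𝓘(ℝ, E) ((extChartAt 𝓘(ℝ, E) x₀).symm y)) :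
    dirDeriv (fun x => metric x (coordField x₀ u x) (coordField x₀ v x))
      ((extChartAt 𝓘(ℝ, E) x₀).symm y) w =
      fderiv ℝ (localMetric x₀) y (chartDeriv x₀ _ w) u v := by
  obtain ⟨h1, h2⟩ := hasFDerivAt_localMetric hy u v
  rw [dirDeriv_eq hy h1 (fun z hz => inner_coordField hz u v), h2]

theorem dirDeriv_kahlerForm_coordField [FiniteDimensional ℝ E] {x₀ : M} {y : E}
    (hy : y ∈ (extChartAt 𝓘(ℝ, E) x₀).target) (u v : E)
    (w : TangentSpace 𝓘(ℝ, E) ((extChartAt 𝓘(ℝ, E) x₀).symm y)) :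
    dirDeriv (fun x => kahlerForm x (coordField x₀ u x) (coordField x₀ v x))
      ((extChartAt 𝓘(ℝ, E) x₀).symm y) w =
      fderiv ℝ (localMetric x₀) y (chartDeriv x₀ _ w) (Complex.I • u) v := by
  obtain ⟨h1, h2⟩ := hasFDerivAt_localMetric hy (Complex.I • u) v
  rw [dirDeriv_eq hy h1 (fun z hz => kahlerForm_coordField hz u v), h2]

/-- A Killing field of a Kähler manifold in a holomorphic chart. -/
theorem isKahlerKilling [FiniteDimensional ℝ E] (hM : IsKahler E M) {V : VField E M}
    (hV : IsSymplecticKilling V) (x₀ : M) :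
    IsKahlerKilling (extChartAt 𝓘(ℝ, E) x₀).target (localMetric x₀) (localField V x₀) := by
  have : CompleteSpace E := FiniteDimensional.complete ℝ E
  have hsymm : ∀ y u v : E, localMetric x₀ y u v = localMetric x₀ y v u := fun y u v =>
    real_inner_comm (chartSymmDeriv x₀ y v) (chartSymmDeriv x₀ y u)
  have hpos : ∀ y ∈ (extChartAt 𝓘(ℝ, E) x₀).target, ∀ u, u ≠ 0 → 0 < localMetric x₀ y u u := by
    intro y hy u hu
    refine (real_inner_self_pos (x := chartSymmDeriv x₀ y u)).2 fun h0 => hu ?_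
    rw [← chartSymmDeriv_comp hy u, h0]
    exact map_zero (chartDeriv x₀ ((extChartAt 𝓘(ℝ, E) x₀).symm y))
  have hherm : ∀ y ∈ (extChartAt 𝓘(ℝ, E) x₀).target, ∀ u v,
      localMetric x₀ y (Complex.I • u) (Complex.I • v) = localMetric x₀ y u v := by
    intro y hy u v
    rw [localMetric_apply, chartSymmDeriv_I hy, chartSymmDeriv_I hy]
    exact hM.hermitian _ _ _
  have hbr : ∀ y ∈ (extChartAt 𝓘(ℝ, E) x₀).target, ∀ u,
      VectorField.mlieBracket 𝓘(ℝ, E) V (coordField x₀ u) ((extChartAt 𝓘(ℝ, E) x₀).symm y) =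
      chartSymmDeriv x₀ y (-fderiv ℝ (localField V x₀) y u) := by
    intro y hy u
    rw [mlieBracket_coordField V hy (hV.smooth _)]
    exact (map_neg (chartSymmDeriv x₀ y) _).symm
  have hkill : ∀ y ∈ (extChartAt 𝓘(ℝ, E) x₀).target, ∀ u v,
      fderiv ℝ (localMetric x₀) y (localField V x₀ y) u v +
        localMetric x₀ y (fderiv ℝ (localField V x₀) y u) v +
        localMetric x₀ y u (fderiv ℝ (localField V x₀) y v) = 0 := by
    intro y hy u v
    have hys := (extChartAt 𝓘(ℝ, E) x₀).map_target hy
    have h1 := hV.killing _ _ _ (smoothAt_coordField hys u) (smoothAt_coordField hys v)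
    rw [dirDeriv_metric_coordField hy, ← localField_apply V hy, hbr y hy, hbr y hy,
      coordField_apply hy, coordField_apply hy, metric, metric, ← localMetric_apply,
      ← localMetric_apply, map_neg, map_neg, neg_apply] at h1
    linarith
  have hsymp : ∀ y ∈ (extChartAt 𝓘(ℝ, E) x₀).target, ∀ u v,
      fderiv ℝ (localMetric x₀) y (localField V x₀ y) (Complex.I • u) v +
        localMetric x₀ y (Complex.I • fderiv ℝ (localField V x₀) y u) v +
        localMetric x₀ y (Complex.I • u) (fderiv ℝ (localField V x₀) y v) = 0 := by
    intro y hy u v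
    have hys := (extChartAt 𝓘(ℝ, E) x₀).map_target hy
    have h1 := hV.symplectic _ _ _ (smoothAt_coordField hys u) (smoothAt_coordField hys v)
    rw [dirDeriv_kahlerForm_coordField hy, ← localField_apply V hy, hbr y hy, hbr y hy,
      coordField_apply hy, coordField_apply hy, kahlerForm, kahlerForm, ← chartSymmDeriv_I hy,
      ← chartSymmDeriv_I hy, ← localMetric_apply, ← localMetric_apply, smul_neg, map_neg, map_neg,
      neg_apply] at h1
    linarith
  refine ⟨isOpen_extChartAt_target x₀, fun y hy => contDiffAt_localMetric hy,
    fun y hy => contDiffAt_localField hy (hV.smooth _), fun y _ => hsymm y, hpos, hherm, hkill,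
    fun y hy u => ?_, fun y hy u v w => ?_⟩
  -- The Killing equation at `(iu, d)` minus the symplectic equation at `(u, d)` says that the
  -- defect of complex linearity is orthogonal to `d`; here `d` is the defect itself.
  · rw [← sub_eq_zero]
    by_contra hne
    set d := fderiv ℝ (localField V x₀) y (Complex.I • u) -
      Complex.I • fderiv ℝ (localField V x₀) y u with hd
    have h1 := hkill y hy (Complex.I • u) d
    have h2 := hsymp y hy u d
    have h3 : localMetric x₀ y d d = localMetric x₀ y (fderiv ℝ (localField V x₀) y
        (Complex.I • u)) d - localMetric x₀ y (Complex.I • fderiv ℝ (localField V x₀) y u) d := by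
      rw [← sub_apply, ← map_sub]
    have h4 := hpos y hy d hne
    linarith
  · have hys := (extChartAt 𝓘(ℝ, E) x₀).map_target hy
    have h1 := hM.closed _ _ _ _ (smoothAt_coordField hys u) (smoothAt_coordField hys v)
      (smoothAt_coordField hys w)
    have h0 : ∀ a b c, kahlerForm ((extChartAt 𝓘(ℝ, E) x₀).symm y)
        (VectorField.mlieBracket 𝓘(ℝ, E) (coordField x₀ a) (coordField x₀ b)
          ((extChartAt 𝓘(ℝ, E) x₀).symm y)) c = 0 := by
      intro a b c
      rw [mlieBracket_coordField_coordField hy, kahlerForm, map_zero, inner_zero_left]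
    rw [h0, h0, h0, dirDeriv_kahlerForm_coordField hy, dirDeriv_kahlerForm_coordField hy,
      dirDeriv_kahlerForm_coordField hy, coordField_apply hy, coordField_apply hy,
      coordField_apply hy, chartSymmDeriv_comp hy, chartSymmDeriv_comp hy,
      chartSymmDeriv_comp hy] at h1
    linarith

end LocalMetric

end Kahler

/-! ### Leaves and primitives of `ω(·, V)`. -/

namespace Kahler

set_option maxSynthPendingDepth 3

open Filter Topology KillingField

section Leaf

variable {E : Type*} [NormedAddCommGroup E] [NormedSpace ℂ E] {M : Type*} [TopologicalSpace M]
  [ChartedSpace E M] [RiemannianBundle (fun x : M => TangentSpace 𝓘(ℝ, E) x)]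

/-- A `C¹` curve which is tangent to the distribution `𝒟`. -/
def IsTangentCurve (V : VField E M) (γ : ℝ → M) : Prop :=
  ContMDiff 𝓘(ℝ, ℝ) 𝓘(ℝ, E) 1 γ ∧
    ∀ t : ℝ, mfderiv 𝓘(ℝ, ℝ) 𝓘(ℝ, E) γ t (1 : ℝ) ∈ distribution V (γ t)

theorem mem_leaf {V : VField E M} {p q : M} :
    q ∈ leaf V p ↔ ∃ γ : ℝ → M, IsTangentCurve V γ ∧ γ 0 = p ∧ γ 1 = q :=
  ⟨fun ⟨γ, h1, h2, h3, h4⟩ => ⟨γ, ⟨h1, h4⟩, h2, h3⟩,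
    fun ⟨γ, ⟨h1, h4⟩, h2, h3⟩ => ⟨γ, h1, h2, h3, h4⟩⟩

theorem smul_mem_distribution {V : VField E M} {x : M} {v : TangentSpace 𝓘(ℝ, E) x}
    (hv : v ∈ distribution V x) (c : ℝ) : c • v ∈ distribution V x := by
  have h : kahlerForm x v (V x) = 0 := hv
  change kahlerForm x (c • v) (V x) = 0
  rw [kahlerForm, map_smul, real_inner_smul_left, ← kahlerForm, h, mul_zero]

theorem isTangentCurve_const (V : VField E M) (p : M) : IsTangentCurve V fun _ => p := by
  refine ⟨contMDiff_const, fun t => ?_⟩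
  rw [mfderiv_const]
  change kahlerForm p 0 (V p) = 0
  rw [kahlerForm, map_zero, inner_zero_left]

theorem IsTangentCurve.of_eventuallyEq {V : VField E M} {γ : ℝ → M}
    (h : ∀ t, ∃ γ', IsTangentCurve V γ' ∧ γ =ᶠ[𝓝 t] γ') : IsTangentCurve V γ := by
  refine ⟨fun t => ?_, fun t => ?_⟩
  · obtain ⟨γ', h1, h2⟩ := h t
    exact (h1.1 t).congr_of_eventuallyEq h2
  · obtain ⟨γ', h1, h2⟩ := h t
    -- Base point and velocity are generalized separately, because the tangent space depends on the
    -- base point.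
    have h3 : ∀ (x : M) (v : E), x = γ' t → v = mfderiv 𝓘(ℝ, ℝ) 𝓘(ℝ, E) γ' t (1 : ℝ) →
        (v : TangentSpace 𝓘(ℝ, E) x) ∈ distribution V x := by
      rintro _ _ rfl rfl
      exact h1.2 t
    refine h3 _ _ h2.self_of_nhds ?_
    exact congrArg (fun l : ℝ →L[ℝ] E => l 1) h2.mfderiv_eq

theorem IsTangentCurve.comp {V : VField E M} {γ : ℝ → M} (h : IsTangentCurve V γ) {s : ℝ → ℝ}
    (hs : ContDiff ℝ 1 s) : IsTangentCurve V (γ ∘ s) := by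
  refine ⟨h.1.comp hs.contMDiff, fun t => ?_⟩
  have h1 : HasMFDerivAt 𝓘(ℝ, ℝ) 𝓘(ℝ, ℝ) s t (fderiv ℝ s t) :=
    (hs.differentiable one_ne_zero t).hasFDerivAt.hasMFDerivAt
  have h2 : HasMFDerivAt 𝓘(ℝ, ℝ) 𝓘(ℝ, E) γ (s t) (mfderiv 𝓘(ℝ, ℝ) 𝓘(ℝ, E) γ (s t)) :=
    (h.1.mdifferentiableAt one_ne_zero).hasMFDerivAt
  have h3 : ∀ (l : ℝ →L[ℝ] E) (l' : ℝ →L[ℝ] ℝ), (l.comp l') 1 = l' 1 • l 1 := fun l l' => by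
    rw [ContinuousLinearMap.comp_apply, ← map_smul, smul_eq_mul, mul_one]
  have h4 : mfderiv 𝓘(ℝ, ℝ) 𝓘(ℝ, E) (γ ∘ s) t (1 : ℝ) =
      (deriv s t • mfderiv 𝓘(ℝ, ℝ) 𝓘(ℝ, E) γ (s t) (1 : ℝ) : TangentSpace 𝓘(ℝ, E) (γ (s t))) :=
    (congrArg (fun l : ℝ →L[ℝ] E => l 1) (h2.comp t h1).mfderiv).trans (h3 _ _)
  exact h4 ▸ smul_mem_distribution (h.2 (s t)) _

theorem leaf_equivalence (V : VField E M) : Equivalence fun p q => q ∈ leaf V p where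
  refl p := mem_leaf.2 ⟨_, isTangentCurve_const V p, rfl, rfl⟩
  symm := by
    intro p q h
    obtain ⟨γ, hγ, rfl, rfl⟩ := mem_leaf.1 h
    exact mem_leaf.2 ⟨_, hγ.comp (s := fun t => 1 - t) (by fun_prop), by simp, by simp⟩
  trans := by
    intro p q r h h'
    obtain ⟨γ, hγ, rfl, rfl⟩ := mem_leaf.1 h
    obtain ⟨δ, hδ, h1, rfl⟩ := mem_leaf.1 h'
    -- The first curve comes to rest at time `1/3` and the second starts at `2/3`, so the
    -- concatenation is constant around `1/2` and remains `C¹`.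
    have hγ' := hγ.comp (s := fun t => Real.smoothTransition (3 * t))
      (Real.smoothTransition.contDiff.comp (by fun_prop))
    have hδ' := hδ.comp (s := fun t => Real.smoothTransition (3 * t - 2))
      (Real.smoothTransition.contDiff.comp (by fun_prop))
    refine mem_leaf.2 ⟨fun t => if t < 1 / 2 then γ (Real.smoothTransition (3 * t)) else
      δ (Real.smoothTransition (3 * t - 2)), .of_eventuallyEq fun t => ?_, by simp, ?_⟩
    · obtain ht | ht := lt_or_ge t (1 / 2)
      · refine ⟨_, hγ', ?_⟩
        filter_upwards [gt_mem_nhds ht] with s hs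
        simp only [hs, if_true, Function.comp_apply]
      · refine ⟨_, hδ', ?_⟩
        filter_upwards [lt_mem_nhds (show 1 / 3 < t by linarith)] with s hs
        split_ifs with h2
        · rw [Function.comp_apply, Real.smoothTransition.one_of_one_le (by linarith),
            Real.smoothTransition.zero_of_nonpos (by linarith), h1]
        · rfl
    · beta_reduce
      rw [if_neg (by norm_num), Real.smoothTransition.one_of_one_le (by norm_num)]

/-- The function `z` is a primitive of the 1-form `ω(·, V)` at `q`. -/
def IsPrimitiveAt (V : VField E M) (z : M → ℝ) (q : M) : Prop :=
  MDifferentiableAt 𝓘(ℝ, E) 𝓘(ℝ, ℝ) z q ∧ ∀ v, dirDeriv z q v = kahlerForm q v (V q)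

theorem IsPrimitiveAt.hasDerivAt_comp {V : VField E M} {z : M → ℝ} {γ : ℝ → M} {t : ℝ}
    (h : IsPrimitiveAt V z (γ t)) (hγ : MDifferentiableAt 𝓘(ℝ, ℝ) 𝓘(ℝ, E) γ t) :
    HasDerivAt (z ∘ γ) (kahlerForm (γ t) (mfderiv 𝓘(ℝ, ℝ) 𝓘(ℝ, E) γ t (1 : ℝ)) (V (γ t))) t := by
  have h1 : ∀ l : ℝ →L[ℝ] ℝ, HasFDerivAt (z ∘ γ) l t → HasDerivAt (z ∘ γ) (l 1) t :=
    fun l hl => hl.hasDerivAt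
  rw [← h.2]
  exact h1 _ (h.1.hasMFDerivAt.comp t hγ.hasMFDerivAt).hasFDerivAt

/-- In a chart the difference of two primitives has zero derivative on a ball. -/
theorem IsPrimitiveAt.eventually_sub_eq [IsManifold 𝓘(ℂ, E) ω M] {V : VField E M} {z z' : M → ℝ}
    {q : M} (h : ∀ᶠ y in 𝓝 q, IsPrimitiveAt V z y) (h' : ∀ᶠ y in 𝓝 q, IsPrimitiveAt V z' y) :
    ∀ᶠ y in 𝓝 q, z y - z q = z' y - z' q := by
  set φ := extChartAt 𝓘(ℝ, E) q with hφ
  have hq : q ∈ φ.source := mem_extChartAt_source q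
  have hφq : φ q ∈ φ.target := mem_extChartAt_target q
  have hlim : Tendsto φ.symm (𝓝 (φ q)) (𝓝 q) := by
    have := continuousAt_extChartAt_symm (I := 𝓘(ℝ, E)) q
    rwa [ContinuousAt, ← hφ, φ.left_inv hq] at this
  obtain ⟨r, hr, hball⟩ := Metric.mem_nhds_iff.1 (inter_mem
    ((isOpen_extChartAt_target q).mem_nhds hφq) (hlim.eventually (h.and h')))
  have hder : ∀ y ∈ Metric.ball (φ q) r,
      HasFDerivAt (fun y => z (φ.symm y) - z' (φ.symm y)) (0 : E →L[ℝ] ℝ) y := by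
    intro y hy
    obtain ⟨hyt, hz, hz'⟩ := hball hy
    have e0 := ((contMDiffAt_extChartAt_symm hyt).mdifferentiableAt (by simp)).hasMFDerivAt
    have e1 : HasFDerivAt (z ∘ φ.symm) _ y := (hz.1.hasMFDerivAt.comp y e0).hasFDerivAt
    have e2 : HasFDerivAt (z' ∘ φ.symm) _ y := (hz'.1.hasMFDerivAt.comp y e0).hasFDerivAt
    convert! e1.sub e2 using 1
    refine ContinuousLinearMap.ext fun v => ?_
    exact (sub_eq_zero.2 ((hz.2 (chartSymmDeriv q y v)).trans
      (hz'.2 (chartSymmDeriv q y v)).symm)).symm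
  filter_upwards [(isOpen_extChartAt_source q).mem_nhds hq,
    (continuousAt_extChartAt (I := 𝓘(ℝ, E)) q).eventually (Metric.ball_mem_nhds _ hr)] with y hys hy
  have := Metric.isOpen_ball.is_const_of_fderiv_eq_zero (𝕜 := ℝ)
    (convex_ball (φ q) r).isPreconnected
    (fun y hy => (hder y hy).differentiableAt.differentiableWithinAt)
    (fun y hy => (hder y hy).fderiv) hy (Metric.mem_ball_self hr)
  rw [φ.left_inv hys, φ.left_inv hq] at this
  linarith

theorem IsTangentCurve.eventually_eq {V : VField E M} {γ : ℝ → M} (h : IsTangentCurve V γ)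
    {z : M → ℝ} {t : ℝ} (hz : ∀ᶠ y in 𝓝 (γ t), IsPrimitiveAt V z y) :
    ∀ᶠ s in 𝓝 t, z (γ s) = z (γ t) := by
  obtain ⟨r, hr, hball⟩ := Metric.mem_nhds_iff.1 (h.1.continuous.continuousAt.eventually hz)
  have hder : ∀ s ∈ Metric.ball t r, HasDerivAt (z ∘ γ) 0 s := by
    intro s hs
    have e1 := (hball hs).hasDerivAt_comp (h.1.mdifferentiableAt one_ne_zero)
    rwa [h.2 s] at e1
  filter_upwards [Metric.ball_mem_nhds t hr] with s hs
  exact Metric.isOpen_ball.is_const_of_deriv_eq_zero (convex_ball t r).isPreconnected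
    (fun y hy => (hder y hy).differentiableAt.differentiableWithinAt)
    (fun y hy => (hder y hy).deriv) hs (Metric.mem_ball_self hr)

end Leaf

section LevelChart

variable {E : Type*} [NormedAddCommGroup E] [NormedSpace ℂ E] {M : Type*} [MetricSpace M]
  [ChartedSpace E M] [RiemannianBundle (fun x : M => TangentSpace 𝓘(ℝ, E) x)]

/-- A domain with a primitive of `ω(·, V)` whose levels lie in single leaves. -/
def IsLevelChart (V : VField E M) (W : Set M) (z : M → ℝ) : Prop :=
  LevelFoliation.IsBox (fun p q => q ∈ leaf V p) W z ∧ ∀ q ∈ W, IsPrimitiveAt V z q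

end LevelChart

end Kahler

/-! ### Level charts: the leaves as an abstract level foliation. -/

namespace Kahler

set_option maxSynthPendingDepth 3

open Filter Topology KillingField

section LevelChart

variable {E : Type*} [NormedAddCommGroup E] [NormedSpace ℂ E] {M : Type*} [MetricSpace M]
  [ChartedSpace E M] [IsManifold 𝓘(ℂ, E) ω M]
  [RiemannianBundle (fun x : M => TangentSpace 𝓘(ℝ, E) x)]

theorem isPrimitiveAt_comp_extChartAt (V : VField E M) {x : M} {ζ : E → ℝ} {y : E}
    (hy : y ∈ (extChartAt 𝓘(ℝ, E) x).target)
    (hζ : HasFDerivAt ζ (IsKahlerKilling.oneForm (localMetric x) (localField V x) y) y) :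
    IsPrimitiveAt V (ζ ∘ extChartAt 𝓘(ℝ, E) x) ((extChartAt 𝓘(ℝ, E) x).symm y) := by
  have hys := (extChartAt 𝓘(ℝ, E) x).map_target hy
  have hr := (extChartAt 𝓘(ℝ, E) x).right_inv hy
  refine ⟨?_, fun v => ?_⟩
  · refine MDifferentiableAt.comp (I' := 𝓘(ℝ, E)) _ ?_
      (mdifferentiableAt_extChartAt (by simpa using hys))
    rw [hr]
    exact hζ.hasMFDerivAt.mdifferentiableAt
  · rw [dirDeriv_eq hy hζ.differentiableAt
      (fun w hw => congrArg ζ ((extChartAt 𝓘(ℝ, E) x).right_inv hw)), hζ.fderiv,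
      IsKahlerKilling.oneForm_apply,
      localMetric_apply, chartSymmDeriv_I hy, chartSymmDeriv_comp' hy,
      chartSymmDeriv_localField V hy]
    exact real_inner_comm _ _

/-- A curve inside a level of a primitive has velocity in the kernel of `ω(·, V)`, which is the
distribution. -/
theorem mem_leaf_of_joinedBy (V : VField E M) {x : M} {ζ : E → ℝ} {W : Set E}
    (hW : ∀ y ∈ W, y ∈ (extChartAt 𝓘(ℝ, E) x).target ∧
      HasFDerivAt ζ (IsKahlerKilling.oneForm (localMetric x) (localField V x) y) y) {y y' : E}
    (h : Splitting.JoinedBy ζ W y y') :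
    (extChartAt 𝓘(ℝ, E) x).symm y' ∈ leaf V ((extChartAt 𝓘(ℝ, E) x).symm y) := by
  obtain ⟨c, hc, rfl, rfl, hcW⟩ := h
  have hγ : ContMDiff 𝓘(ℝ, ℝ) 𝓘(ℝ, E) 1 ((extChartAt 𝓘(ℝ, E) x).symm ∘ c) := fun t =>
    ((contMDiffAt_extChartAt_symm (hW _ (hcW t).1).1).of_le (by simp)).comp t (hc.contMDiff t)
  refine mem_leaf.2 ⟨_, ⟨hγ, fun t => ?_⟩, rfl, rfl⟩
  have h1 := (isPrimitiveAt_comp_extChartAt V (hW _ (hcW t).1).1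
    (hW _ (hcW t).1).2).hasDerivAt_comp (hγ.mdifferentiableAt one_ne_zero)
  refine h1.unique ?_
  have : (ζ ∘ extChartAt 𝓘(ℝ, E) x) ∘ (extChartAt 𝓘(ℝ, E) x).symm ∘ c = fun _ => ζ (c 0) := by
    funext s
    simp only [Function.comp_apply]
    rw [(extChartAt 𝓘(ℝ, E) x).right_inv (hW _ (hcW s).1).1, (hcW s).2]
  rw [this]
  exact hasDerivAt_const t _

variable [IsContMDiffRiemannianBundle 𝓘(ℝ, E) ∞ E (fun x : M => TangentSpace 𝓘(ℝ, E) x)]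
  [FiniteDimensional ℝ E]

theorem exists_isLevelChart (hE : Module.finrank ℂ E = 2) (hM : IsKahler E M) {V : VField E M}
    (hV : IsSymplecticKilling V) (x : M) {O : Set M} (hO : O ∈ 𝓝 x) :
    ∃ W z, IsLevelChart V W z ∧ x ∈ W ∧ W ⊆ O := by
  set φ := extChartAt 𝓘(ℝ, E) x with hφ
  have hx : x ∈ φ.source := mem_extChartAt_source x
  have hφx : φ x ∈ φ.target := mem_extChartAt_target x
  have h := isKahlerKilling hM hV x
  obtain ⟨ζ, hζ⟩ := h.exists_primitive hφx
  have hlim : Tendsto φ.symm (𝓝 (φ x)) (𝓝 x) := by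
    have := continuousAt_extChartAt_symm (I := 𝓘(ℝ, E)) x
    rwa [ContinuousAt, ← hφ, φ.left_inv hx] at this
  obtain ⟨W, hWN, hxW, hW⟩ := h.exists_isLevelBox hE hφx hζ _ (inter_mem
    (inter_mem ((isOpen_extChartAt_target x).mem_nhds hφx) hζ) (hlim hO))
  have hWt : ∀ y ∈ W, y ∈ φ.target ∧
      HasFDerivAt ζ (IsKahlerKilling.oneForm (localMetric x) (localField V x) y) y :=
    fun y hy => (hWN hy).1
  have hcs : ContinuousOn φ.symm W := fun y hy =>
    ((contMDiffAt_extChartAt_symm (hWt y hy).1).continuousAt).continuousWithinAt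
  have hW' : φ.symm '' W = φ.source ∩ φ ⁻¹' W :=
    φ.symm_image_eq_source_inter_preimage fun y hy => (hWt y hy).1
  have hprim : ∀ y ∈ W, IsPrimitiveAt V (ζ ∘ φ) (φ.symm y) := fun y hy =>
    isPrimitiveAt_comp_extChartAt V (hWt y hy).1 (hWt y hy).2
  have hval : ∀ y ∈ W, (ζ ∘ φ) (φ.symm y) = ζ y := fun y hy =>
    congrArg ζ (φ.right_inv (hWt y hy).1)
  have hopen : IsOpen (φ.symm '' W) := by
    rw [hW']
    exact (continuousOn_extChartAt x).isOpen_inter_preimage (isOpen_extChartAt_source x) hW.isOpen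
  refine ⟨φ.symm '' W, ζ ∘ φ, ⟨⟨hopen, hW.preconnected.image _ hcs, ?_, ?_, ?_⟩, ?_⟩,
    ⟨φ x, hxW, φ.left_inv hx⟩, ?_⟩
  · rintro _ ⟨y, hy, rfl⟩
    exact (hprim y hy).1.continuousAt.continuousWithinAt
  · rintro _ ⟨y, hy, rfl⟩ _ ⟨y', hy', rfl⟩ e
    rw [hval y hy, hval y' hy'] at e
    -- The box joins points of a level only by chains of `C¹` curves; transitivity of leaf
    -- membership absorbs the chain.
    have heq : Equivalence fun a b => φ.symm b ∈ leaf V (φ.symm a) :=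
      (leaf_equivalence V).comap φ.symm
    exact heq.eqvGen_iff.1
      (Relation.EqvGen.mono (fun _ _ => mem_leaf_of_joinedBy V hWt) _ _ (hW.level y hy y' hy' e))
  · rintro _ ⟨y, hy, rfl⟩ O' hO'
    obtain ⟨η, hη, H⟩ := hW.relOpen y hy _ ((hcs.continuousAt (hW.isOpen.mem_nhds hy)) hO')
    refine ⟨η, hη, ?_⟩
    rintro _ ⟨y', hy', rfl⟩ e
    rw [hval y hy, hval y' hy'] at e
    obtain ⟨p, hp, hpW, e'⟩ := H y' hy' e
    exact ⟨φ.symm p, hp, mem_image_of_mem _ hpW, by rw [hval p hpW, hval y' hy', e']⟩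
  · rintro _ ⟨y, hy, rfl⟩
    exact hprim y hy
  · rintro _ ⟨y, hy, rfl⟩
    exact (hWN hy).2

theorem foliation (hE : Module.finrank ℂ E = 2) (hM : IsKahler E M) {V : VField E M}
    (hV : IsSymplecticKilling V) :
    LevelFoliation.Foliation (fun p q => q ∈ leaf V p) (IsLevelChart V) where
  equiv := leaf_equivalence V
  isBox h := h.1
  exists_box x _ hO := exists_isLevelChart hE hM hV x hO
  compat h h' hq hq' := IsPrimitiveAt.eventually_sub_eq
    (eventually_of_mem (h.1.isOpen.mem_nhds hq) h.2)
    (eventually_of_mem (h'.1.isOpen.mem_nhds hq') h'.2)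
  path p q h := by
    obtain ⟨γ, hγ, h0, h1⟩ := mem_leaf.1 h
    exact ⟨γ, hγ.1.continuous, h0, h1, fun t W z hW ht =>
      hγ.eventually_eq (eventually_of_mem (hW.1.isOpen.mem_nhds ht) hW.2)⟩

end LevelChart

end Kahler

/-! ### The slope of the primitives outside the compact set. -/

namespace Kahler

set_option maxSynthPendingDepth 3

open Filter Topology Manifold

section Slope

variable {E : Type*} [NormedAddCommGroup E] [NormedSpace ℂ E] {M : Type*} [MetricSpace M]
  [ChartedSpace E M] [RiemannianBundle (fun x : M => TangentSpace 𝓘(ℝ, E) x)]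

theorem norm_J [IsManifold 𝓘(ℂ, E) ω M] (hM : IsKahler E M) (q : M)
    (v : TangentSpace 𝓘(ℝ, E) q) : ‖J q v‖ = ‖v‖ := by
  have h := hM.hermitian q v v
  rw [metric, metric, real_inner_self_eq_norm_sq, real_inner_self_eq_norm_sq] at h
  exact (sq_eq_sq₀ (norm_nonneg _) (norm_nonneg _)).1 h

theorem norm_chartSymmDeriv_lt {x₀ : M} {y w : E} {r : ℝ} (hr : 0 ≤ r)
    (h : localMetric x₀ y w w < r ^ 2) : ‖chartSymmDeriv x₀ y w‖ < r := by
  rw [localMetric_apply, real_inner_self_eq_norm_sq] at h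
  exact lt_of_pow_lt_pow_left₀ 2 hr h

variable [IsManifold 𝓘(ℂ, E) ω M]

omit [RiemannianBundle (fun x : M => TangentSpace 𝓘(ℝ, E) x)] in
/-- The velocity of a coordinate line. -/
theorem hasMFDerivAt_coordLine (x₀ : M) {y w : E} {t : ℝ}
    (ht : y + t • w ∈ (extChartAt 𝓘(ℝ, E) x₀).target) :
    HasMFDerivAt 𝓘(ℝ, ℝ) 𝓘(ℝ, E) (fun s : ℝ => (extChartAt 𝓘(ℝ, E) x₀).symm (y + s • w)) t
      ((chartSymmDeriv x₀ (y + t • w)).comp (ContinuousLinearMap.toSpanSingleton ℝ w)) := by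
  have h1 : HasFDerivAt (fun s : ℝ => y + s • w) (ContinuousLinearMap.toSpanSingleton ℝ w) t :=
    ((hasDerivAt_id t).smul_const w).const_add y |>.hasFDerivAt.congr_fderiv (by rw [one_smul])
  exact HasMFDerivAt.comp t ((contMDiffAt_extChartAt_symm ht).mdifferentiableAt
    (by simp)).hasMFDerivAt h1.hasMFDerivAt

variable [IsContMDiffRiemannianBundle 𝓘(ℝ, E) ∞ E (fun x : M => TangentSpace 𝓘(ℝ, E) x)]
  [IsRiemannianManifold 𝓘(ℝ, E) M] [FiniteDimensional ℝ E]

-- The distance of `M` is the Riemannian one, hence at most the length of the coordinate segment.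
omit [IsContMDiffRiemannianBundle 𝓘(ℝ, E) ∞ E (fun x : M => TangentSpace 𝓘(ℝ, E) x)]
  [FiniteDimensional ℝ E] in
theorem dist_coordLine_le {x₀ : M} {y w : E} {r t : ℝ} (hr : 0 ≤ r) (ht : 0 ≤ t)
    (h : ∀ s ∈ Icc 0 t, y + s • w ∈ (extChartAt 𝓘(ℝ, E) x₀).target ∧
      localMetric x₀ (y + s • w) w w < r ^ 2) :
    dist ((extChartAt 𝓘(ℝ, E) x₀).symm y) ((extChartAt 𝓘(ℝ, E) x₀).symm (y + t • w)) ≤ r * t := by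
  set γ : ℝ → M := fun s => (extChartAt 𝓘(ℝ, E) x₀).symm (y + s • w) with hγ
  have hγs : ContMDiffOn 𝓘(ℝ, ℝ) 𝓘(ℝ, E) 1 γ (Icc 0 t) := by
    intro s hs
    have h1 : ContMDiffAt 𝓘(ℝ, ℝ) 𝓘(ℝ, E) 1 (fun s : ℝ => y + s • w) s :=
      (ContDiff.contDiffAt (by fun_prop)).contMDiffAt
    exact (((contMDiffAt_extChartAt_symm (h s hs).1).of_le (by simp)).comp s h1).contMDiffWithinAt
  have h1 := riemannianEDist_le_pathELength hγs (x := γ 0) (y := γ t) rfl rfl ht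
  rw [← IsRiemannianManifold.out (I := 𝓘(ℝ, E)), pathELength_eq_lintegral_mfderiv_Icc] at h1
  have h2 : ∀ s ∈ Icc 0 t, ‖mfderiv 𝓘(ℝ, ℝ) 𝓘(ℝ, E) γ s (1 : ℝ)‖ₑ ≤ ENNReal.ofReal r := by
    intro s hs
    have h3 : mfderiv 𝓘(ℝ, ℝ) 𝓘(ℝ, E) γ s (1 : ℝ) = chartSymmDeriv x₀ (y + s • w) w := by
      have h4 : ∀ l : E →L[ℝ] E, l.comp (ContinuousLinearMap.toSpanSingleton ℝ w) 1 = l w := by simp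
      exact (congrArg (fun l : ℝ →L[ℝ] E => l 1)
        (hasMFDerivAt_coordLine x₀ (h s hs).1).mfderiv).trans
        (h4 _)
    rw [← ofReal_norm]
    refine ENNReal.ofReal_le_ofReal ?_
    exact h3 ▸ (norm_chartSymmDeriv_lt hr (h s hs).2).le
  have h3 : edist (γ 0) (γ t) ≤ ENNReal.ofReal (r * t) := by
    refine h1.trans ((MeasureTheory.setLIntegral_mono measurable_const h2).trans_eq ?_)
    rw [MeasureTheory.setLIntegral_const, Real.volume_Icc, sub_zero, ENNReal.ofReal_mul hr]
  rw [edist_dist, ENNReal.ofReal_le_ofReal_iff (by positivity)] at h3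
  simpa [hγ] using h3

/-- A function decreases with a slope that is at least its directional derivative. -/
theorem exists_lt_of_dirDeriv {x₀ q : M} (hq : q ∈ (extChartAt 𝓘(ℝ, E) x₀).source) {z : M → ℝ}
    (hz : MDifferentiableAt 𝓘(ℝ, E) 𝓘(ℝ, ℝ) z q) {v : TangentSpace 𝓘(ℝ, E) q} {ε : ℝ} (hε : 0 < ε)
    (h : ε * ‖v‖ < -dirDeriv z q v) {O : Set M} (hO : O ∈ 𝓝 q) :
    ∃ q' ∈ O, z q' < z q ∧ ε * dist q q' < z q - z q' := by
  obtain ⟨y, hy, rfl⟩ : ∃ y ∈ (extChartAt 𝓘(ℝ, E) x₀).target,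
      (extChartAt 𝓘(ℝ, E) x₀).symm y = q :=
    ⟨_, (extChartAt 𝓘(ℝ, E) x₀).map_source hq, (extChartAt 𝓘(ℝ, E) x₀).left_inv hq⟩
  obtain ⟨w, rfl⟩ : ∃ w, chartSymmDeriv x₀ y w = v := ⟨_, chartSymmDeriv_comp' hy v⟩
  set d := dirDeriv z _ (chartSymmDeriv x₀ y w) with hd
  -- A speed strictly between `‖v‖` and `-d / ε` leaves room on both sides: for short times the line
  -- is slower than `r`, while `z` falls faster than `ε r`.
  obtain ⟨r, hr, hrd⟩ := exists_between ((lt_div_iff₀' hε).2 h)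
  have hr0 : 0 ≤ r := (norm_nonneg _).trans hr.le
  rw [lt_div_iff₀' hε] at hrd
  set γ : ℝ → M := fun s => (extChartAt 𝓘(ℝ, E) x₀).symm (y + s • w) with hγ
  have hγ0 : γ 0 = (extChartAt 𝓘(ℝ, E) x₀).symm y := by simp [hγ]
  have hline : ContinuousAt (fun s : ℝ => y + s • w) 0 := by fun_prop
  have hy0 : y + (0 : ℝ) • w = y := by simp
  have hmet : ContinuousAt (fun y' => localMetric x₀ y' w w) y :=
    (hasFDerivAt_localMetric hy w w).1.continuousAt
  have hlt : localMetric x₀ y w w < r ^ 2 := by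
    rw [localMetric_apply, real_inner_self_eq_norm_sq]
    exact pow_lt_pow_left₀ hr (norm_nonneg _) two_ne_zero
  have hev : ∀ᶠ s in 𝓝 (0 : ℝ), y + s • w ∈ (extChartAt 𝓘(ℝ, E) x₀).target ∧
      localMetric x₀ (y + s • w) w w < r ^ 2 := by
    rw [ContinuousAt, hy0] at hline
    exact hline.eventually (((isOpen_extChartAt_target x₀).eventually_mem hy).and
      (hmet.eventually_lt_const hlt))
  obtain ⟨δ, hδ, hball⟩ := Metric.mem_nhds_iff.1 hev
  have hγd := hasMFDerivAt_coordLine x₀ (t := 0) (w := w) (y := y) (by rwa [hy0])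
  have hder : HasDerivAt (fun s => z (γ s)) d 0 := by
    have h1 : ∀ l : E →L[ℝ] ℝ, HasFDerivAt (z ∘ (extChartAt 𝓘(ℝ, E) x₀).symm) l y →
        HasDerivAt (fun s => z (γ s)) (l w) 0 := by
      intro l hl
      have h2 : HasDerivAt (fun s : ℝ => y + s • w) w 0 := by
        simpa using ((hasDerivAt_id (0 : ℝ)).smul_const w).const_add y
      exact hl.comp_hasDerivAt_of_eq 0 h2 hy0.symm
    exact h1 _ (hz.hasMFDerivAt.comp y ((contMDiffAt_extChartAt_symm hy).mdifferentiableAt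
      (by simp)).hasMFDerivAt).hasFDerivAt
  have hO' : ∀ᶠ s in 𝓝[>] (0 : ℝ), γ s ∈ O := by
    have : ContinuousAt γ 0 := hγd.continuousAt
    rw [ContinuousAt, hγ0] at this
    exact (this.eventually_mem hO).filter_mono nhdsWithin_le_nhds
  have hs := hder.tendsto_slope_zero_right.eventually_lt_const (show d < -(ε * r) by linarith)
  obtain ⟨t, ⟨⟨ht, htO⟩, ht0, htδ⟩⟩ := ((hs.and hO').and (Ioo_mem_nhdsGT hδ)).exists
  have hdist := dist_coordLine_le (x₀ := x₀) hr0 ht0.le fun s hs => hball (by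
    rw [Metric.mem_ball, Real.dist_eq, sub_zero, abs_of_nonneg hs.1]
    exact hs.2.trans_lt htδ)
  rw [zero_add, hγ0, smul_eq_mul, inv_mul_lt_iff₀ ht0] at ht
  have h5 : ε * dist ((extChartAt 𝓘(ℝ, E) x₀).symm y) (γ t) ≤ ε * (r * t) :=
    mul_le_mul_of_nonneg_left hdist hε.le
  have h6 : 0 ≤ ε * dist ((extChartAt 𝓘(ℝ, E) x₀).symm y) (γ t) := by positivity
  exact ⟨γ t, htO, by linarith, by linarith⟩

omit [IsManifold 𝓘(ℂ, E) ω M] [IsRiemannianManifold 𝓘(ℝ, E) M] [FiniteDimensional ℝ E]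
  [IsContMDiffRiemannianBundle 𝓘(ℝ, E) ∞ E (fun x : M => TangentSpace 𝓘(ℝ, E) x)] in
theorem IsPrimitiveAt.dirDeriv_J {V : VField E M} {z : M → ℝ} {q : M}
    (hz : IsPrimitiveAt V z q) : dirDeriv z q (J q (V q)) = -(‖V q‖ * ‖V q‖) := by
  have hJ : J q (J q (V q)) = -V q := by
    have : ∀ v : E, Complex.I • Complex.I • v = -v := fun v => by
      rw [smul_smul, Complex.I_mul_I, neg_one_smul]
    exact this (V q)
  rw [hz.2, kahlerForm, hJ, inner_neg_left, real_inner_self_eq_norm_mul_norm]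

/-- Along `J V` the primitive decreases at the rate `‖V‖²`, while `‖J V‖ = ‖V‖ > ε` outside `K`. -/
theorem hasSlope (hM : IsKahler E M) {V : VField E M} {K : Set M} {ε : ℝ} (hε : 0 < ε)
    (hVK : ∀ x : M, x ∉ K → ε < ‖V x‖) : LevelFoliation.HasSlope (IsLevelChart V) K ε := by
  intro q hq W z hW hqW O hO
  have hz := hW.2 q hqW
  obtain ⟨q', ⟨h2, h3⟩, h4⟩ := exists_lt_of_dirDeriv (mem_extChartAt_source (I := 𝓘(ℝ, E)) q)
    hz.1 (v := J q (V q)) hε (by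
      rw [norm_J hM, hz.dirDeriv_J, neg_neg]
      exact mul_lt_mul_of_pos_right (hVK q hq) (hε.trans (hVK q hq)))
    (inter_mem hO (hW.1.isOpen.mem_nhds hqW))
  exact ⟨q', h2, h3, h4⟩

theorem hasSlope_neg (hM : IsKahler E M) {V : VField E M} {K : Set M} {ε : ℝ} (hε : 0 < ε)
    (hVK : ∀ x : M, x ∉ K → ε < ‖V x‖) :
    LevelFoliation.HasSlope (fun W z => IsLevelChart V W (-z)) K ε := by
  intro q hq W z hW hqW O hO
  have hz := hW.2 q hqW
  have hz' : MDifferentiableAt 𝓘(ℝ, E) 𝓘(ℝ, ℝ) z q := by simpa using hz.1.neg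
  have h1 : dirDeriv z q (-J q (V q)) = -(‖V q‖ * ‖V q‖) := by
    have h2 : dirDeriv (-z) q (J q (V q)) = -dirDeriv z q (J q (V q)) :=
      congrArg (fun l : E →L[ℝ] ℝ => l (J q (V q))) hz'.hasMFDerivAt.neg.mfderiv
    rw [← hz.dirDeriv_J, h2]
    exact map_neg (mfderiv 𝓘(ℝ, E) 𝓘(ℝ, ℝ) z q) _
  obtain ⟨q', ⟨h2, h3⟩, h4⟩ := exists_lt_of_dirDeriv (mem_extChartAt_source (I := 𝓘(ℝ, E)) q)
    hz' (v := -J q (V q)) hε (by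
      rw [norm_neg, norm_J hM, h1, neg_neg]
      exact mul_lt_mul_of_pos_right (hVK q hq) (hε.trans (hVK q hq)))
    (inter_mem hO (hW.1.isOpen.mem_nhds hqW))
  exact ⟨q', h2, h3, h4⟩

end Slope

end Kahler

theorem theorem1p1 {E : Type*} [NormedAddCommGroup E] [NormedSpace ℂ E]
    (hE : Module.finrank ℂ E = 2)
    {M : Type*} [MetricSpace M] [CompleteSpace M] [ConnectedSpace M]
    [ChartedSpace E M] [IsManifold 𝓘(ℂ, E) ω M]
    [RiemannianBundle (fun x : M => TangentSpace 𝓘(ℝ, E) x)]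
    [IsContMDiffRiemannianBundle 𝓘(ℝ, E) ∞ E (fun x : M => TangentSpace 𝓘(ℝ, E) x)]
    [IsRiemannianManifold 𝓘(ℝ, E) M]
    (hM : Kahler.IsKahler E M)
    (V : Kahler.VField E M) (hV : Kahler.IsSymplecticKilling V)
    (K : Set M) (hK : IsCompact K) (ε : ℝ) (hε : 0 < ε)
    (hVK : ∀ x : M, x ∉ K → ε < ‖V x‖) :
    (∀ p : M, IsCompact (Kahler.leaf V p)) ∨ (∀ p : M, ¬ IsCompact (Kahler.leaf V p)) := by
  have : FiniteDimensional ℂ E := .of_finrank_pos (by omega)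
  have : FiniteDimensional ℝ E := .complexToReal E
  have : LocallyCompactSpace M := Manifold.locallyCompact_of_finiteDimensional 𝓘(ℝ, E)
  by_cases h : ∃ p, IsCompact (Kahler.leaf V p)
  · obtain ⟨p, hp⟩ := h
    exact .inl fun q => (Kahler.foliation hE hM hV).isCompact_class hK hε
      (Kahler.hasSlope hM hε hVK) (Kahler.hasSlope_neg hM hε hVK) (x := p) hp q
  · exact .inr fun p hp => h ⟨p, hp⟩
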